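/- Let $m\ge 1$ and let $(N^{2m+1},\varphi,\varsigma,\eta,g)$ be a non-empty $(k,\mu)'$-almost Kenmotsu manifold. That is, $N$ is a smooth Hausdorff manifold of dimension $2m+1$ with a smooth Riemannian metric $g$, a smooth $(1,1)$-tensor field $\varphi$, a smooth vector field $\varsigma$ and a smooth $1$-form $\eta$ such that $$\varphi^2U=-U+\eta(U)\varsigma,\qquad \eta(\varsigma)=1,\qquad g(\varphi U,\varphi V)=g(U,V)-\eta(U)\eta(V),$$ $$d\eta=0,\qquad d\Phi=2\,\eta\wedge\Phi\quad\text{where }\Phi(U,V)=g(U,\varphi V),$$ and, for some real constants $k,\mu$, with $h=\tfrac12\pounds_\varsigma\varphi$ and $h'=h\circ\varphi$, $$R(U,V)\varsigma=k\big(\eta(V)U-\eta(U)V\big)+\mu\big(\eta(V)h'U-\eta(U)h'V\big)$$ for all vector fields $U,V$. Here $R(U,V)W=\nabla_U\nabla_VW-\nabla_V\nabla_UW-\nabla_{[U,V]}W$ is the curvature tensor of the Levi-Civita connection, $S$ is the Ricci tensor and $r$ is the scalar curvature. Let $X$ be a smooth conformal vector field, $\pounds_Xg=2\rho g$ with $\rho$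 a smooth function on $N$, and let $\alpha_1,\beta_1,\lambda_1,\nu_1$ be real constants such that $X$ is the potential field of an $\eta$-Ricci-Yamabe soliton: $$\pounds_Xg+2\alpha_1S+(2\lambda_1-\beta_1r)g+2\nu_1\,\eta\otimes\eta=0 .$$ Then $\rho$ is constant, and in fact $\rho=0$; the soliton constants are $$\lambda_1=\beta_1m(k-2m)-\rho+2m\alpha_1,\qquad \nu_1=-2m\alpha_1(k+1);$$ and, if $\alpha_1\neq0$, the manifold is Einstein, i.e. $S=c\,g$ for some constant $c$. -/

import Mathlib

open Bundle VectorField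
open scoped Manifold ContDiff

set_option linter.unusedSectionVars false

namespace AlmostKenmotsu

noncomputable section

variable {E : Type*} [NormedAddCommGroup E] [NormedSpace ℝ E] [FiniteDimensional ℝ E]
  [CompleteSpace E]
  {H : Type*} [TopologicalSpace H] (I : ModelWithCorners ℝ E H)
  {M : Type*} [TopologicalSpace M] [ChartedSpace H M] [IsManifold I ∞ M]
  [RiemannianBundle (fun x : M => TangentSpace I x)]
  [IsContMDiffRiemannianBundle I ∞ E (fun x : M => TangentSpace I x)]

instance instFiniteDimensionalTangentSpace (x : M) : FiniteDimensional ℝ (TangentSpace I x) :=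
  inferInstanceAs (FiniteDimensional ℝ E)

/-! ### The Levi-Civita connection of the Riemannian metric `g = ⟪·, ·⟫` -/

/-- The right-hand side of the Koszul formula for `g (∇_X Y, Z)` at `x`. -/
def koszul (X Y Z : Π x : M, TangentSpace I x) (x : M) : ℝ :=
  (1 / 2) * (d% (fun y => inner ℝ (Y y) (Z y)) x (X x)
    + d% (fun y => inner ℝ (Z y) (X y)) x (Y x)
    - d% (fun y => inner ℝ (X y) (Y y)) x (Z x)
    + inner ℝ (mlieBracket I X Y x) (Z x)
    - inner ℝ (mlieBracket I Y Z x) (X x)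
    + inner ℝ (mlieBracket I Z X x) (Y x))

variable {I}

theorem mdifferentiableAt_inner {x : M} {Y Z : Π x : M, TangentSpace I x}
    (hY : MDiffAt (T% Y) x) (hZ : MDiffAt (T% Z) x) :
    MDiffAt (fun y => inner ℝ (Y y) (Z y)) x :=
  MDifferentiableAt.inner_bundle (IB := I) (F := E) (E := fun x : M => TangentSpace I x)
    (by exact hY) (by exact hZ)

theorem koszul_tensorial_left (Y Z : Π x : M, TangentSpace I x) (x : M)
    (hY : MDiffAt (T% Y) x) (hZ : MDiffAt (T% Z) x) :
    TensorialAt I E (fun X => koszul I X Y Z x) x where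
  smul {f X} hf hX := by
    have h1 := mdifferentiableAt_inner hZ hX
    have h2 := mdifferentiableAt_inner hX hY
    simp [koszul, inner_smul_left, inner_smul_right, mvfderiv_fun_mul hf h1,
      mvfderiv_fun_mul hf h2, mlieBracket_smul_left hf hX, mlieBracket_smul_right hf hX,
      inner_add_left]
    rw [real_inner_comm (X x) (Z x)]
    ring
  add {X X'} hX hX' := by
    simp [koszul, inner_add_left, inner_add_right, mlieBracket_add_left hX hX',
      mlieBracket_add_right hX hX',
      mvfderiv_fun_add (mdifferentiableAt_inner hZ hX) (mdifferentiableAt_inner hZ hX'),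
      mvfderiv_fun_add (mdifferentiableAt_inner hX hY) (mdifferentiableAt_inner hX' hY)]
    ring

theorem koszul_tensorial_right (X Y : Π x : M, TangentSpace I x) (x : M)
    (hX : MDiffAt (T% X) x) (hY : MDiffAt (T% Y) x) :
    TensorialAt I E (fun Z => koszul I X Y Z x) x where
  smul {f Z} hf hZ := by
    have h1 := mdifferentiableAt_inner hZ hX
    have h2 := mdifferentiableAt_inner hY hZ
    simp [koszul, inner_smul_left, inner_smul_right, mvfderiv_fun_mul hf h1,
      mvfderiv_fun_mul hf h2, mlieBracket_smul_left hf hZ, mlieBracket_smul_right hf hZ,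
      inner_add_left]
    rw [real_inner_comm (X x) (Z x), real_inner_comm (Y x) (Z x)]
    ring
  add {Z Z'} hZ hZ' := by
    simp [koszul, inner_add_left, inner_add_right, mlieBracket_add_left hZ hZ',
      mlieBracket_add_right hZ hZ',
      mvfderiv_fun_add (mdifferentiableAt_inner hZ hX) (mdifferentiableAt_inner hZ' hX),
      mvfderiv_fun_add (mdifferentiableAt_inner hY hZ) (mdifferentiableAt_inner hY hZ')]
    ring

variable (I) in
open Classical in
/-- The covariant differential `∇Y` at `x`, obtained from the Koszul formula by dualizing with the
metric (and given the junk value `0` where `Y` is not differentiable). -/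
def leviCivitaFun (Y : Π x : M, TangentSpace I x) (x : M) :
    TangentSpace I x →L[ℝ] TangentSpace I x :=
  if hY : MDiffAt (T% Y) x then
    ∑ i, ((TensorialAt.mkHom₂ (fun X Z => koszul I X Y Z x) x
      (fun Z hZ => koszul_tensorial_left Y Z x hY hZ)
      (fun X hX => koszul_tensorial_right X Y x hX hY)).flip
        (stdOrthonormalBasis ℝ (TangentSpace I x) i)).smulRight
          (stdOrthonormalBasis ℝ (TangentSpace I x) i)
  else 0

/-- The Koszul formula. -/
theorem inner_leviCivitaFun {X Y Z : Π x : M, TangentSpace I x} {x : M} (hX : MDiffAt (T% X) x)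
    (hY : MDiffAt (T% Y) x) (hZ : MDiffAt (T% Z) x) :
    inner ℝ (leviCivitaFun I Y x (X x)) (Z x) = koszul I X Y Z x := by
  rw [← TensorialAt.mkHom₂_apply (Φ := fun X Z => koszul I X Y Z x) (x := x)
      (fun Z hZ => koszul_tensorial_left Y Z x hY hZ)
      (fun X hX => koszul_tensorial_right X Y x hX hY) hX hZ]
  rw [leviCivitaFun, dif_pos hY]
  set B := (TensorialAt.mkHom₂ (fun X Z => koszul I X Y Z x) x
      (fun Z hZ => koszul_tensorial_left Y Z x hY hZ)
      (fun X hX => koszul_tensorial_right X Y x hX hY))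
  set b := stdOrthonormalBasis ℝ (TangentSpace I x)
  conv_rhs => rw [← b.sum_repr (Z x)]
  simp [sum_inner, inner_smul_left, b.repr_apply_apply, mul_comm]

theorem tangentHom_ext {x : M} {L L' : TangentSpace I x →L[ℝ] TangentSpace I x}
    (h : ∀ X Z : Π x : M, TangentSpace I x, MDiffAt (T% X) x → MDiffAt (T% Z) x →
      inner ℝ (L (X x)) (Z x) = inner ℝ (L' (X x)) (Z x)) : L = L' := by
  ext1 u
  refine ext_inner_right ℝ fun v => ?_
  simpa using h (FiberBundle.extend E u) (FiberBundle.extend E v)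
    (FiberBundle.mdifferentiableAt_extend ..) (FiberBundle.mdifferentiableAt_extend ..)

theorem koszul_add {X Y Y' Z : Π x : M, TangentSpace I x} {x : M} (hX : MDiffAt (T% X) x)
    (hY : MDiffAt (T% Y) x) (hY' : MDiffAt (T% Y') x) (hZ : MDiffAt (T% Z) x) :
    koszul I X (Y + Y') Z x = koszul I X Y Z x + koszul I X Y' Z x := by
  simp [koszul, inner_add_left, inner_add_right, mlieBracket_add_left hY hY',
    mlieBracket_add_right hY hY',
    mvfderiv_fun_add (mdifferentiableAt_inner hY hZ) (mdifferentiableAt_inner hY' hZ),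
    mvfderiv_fun_add (mdifferentiableAt_inner hX hY) (mdifferentiableAt_inner hX hY')]
  ring

theorem koszul_smul {X Y Z : Π x : M, TangentSpace I x} {f : M → ℝ} {x : M}
    (hX : MDiffAt (T% X) x) (hY : MDiffAt (T% Y) x) (hZ : MDiffAt (T% Z) x) (hf : MDiffAt f x) :
    koszul I X (f • Y) Z x = f x * koszul I X Y Z x + d% f x (X x) * inner ℝ (Y x) (Z x) := by
  have h1 := mdifferentiableAt_inner hX hY
  have h2 := mdifferentiableAt_inner hY hZ
  simp [koszul, inner_smul_left, inner_smul_right, mvfderiv_fun_mul hf h1,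
    mvfderiv_fun_mul hf h2, mlieBracket_smul_left hf hY, mlieBracket_smul_right hf hY,
    inner_add_left]
  rw [real_inner_comm (X x) (Y x)]
  ring

variable (I M) in
/-- The Levi-Civita connection. In Mathlib's argument order, `leviCivita I M Y x u` is `∇_u Y`
at the point `x`. -/
def leviCivita : CovariantDerivative I E (fun x : M => TangentSpace I x) where
  toFun := leviCivitaFun I
  isCovariantDerivativeOnUniv :=
    { add := fun {Y Y' x} hY hY' _ => tangentHom_ext fun X Z hX hZ => by
        have h : MDiffAt (T% (Y + Y')) x := mdifferentiableAt_add_section hY hY'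
        simp [inner_leviCivitaFun hX hY hZ, inner_leviCivitaFun hX hY' hZ,
          inner_leviCivitaFun hX h hZ, koszul_add hX hY hY' hZ, inner_add_left]
      leibniz := fun {Y f x} hY hf _ => tangentHom_ext fun X Z hX hZ => by
        have h : MDiffAt (T% (f • Y)) x := hf.smul_section hY
        simp [inner_leviCivitaFun hX hY hZ, inner_leviCivitaFun hX h hZ,
          koszul_smul hX hY hZ hf, inner_add_left, inner_smul_left] }

/-- The Levi-Civita connection is torsion free. -/
theorem leviCivita_torsionFree {X Y : Π x : M, TangentSpace I x} {x : M} (hX : MDiffAt (T% X) x)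
    (hY : MDiffAt (T% Y) x) :
    leviCivita I M Y x (X x) - leviCivita I M X x (Y x) = mlieBracket I X Y x := by
  refine ext_inner_right ℝ fun v => ?_
  have hv := FiberBundle.mdifferentiableAt_extend I E v
  have h1 := inner_leviCivitaFun hX hY hv
  have h2 := inner_leviCivitaFun hY hX hv
  rw [FiberBundle.extend_apply_self] at h1 h2
  rw [inner_sub_left]
  erw [h1, h2]
  have e (A B : Π x : M, TangentSpace I x) :
      (fun y => inner ℝ (A y) (B y)) = (fun y => inner ℝ (B y) (A y)) := by
    ext y; exact real_inner_comm _ _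
  simp only [koszul, FiberBundle.extend_apply_self]
  rw [e (FiberBundle.extend E v) X, e (FiberBundle.extend E v) Y, e Y X,
    mlieBracket_swap_apply (V := Y) (W := X),
    mlieBracket_swap_apply (V := FiberBundle.extend E v) (W := X),
    mlieBracket_swap_apply (V := FiberBundle.extend E v) (W := Y)]
  simp only [inner_neg_left]
  ring

/-- The Levi-Civita connection is compatible with the metric. -/
theorem leviCivita_metric {X Y Z : Π x : M, TangentSpace I x} {x : M} (hX : MDiffAt (T% X) x)
    (hY : MDiffAt (T% Y) x) (hZ : MDiffAt (T% Z) x) :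
    d% (fun y => inner ℝ (Y y) (Z y)) x (X x) =
      inner ℝ (leviCivita I M Y x (X x)) (Z x) + inner ℝ (Y x) (leviCivita I M Z x (X x)) := by
  rw [real_inner_comm _ (Y x)]
  erw [inner_leviCivitaFun hX hY hZ, inner_leviCivitaFun hX hZ hY]
  have e (A B : Π x : M, TangentSpace I x) :
      (fun y => inner ℝ (A y) (B y)) = (fun y => inner ℝ (B y) (A y)) := by
    ext y; exact real_inner_comm _ _
  simp only [koszul]
  rw [e Z Y, e X Z, e Y X, mlieBracket_swap_apply (V := Z) (W := Y),
    mlieBracket_swap_apply (V := Z) (W := X), mlieBracket_swap_apply (V := Y) (W := X)]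
  simp only [inner_neg_left]
  ring

/-! ### Curvature -/

variable (I)

/-- `R(U, V)W = ∇_U ∇_V W - ∇_V ∇_U W - ∇_[U,V] W` for vector fields. -/
def curvatureField (U V W : Π x : M, TangentSpace I x) (x : M) : TangentSpace I x :=
  leviCivita I M (fun y => leviCivita I M W y (V y)) x (U x)
    - leviCivita I M (fun y => leviCivita I M W y (U y)) x (V x)
    - leviCivita I M W x (mlieBracket I U V x)

/-- The curvature tensor `R(u, v)w` on tangent vectors at `x`, computed by extending them to
vector fields that are smooth near `x` (the value is independent of the extensions). -/
def curvature (x : M) (u v w : TangentSpace I x) : TangentSpace I x :=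
  curvatureField I (FiberBundle.extend E u) (FiberBundle.extend E v) (FiberBundle.extend E w) x

/-- The Ricci tensor `S(u, v)`, the trace of `w ↦ R(w, u)v`. -/
def ricci (x : M) (u v : TangentSpace I x) : ℝ :=
  ∑ i, inner ℝ (curvature I x (stdOrthonormalBasis ℝ (TangentSpace I x) i) u v)
    (stdOrthonormalBasis ℝ (TangentSpace I x) i)

/-- The scalar curvature `r`, the metric trace of the Ricci tensor. -/
def scalarCurvature (x : M) : ℝ :=
  ∑ i, ricci I x (stdOrthonormalBasis ℝ (TangentSpace I x) i)
    (stdOrthonormalBasis ℝ (TangentSpace I x) i)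

variable (M) in
/-- The Ricci tensor is a constant multiple of the metric. -/
def IsEinstein : Prop :=
  ∃ c : ℝ, ∀ (x : M) (u v : TangentSpace I x), ricci I x u v = c * inner ℝ u v

/-! ### Lie derivative of the metric, exterior derivatives

All the expressions in this section are tensorial in the vector fields `U, V, W`. -/

/-- `(L_X g)(U, V) = X(g(U, V)) - g([X, U], V) - g(U, [X, V])`. -/
def lieDerivMetric (X U V : Π x : M, TangentSpace I x) (x : M) : ℝ :=
  d% (fun y => inner ℝ (U y) (V y)) x (X x)
    - inner ℝ (mlieBracket I X U x) (V x) - inner ℝ (U x) (mlieBracket I X V x)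

/-- `dη(U, V) = U(η(V)) - V(η(U)) - η([U, V])`. -/
def extDerivOneForm (η : Π x : M, TangentSpace I x →L[ℝ] ℝ)
    (U V : Π x : M, TangentSpace I x) (x : M) : ℝ :=
  d% (fun y => η y (V y)) x (U x) - d% (fun y => η y (U y)) x (V x)
    - η x (mlieBracket I U V x)

/-- The fundamental form `Φ(u, v) = g(u, φ v)`. -/
def fundamentalForm (φ : Π x : M, TangentSpace I x →L[ℝ] TangentSpace I x) (x : M)
    (u v : TangentSpace I x) : ℝ :=
  inner ℝ u (φ x v)

/-- The exterior derivative of a 2-form `Φ`, evaluated on vector fields. -/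
def extDerivTwoForm (Φ : Π x : M, TangentSpace I x → TangentSpace I x → ℝ)
    (U V W : Π x : M, TangentSpace I x) (x : M) : ℝ :=
  d% (fun y => Φ y (V y) (W y)) x (U x) - d% (fun y => Φ y (U y) (W y)) x (V x)
    + d% (fun y => Φ y (U y) (V y)) x (W x)
    - Φ x (mlieBracket I U V x) (W x) + Φ x (mlieBracket I U W x) (V x)
    - Φ x (mlieBracket I V W x) (U x)

/-- The wedge product `η ∧ Φ` of a 1-form and a 2-form. -/
def wedgeOneTwo (η : Π x : M, TangentSpace I x →L[ℝ] ℝ)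
    (Φ : Π x : M, TangentSpace I x → TangentSpace I x → ℝ) (x : M)
    (u v w : TangentSpace I x) : ℝ :=
  η x u * Φ x v w - η x v * Φ x u w + η x w * Φ x u v

/-! ### Almost Kenmotsu manifolds -/

/-- `(φ, ξ, η, g)` is an almost contact metric structure, `g` being the Riemannian metric of `M`.
Here `φ` is a smooth (1,1)-tensor field, `ξ` a smooth vector field (the Reeb field) and `η` a
smooth 1-form. -/
structure IsAlmostContactMetric (φ : Π x : M, TangentSpace I x →L[ℝ] TangentSpace I x)
    (ξ : Π x : M, TangentSpace I x) (η : Π x : M, TangentSpace I x →L[ℝ] ℝ) : Prop where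
  smooth_phi : ContMDiff I (I.prod 𝓘(ℝ, E →L[ℝ] E)) ∞ fun x =>
    TotalSpace.mk' (E →L[ℝ] E) (E := fun x : M => TangentSpace I x →L[ℝ] TangentSpace I x) x (φ x)
  smooth_xi : ContMDiff I (I.prod 𝓘(ℝ, E)) ∞ (T% ξ)
  smooth_eta : ContMDiff I (I.prod 𝓘(ℝ, E →L[ℝ] ℝ)) ∞ fun x =>
    TotalSpace.mk' (E →L[ℝ] ℝ) (E := fun x : M => TangentSpace I x →L[ℝ] ℝ) x (η x)
  phi_phi : ∀ (x : M) (u : TangentSpace I x), φ x (φ x u) = -u + η x u • ξ x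
  eta_xi : ∀ x : M, η x (ξ x) = 1
  inner_phi : ∀ (x : M) (u v : TangentSpace I x),
    inner ℝ (φ x u) (φ x v) = inner ℝ u v - η x u * η x v

/-- An almost contact metric structure with `dη = 0` and `dΦ = 2 η ∧ Φ`. -/
structure IsAlmostKenmotsu (φ : Π x : M, TangentSpace I x →L[ℝ] TangentSpace I x)
    (ξ : Π x : M, TangentSpace I x) (η : Π x : M, TangentSpace I x →L[ℝ] ℝ) : Prop
    extends IsAlmostContactMetric I φ ξ η where
  d_eta : ∀ (x : M) (U V : Π x : M, TangentSpace I x),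
    MDiffAt (T% U) x → MDiffAt (T% V) x → extDerivOneForm I η U V x = 0
  d_Phi : ∀ (x : M) (U V W : Π x : M, TangentSpace I x),
    MDiffAt (T% U) x → MDiffAt (T% V) x → MDiffAt (T% W) x →
    extDerivTwoForm I (fundamentalForm I φ) U V W x
      = 2 * wedgeOneTwo I η (fundamentalForm I φ) x (U x) (V x) (W x)

/-- `h = (1/2) L_ξ φ`, that is `h(U) = (1/2) ([ξ, φ U] - φ [ξ, U])`, on tangent vectors. -/
def hTensor (φ : Π x : M, TangentSpace I x →L[ℝ] TangentSpace I x)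
    (ξ : Π x : M, TangentSpace I x) (x : M) (u : TangentSpace I x) : TangentSpace I x :=
  (1 / 2 : ℝ) • (mlieBracket I ξ (fun y => φ y (FiberBundle.extend E u y)) x
    - φ x (mlieBracket I ξ (FiberBundle.extend E u) x))

/-- `h' = h ∘ φ`. -/
def hPrime (φ : Π x : M, TangentSpace I x →L[ℝ] TangentSpace I x)
    (ξ : Π x : M, TangentSpace I x) (x : M) (u : TangentSpace I x) : TangentSpace I x :=
  hTensor I φ ξ x (φ x u)

/-- A `(k, μ)'`-almost Kenmotsu structure: an almost Kenmotsu structure whose Reeb field belongs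
to the `(k, μ)'`-nullity distribution, with constant `k` and `μ`. -/
structure IsKMuPrimeAlmostKenmotsu (φ : Π x : M, TangentSpace I x →L[ℝ] TangentSpace I x)
    (ξ : Π x : M, TangentSpace I x) (η : Π x : M, TangentSpace I x →L[ℝ] ℝ) (k μ : ℝ) : Prop
    extends IsAlmostKenmotsu I φ ξ η where
  nullity : ∀ (x : M) (u v : TangentSpace I x),
    curvature I x u v (ξ x) = k • (η x v • u - η x u • v)
      + μ • (η x v • hPrime I φ ξ x u - η x u • hPrime I φ ξ x v)

/-! ### Conformal vector fields and solitons -/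

/-- `X` is a smooth vector field with `L_X g = 2 ρ g`, where `ρ` is a smooth function. -/
structure IsConformalVectorField (X : Π x : M, TangentSpace I x) (ρ : M → ℝ) : Prop where
  smooth_field : ContMDiff I (I.prod 𝓘(ℝ, E)) ∞ (T% X)
  smooth_factor : ContMDiff I 𝓘(ℝ, ℝ) ∞ ρ
  lieDeriv_eq : ∀ (x : M) (U V : Π x : M, TangentSpace I x),
    MDiffAt (T% U) x → MDiffAt (T% V) x →
    lieDerivMetric I X U V x = 2 * ρ x * inner ℝ (U x) (V x)

/-- The `η`-Ricci-Yamabe soliton equation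
`L_X g + 2 α S + (2 λ - β r) g + 2 ν η ⊗ η = 0` with potential field `X`. -/
def IsEtaRicciYamabeSoliton (η : Π x : M, TangentSpace I x →L[ℝ] ℝ)
    (X : Π x : M, TangentSpace I x) (α β lam ν : ℝ) : Prop :=
  ∀ (x : M) (U V : Π x : M, TangentSpace I x), MDiffAt (T% U) x → MDiffAt (T% V) x →
    lieDerivMetric I X U V x + 2 * α * ricci I x (U x) (V x)
      + (2 * lam - β * scalarCurvature I x) * inner ℝ (U x) (V x)
      + 2 * ν * (η x (U x) * η x (V x)) = 0

end

end AlmostKenmotsu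

/-! Every conclusion is local, with constants independent of the point. Near a point there is a
smooth orthonormal frame, and there the smooth functions `A` and the smooth fields form a purely
algebraic object, `FramedGeometry`. The geometry is proved in that setting (`conformal_soliton`) and
then carried back to the manifold. Below, n = 2m+1, P is the projection orthogonal to ξ,
"horizontal" means orthogonal to ξ, and B = ∇ξ - P (`shape`) is the tensor h'.

Structure: dη = 0 makes B symmetric; dΦ = 2η∧Φ gives ∇_ξ φ = 0 and φB = -Bφ. The nullity condition
gives a Riccati equation for B along ξ. Its part commuting with φ is B² = -(k+1)P, so k ≤ -1, and
the rest gives (μ+2)(k+1)P = 0.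

One more general tool is needed: for a conformal field, X r = -2ρr - 2(n-1)Δρ
(`IsConformal.D_scal`). It comes from the Lie derivative of the connection and the second Bianchi
identity. In particular, constant ρ implies ρr = 0 when r is constant along X.

Case k < -1. Then μ = -2, the horizontal parts of ∇B and ∇φ vanish, and the Ricci identities for B
and φ force the leaves orthogonal to ξ to be flat. Hence Ric = -2m(g + g(B·,·)) on horizontal
vectors and r = 2m(k-2m), a nonzero constant. Since B anticommutes with φ and is not zero, Ric is
not proportional to g horizontally, so the soliton equation forces α = 0. Then ν = 0 and 2ρ = βr -
2λ is constant, hence ρ = 0.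

Case k = -1. Then B² = 0, so B = 0 and ∇ξ = P, which yields ξr = -2(r + n(n-1)). If α ≠ 0, the (ξ,ξ)
component of the soliton equation shows that Ric is η-Einstein with constant coefficients; so r is
constant, equal to -n(n-1), the metric is Einstein, and ρ is constant, thus zero. If α = 0, then 2ρ
= βr - 2λ need not be constant a priori. The function f = g(X,ξ) satisfies ξf = ρ and a Hessian
equation on horizontal vectors; transporting that equation along ξ twice fixes λ and gives ξρ = -2ρ,
and comparing the derivatives of ρ along ξ, X and grad f gives ρ³ = 0
(`conformal_factor_nilpotent`). -/

/-! ### Metric connections on modules over a commutative ring -/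

/-- An algebraic model of the smooth functions `A` and vector fields `𝔛` on an open set carrying an
orthonormal frame `e`: derivatives of functions along fields, a metric, a metric connection, and the
Jacobi identity for the bracket `[U, V] = ∇_U V - ∇_V U`. -/
structure FramedGeometry (A 𝔛 : Type*) [CommRing A] [AddCommGroup 𝔛] [Module A 𝔛] (n : ℕ) where
  D : 𝔛 → A → A
  g : 𝔛 →ₗ[A] 𝔛 →ₗ[A] A
  nab : 𝔛 → 𝔛 → 𝔛
  e : Fin n → 𝔛
  D_add_left : ∀ (U V : 𝔛) (f : A), D (U + V) f = D U f + D V f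
  D_smul_left : ∀ (a : A) (U : 𝔛) (f : A), D (a • U) f = a * D U f
  D_add : ∀ (U : 𝔛) (f h : A), D U (f + h) = D U f + D U h
  D_mul : ∀ (U : 𝔛) (f h : A), D U (f * h) = f * D U h + D U f * h
  g_symm : ∀ U V : 𝔛, g U V = g V U
  nab_add_left : ∀ U V W : 𝔛, nab (U + V) W = nab U W + nab V W
  nab_smul_left : ∀ (a : A) (U W : 𝔛), nab (a • U) W = a • nab U W
  nab_add : ∀ U V W : 𝔛, nab U (V + W) = nab U V + nab U W
  nab_smul : ∀ (U : 𝔛) (a : A) (V : 𝔛), nab U (a • V) = a • nab U V + D U a • V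
  D_g : ∀ U V W : 𝔛, D U (g V W) = g (nab U V) W + g V (nab U W)
  jacobi : ∀ U V W : 𝔛,
    (nab U (nab V W - nab W V) - nab (nab V W - nab W V) U)
    + (nab V (nab W U - nab U W) - nab (nab W U - nab U W) V)
    + (nab W (nab U V - nab V U) - nab (nab U V - nab V U) W) = 0
  ortho : ∀ i j, g (e i) (e j) = if i = j then 1 else 0
  expand : ∀ U : 𝔛, ∑ i, g U (e i) • e i = U
  dim_pos : 0 < n

/-! ### Calculus of a framed geometry: brackets and algebraic symmetries of the curvature. -/

namespace FramedGeometry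

variable {A 𝔛 : Type*} [CommRing A] [AddCommGroup 𝔛] [Module A 𝔛] {n : ℕ}
  (G : FramedGeometry A 𝔛 n)

@[simp] theorem D_zero (U : 𝔛) : G.D U 0 = 0 := by
  have h := G.D_add U 0 0
  simpa using h

theorem D_neg (U : 𝔛) (f : A) : G.D U (-f) = -G.D U f := by
  have h := G.D_add U f (-f)
  rw [add_neg_cancel, D_zero] at h
  linear_combination -h

theorem D_sub (U : 𝔛) (f h : A) : G.D U (f - h) = G.D U f - G.D U h := by
  rw [sub_eq_add_neg, D_add, D_neg, sub_eq_add_neg]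

@[simp] theorem D_one (U : 𝔛) : G.D U 1 = 0 := by
  have h := G.D_mul U 1 1
  simp only [one_mul, mul_one] at h
  linear_combination -h

@[simp] theorem D_natCast (U : 𝔛) (k : ℕ) : G.D U (k : A) = 0 := by
  induction k with
  | zero => simp
  | succ k ih => rw [Nat.cast_succ, D_add, ih, D_one, add_zero]

@[simp] theorem D_ofNat (U : 𝔛) (k : ℕ) [k.AtLeastTwo] : G.D U (ofNat(k) : A) = 0 :=
  G.D_natCast U k

theorem D_sum {ι : Type*} (s : Finset ι) (U : 𝔛) (f : ι → A) :
    G.D U (∑ i ∈ s, f i) = ∑ i ∈ s, G.D U (f i) :=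
  map_sum (AddMonoidHom.mk' (G.D U) (G.D_add U)) f s

theorem D_sub_left (U V : 𝔛) (f : A) : G.D (U - V) f = G.D U f - G.D V f := by
  have h := G.D_add_left (U - V) V f
  rw [sub_add_cancel] at h
  linear_combination -h

theorem D_zero_left (f : A) : G.D 0 f = 0 := by
  have h := G.D_smul_left 0 0 f
  simpa using h

/-- The derivative of a function as a 1-form. -/
def diff (f : A) : 𝔛 →ₗ[A] A where
  toFun U := G.D U f
  map_add' U V := G.D_add_left U V f
  map_smul' a U := G.D_smul_left a U f

@[simp] theorem diff_apply (f : A) (U : 𝔛) : G.diff f U = G.D U f := rfl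

/-- The covariant differential `∇Y`. -/
def cov (Y : 𝔛) : 𝔛 →ₗ[A] 𝔛 where
  toFun U := G.nab U Y
  map_add' U V := G.nab_add_left U V Y
  map_smul' a U := G.nab_smul_left a U Y

@[simp] theorem cov_apply (Y U : 𝔛) : G.cov Y U = G.nab U Y := rfl

theorem nab_sub_left (U V W : 𝔛) : G.nab (U - V) W = G.nab U W - G.nab V W :=
  map_sub (G.cov W) U V

theorem nab_neg_left (U W : 𝔛) : G.nab (-U) W = -G.nab U W :=
  map_neg (G.cov W) U

theorem nab_zero_left (W : 𝔛) : G.nab 0 W = 0 :=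
  map_zero (G.cov W)

theorem nab_zero (U : 𝔛) : G.nab U 0 = 0 :=
  map_zero (AddMonoidHom.mk' (G.nab U) (G.nab_add U))

theorem nab_neg (U V : 𝔛) : G.nab U (-V) = -G.nab U V :=
  map_neg (AddMonoidHom.mk' (G.nab U) (G.nab_add U)) V

theorem nab_sub (U V W : 𝔛) : G.nab U (V - W) = G.nab U V - G.nab U W :=
  map_sub (AddMonoidHom.mk' (G.nab U) (G.nab_add U)) V W

theorem ext_g {U V : 𝔛} (h : ∀ Z, G.g U Z = G.g V Z) : U = V := by
  rw [← G.expand U, ← G.expand V]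
  simp only [h]

/-- The bracket `[U, V]`. -/
def br (U V : 𝔛) : 𝔛 := G.nab U V - G.nab V U

theorem br_swap (U V : 𝔛) : G.br U V = -G.br V U := by
  simp [br]

theorem br_smul (U V : 𝔛) (f : A) : G.br U (f • V) = f • G.br U V + G.D U f • V := by
  simp only [br, nab_smul, nab_smul_left]
  module

theorem br_smul_left (U V : 𝔛) (f : A) : G.br (f • U) V = f • G.br U V - G.D V f • U := by
  rw [br_swap, br_smul, br_swap]
  module

theorem br_add (U V W : 𝔛) : G.br U (V + W) = G.br U V + G.br U W := by
  simp only [br, nab_add, nab_add_left]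
  abel

theorem br_add_left (U V W : 𝔛) : G.br (U + V) W = G.br U W + G.br V W := by
  simp only [br, nab_add, nab_add_left]
  abel

theorem jacobi_br (U V W : 𝔛) :
    G.br U (G.br V W) + G.br V (G.br W U) + G.br W (G.br U V) = 0 :=
  G.jacobi U V W

/-- Fields differentiate functions compatibly with the bracket. -/
theorem D_br (U V : 𝔛) (f : A) : G.D (G.br U V) f = G.D U (G.D V f) - G.D V (G.D U f) := by
  -- A field of unit length exists because the frame is nonempty. The Jacobi identity for U, V, fW
  -- minus f times the one for U, V, W is the claimed identity times W, and pairing with W removes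
  -- the factor.
  set W := G.e ⟨0, G.dim_pos⟩
  have hW : G.g W W = 1 := by simp [W, G.ortho]
  have h0 := G.jacobi_br U V W
  have h1 := G.jacobi_br U V (f • W)
  rw [G.br_swap W U, G.br_swap W] at h0
  rw [G.br_swap (f • W) U, G.br_swap (f • W)] at h1
  have hn (Y Z : 𝔛) : G.br Y (-Z) = -G.br Y Z := by simp [br, nab_neg, nab_neg_left]; abel
  simp only [br_smul, br_add, hn] at h0 h1
  have h2 : (G.D U (G.D V f) - G.D V (G.D U f) - G.D (G.br U V) f) • W = 0 := by
    have : f • (G.br U (G.br V W) + -G.br V (G.br U W) + -G.br (G.br U V) W) = 0 := by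
      rw [h0, smul_zero]
    rw [← h1, ← sub_eq_zero] at this
    rw [← neg_eq_zero, ← this]
    module
  have h3 := congrArg (fun Z => G.g Z W) h2
  simp only [map_smul, LinearMap.smul_apply, hW, map_zero, LinearMap.zero_apply, smul_eq_mul,
    mul_one] at h3
  linear_combination -h3

/-- The curvature tensor `R(U, V)W`. -/
def R : 𝔛 →ₗ[A] 𝔛 →ₗ[A] 𝔛 →ₗ[A] 𝔛 :=
  LinearMap.mk₂ A
    (fun U V =>
      { toFun := fun W => G.nab U (G.nab V W) - G.nab V (G.nab U W) - G.nab (G.br U V) W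
        map_add' := fun W W' => by simp only [nab_add]; abel
        map_smul' := fun f W => by
          simp only [nab_smul, nab_add, D_br, RingHom.id_apply]
          module })
    (fun U U' V => by
      ext W
      simp only [LinearMap.coe_mk, AddHom.coe_mk, LinearMap.add_apply, br_add_left, nab_add_left,
        nab_add]
      abel)
    (fun f U V => by
      ext W
      simp only [LinearMap.coe_mk, AddHom.coe_mk, LinearMap.smul_apply, br_smul_left, nab_smul_left,
        nab_smul, nab_sub_left]
      module)
    (fun U V V' => by
      ext W
      simp only [LinearMap.coe_mk, AddHom.coe_mk, LinearMap.add_apply, br_add, nab_add_left,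
        nab_add]
      abel)
    (fun f U V => by
      ext W
      simp only [LinearMap.coe_mk, AddHom.coe_mk, LinearMap.smul_apply, br_smul, nab_smul_left,
        nab_smul, nab_add_left]
      module)

theorem R_apply (U V W : 𝔛) :
    G.R U V W = G.nab U (G.nab V W) - G.nab V (G.nab U W) - G.nab (G.br U V) W := rfl

theorem R_swap (U V W : 𝔛) : G.R U V W = -G.R V U W := by
  rw [R_apply, R_apply, G.br_swap U V, nab_neg_left]
  abel

theorem bianchi (U V W : 𝔛) : G.R U V W + G.R V W U + G.R W U V = 0 := by
  rw [← G.jacobi U V W]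
  simp only [R_apply, br, nab_sub_left, nab_sub]
  abel

theorem g_R_skew (U V W Z : 𝔛) : G.g (G.R U V W) Z = -G.g (G.R U V Z) W := by
  have h := G.D_br U V (G.g W Z)
  simp only [D_g, D_add] at h
  simp only [R_apply, map_sub, LinearMap.sub_apply]
  rw [G.g_symm (G.nab U (G.nab V Z)), G.g_symm (G.nab V (G.nab U Z)),
    G.g_symm (G.nab (G.br U V) Z)]
  linear_combination -h

theorem g_R_swap (U V W Z : 𝔛) : G.g (G.R U V W) Z = -G.g (G.R V U W) Z := by
  rw [R_swap]; simp

theorem g_bianchi (U V W Z : 𝔛) :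
    G.g (G.R U V W) Z + G.g (G.R V W U) Z + G.g (G.R W U V) Z = 0 := by
  have h := congrArg (fun Y => G.g Y Z) (G.bianchi U V W)
  simpa using h

end FramedGeometry

/-! ### Second Bianchi identity and the change of curvature along a field. -/

namespace FramedGeometry

variable {A 𝔛 : Type*} [CommRing A] [AddCommGroup 𝔛] [Module A 𝔛] {n : ℕ}
  (G : FramedGeometry A 𝔛 n)

/-- The usual octahedron argument: four first Bianchi identities combine to twice the claim, and 2
is invertible because `A` is a real algebra. -/
theorem g_R_pair [Algebra ℝ A] (U V W Z : 𝔛) : G.g (G.R U V W) Z = G.g (G.R W Z U) V := by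
  have h2 : (2 : A) * (G.g (G.R U V W) Z - G.g (G.R W Z U) V) = 0 := by
    have e1 := G.g_bianchi U V W Z
    have e2 := G.g_bianchi V W Z U
    have e3 := G.g_bianchi W Z U V
    have e4 := G.g_bianchi Z U V W
    rw [G.g_R_skew V W Z U, G.g_R_skew W Z V U, G.g_R_swap Z V W U] at e2
    rw [G.g_R_swap Z U W V, G.g_R_skew U Z W V, G.g_R_swap U W Z V, G.g_R_skew W U Z V] at e3
    rw [G.g_R_swap Z U V W, G.g_R_skew U V Z W, G.g_R_skew V Z U W] at e4
    linear_combination e1 + e2 - e3 - e4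
  have u2 : IsUnit (2 : A) := by
    simpa only [map_ofNat] using (IsUnit.mk0 (2 : ℝ) two_ne_zero).map (algebraMap ℝ A)
  exact sub_eq_zero.1 ((u2.mul_right_eq_zero).1 h2)

/-- The covariant derivative of an endomorphism field. -/
def covEnd (T : 𝔛 →ₗ[A] 𝔛) : 𝔛 →ₗ[A] 𝔛 →ₗ[A] 𝔛 :=
  LinearMap.mk₂ A (fun U V => G.nab U (T V) - T (G.nab U V))
    (fun U U' V => by simp only [nab_add_left, map_add]; abel)
    (fun f U V => by simp only [nab_smul_left, map_smul, smul_sub])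
    (fun U V V' => by simp only [nab_add, map_add]; abel)
    (fun f U V => by simp only [nab_smul, map_smul, map_add]; module)

theorem covEnd_apply (T : 𝔛 →ₗ[A] 𝔛) (U V : 𝔛) :
    G.covEnd T U V = G.nab U (T V) - T (G.nab U V) := rfl

theorem covEnd_covEnd_cov_swap (Y U V : 𝔛) :
    G.covEnd (G.cov Y) U V - G.covEnd (G.cov Y) V U = G.R U V Y := by
  simp only [covEnd_apply, cov_apply, R_apply, br, nab_sub_left]
  abel

/-- The covariant derivative of the curvature tensor. -/
def covR (X U V W : 𝔛) : 𝔛 :=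
  G.nab X (G.R U V W) - G.R (G.nab X U) V W - G.R U (G.nab X V) W - G.R U V (G.nab X W)

theorem covR_swap (X U V W : 𝔛) : G.covR X U V W = -G.covR X V U W := by
  simp only [covR]
  rw [G.R_swap U V W, G.R_swap (G.nab X U), G.R_swap U, G.R_swap U, nab_neg]
  abel

theorem second_bianchi (X U V W : 𝔛) :
    G.covR X U V W + G.covR U V X W + G.covR V X U W = 0 := by
  have h : G.R (G.nab X U) V W + G.R U (G.nab X V) W + G.R (G.nab U V) X W
      + G.R V (G.nab U X) W + G.R (G.nab V X) U W + G.R X (G.nab V U) W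
      = G.R (G.br X U) V W + G.R (G.br U V) X W + G.R (G.br V X) U W := by
    rw [G.R_swap U (G.nab X V), G.R_swap V (G.nab U X), G.R_swap X (G.nab V U)]
    simp only [br, map_sub, LinearMap.sub_apply]
    abel
  have hj := congrArg (fun Y => G.nab Y W) (G.jacobi_br X U V)
  simp only [nab_add_left, nab_zero_left] at hj
  have h' : G.covR X U V W + G.covR U V X W + G.covR V X U W
      = G.nab X (G.R U V W) + G.nab U (G.R V X W) + G.nab V (G.R X U W)
        - G.R U V (G.nab X W) - G.R V X (G.nab U W) - G.R X U (G.nab V W)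
        - (G.R (G.br X U) V W + G.R (G.br U V) X W + G.R (G.br V X) U W) := by
    rw [← h]
    simp only [covR]
    abel
  rw [h', ← neg_zero, ← hj]
  simp only [R_apply, nab_sub, G.br_swap (G.br _ _) _, nab_neg_left]
  abel

/-- The covariant derivative of a vector valued bilinear map. -/
def covBil (B : 𝔛 → 𝔛 → 𝔛) (U V W : 𝔛) : 𝔛 :=
  G.nab U (B V W) - B (G.nab U V) W - B V (G.nab U W)

/-- This is L_Y R (U,V) = (∇_U B)(V,·) - (∇_V B)(U,·) for B = L_Y ∇, with the Lie derivative of R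
written out through ∇_Y R. It follows from the second Bianchi identity. -/
theorem covR_eq {Y : 𝔛} {B : 𝔛 → 𝔛 → 𝔛}
    (hB : ∀ V W, B V W = G.covEnd (G.cov Y) V W - G.R V Y W) (U V W : 𝔛) :
    G.covR Y U V W = G.covBil B U V W - G.covBil B V U W - G.R U V (G.nab W Y)
      + G.nab (G.R U V W) Y + G.R V (G.nab U Y) W - G.R U (G.nab V Y) W := by
  have h := G.second_bianchi Y U V W
  have h1 : G.covBil B U V W - G.covBil B V U W = G.R U V (G.nab W Y)
      - G.nab (G.R U V W) Y - G.covR U V Y W - G.R V (G.nab U Y) W + G.covR V U Y W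
      + G.R U (G.nab V Y) W := by
    simp only [covBil, hB, covR, covEnd_apply, cov_apply, R_apply, br, nab_sub, nab_sub_left]
    abel
  rw [h1, G.covR_swap V U Y]
  rw [← sub_eq_zero, ← h]
  abel

/-! ### Traces -/

theorem g_nab_e (Y : 𝔛) (i j : Fin n) :
    G.g (G.nab Y (G.e i)) (G.e j) = -G.g (G.nab Y (G.e j)) (G.e i) := by
  have h := G.D_g Y (G.e i) (G.e j)
  rw [G.ortho, G.g_symm (G.e i)] at h
  have : G.D Y (if i = j then (1 : A) else 0) = 0 := by split_ifs <;> simp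
  rw [this] at h
  linear_combination -h

theorem bilin_expand_left (T : 𝔛 →ₗ[A] 𝔛 →ₗ[A] A) (U V : 𝔛) :
    T U V = ∑ j, G.g U (G.e j) * T (G.e j) V := by
  conv_lhs => rw [← G.expand U]
  simp

theorem bilin_expand_right (T : 𝔛 →ₗ[A] 𝔛 →ₗ[A] A) (U V : 𝔛) :
    T U V = ∑ j, G.g V (G.e j) * T U (G.e j) := by
  conv_lhs => rw [← G.expand V]
  simp

/-- The trace of a bilinear form is parallel. -/
theorem sum_nab_e (T : 𝔛 →ₗ[A] 𝔛 →ₗ[A] A) (Y : 𝔛) :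
    ∑ i, (T (G.nab Y (G.e i)) (G.e i) + T (G.e i) (G.nab Y (G.e i))) = 0 := by
  rw [Finset.sum_add_distrib]
  simp_rw [G.bilin_expand_left T (G.nab Y (G.e _)), G.bilin_expand_right T _ (G.nab Y (G.e _))]
  rw [Finset.sum_comm, ← Finset.sum_add_distrib]
  refine Finset.sum_eq_zero fun i _ => ?_
  rw [← Finset.sum_add_distrib]
  refine Finset.sum_eq_zero fun j _ => ?_
  rw [G.g_nab_e Y j i]
  ring

theorem g_expand (U V : 𝔛) : G.g U V = ∑ j, G.g U (G.e j) * G.g V (G.e j) := by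
  rw [G.bilin_expand_left G.g U V]
  simp_rw [G.g_symm V]

/-- The Ricci tensor. -/
def ric : 𝔛 →ₗ[A] 𝔛 →ₗ[A] A :=
  LinearMap.mk₂ A (fun U V => ∑ i, G.g (G.R (G.e i) U V) (G.e i))
    (fun U U' V => by simp [Finset.sum_add_distrib])
    (fun f U V => by simp [Finset.mul_sum])
    (fun U V V' => by simp [Finset.sum_add_distrib])
    (fun f U V => by simp [Finset.mul_sum])

theorem ric_apply (U V : 𝔛) : G.ric U V = ∑ i, G.g (G.R (G.e i) U V) (G.e i) := rfl

/-- The scalar curvature. -/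
def scal : A := ∑ j, G.ric (G.e j) (G.e j)

theorem ric_symm [Algebra ℝ A] (U V : 𝔛) : G.ric U V = G.ric V U := by
  simp only [ric_apply]
  refine Finset.sum_congr rfl fun i _ => ?_
  rw [G.g_R_pair, G.g_R_swap, G.g_R_skew, neg_neg]

theorem ric_apply' [Algebra ℝ A] (U V : 𝔛) :
    ∑ j, G.g (G.R U (G.e j) (G.e j)) V = G.ric U V := by
  simp only [ric_apply]
  refine Finset.sum_congr rfl fun i _ => ?_
  rw [G.g_R_pair, G.g_R_swap, G.g_R_skew, neg_neg, G.g_R_pair, G.g_R_swap, G.g_R_skew, neg_neg,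
    G.g_R_pair, G.g_R_swap, G.g_R_skew, neg_neg]

/-- `U, V ↦ g(R(U, V)V', U')` with the inner pair and the outer pair as arguments. -/
def rmOuter (V V' : 𝔛) : 𝔛 →ₗ[A] 𝔛 →ₗ[A] A :=
  LinearMap.mk₂ A (fun U U' => G.g (G.R U V V') U')
    (fun _ _ _ => by simp) (fun _ _ _ => by simp) (fun _ _ _ => by simp) (fun _ _ _ => by simp)

theorem rmOuter_apply (V V' U U' : 𝔛) : G.rmOuter V V' U U' = G.g (G.R U V V') U' := rfl

/-- Metric traces are parallel, so the terms in which Y differentiates the frame cancel in both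
contractions. -/
theorem D_ric_trace (Y : 𝔛) :
    G.D Y G.scal = ∑ j, ∑ i, G.g (G.covR Y (G.e i) (G.e j) (G.e j)) (G.e i) := by
  have h1 (V W : 𝔛) : G.D Y (G.ric V W)
      = ∑ i, (G.g (G.covR Y (G.e i) V W) (G.e i)) + G.ric (G.nab Y V) W + G.ric V (G.nab Y W) := by
    have h := G.sum_nab_e (G.rmOuter V W) Y
    simp only [rmOuter_apply, Finset.sum_add_distrib] at h
    simp only [ric_apply, D_sum, D_g, covR, map_sub, LinearMap.sub_apply, Finset.sum_sub_distrib,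
      Finset.sum_add_distrib]
    linear_combination h
  have h2 := G.sum_nab_e G.ric Y
  rw [Finset.sum_add_distrib] at h2
  simp only [scal, D_sum, h1, Finset.sum_add_distrib]
  linear_combination h2

/-- The derivative of the scalar curvature along `Y`, in terms of `B(V, W) = ∇²_{V,W}Y - R(V, Y)W`
(the Lie derivative of the connection along `Y`). -/
theorem D_scal [Algebra ℝ A] {Y : 𝔛} {B : 𝔛 → 𝔛 → 𝔛}
    (hB : ∀ V W, B V W = G.covEnd (G.cov Y) V W - G.R V Y W) :
    G.D Y G.scal = ∑ j, ∑ i, (G.g (G.covBil B (G.e i) (G.e j) (G.e j)) (G.e i)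
      - G.g (G.covBil B (G.e j) (G.e i) (G.e j)) (G.e i))
      - 2 * ∑ i, G.ric (G.e i) (G.nab (G.e i) Y) := by
  have t1 : ∑ j, ∑ i, G.g (G.R (G.e i) (G.e j) (G.nab (G.e j) Y)) (G.e i)
      = ∑ j, G.ric (G.e j) (G.nab (G.e j) Y) := rfl
  have t4 : ∑ j, ∑ i, G.g (G.R (G.e i) (G.nab (G.e j) Y) (G.e j)) (G.e i)
      = ∑ j, G.ric (G.e j) (G.nab (G.e j) Y) :=
    Finset.sum_congr rfl fun j _ => G.ric_symm _ _
  have t3 : ∑ j, ∑ i, G.g (G.R (G.e j) (G.nab (G.e i) Y) (G.e j)) (G.e i)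
      = -∑ j, G.ric (G.e j) (G.nab (G.e j) Y) := by
    rw [Finset.sum_comm, ← Finset.sum_neg_distrib]
    refine Finset.sum_congr rfl fun i _ => ?_
    rw [G.ric_symm, ← G.ric_apply', ← Finset.sum_neg_distrib]
    exact Finset.sum_congr rfl fun j _ => G.g_R_swap _ _ _ _
  have t2 : ∑ j, ∑ i, G.g (G.nab (G.R (G.e i) (G.e j) (G.e j)) Y) (G.e i)
      = ∑ j, G.ric (G.e j) (G.nab (G.e j) Y) := by
    have e1 (i j : Fin n) : G.g (G.nab (G.R (G.e i) (G.e j) (G.e j)) Y) (G.e i)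
        = ∑ k, G.g (G.R (G.e i) (G.e j) (G.e j)) (G.e k) * G.g (G.nab (G.e k) Y) (G.e i) :=
      G.bilin_expand_left (G.g.comp (G.cov Y)) _ _
    simp_rw [e1]
    rw [Finset.sum_comm]
    have e2 (i : Fin n) : ∑ j, ∑ k, G.g (G.R (G.e i) (G.e j) (G.e j)) (G.e k)
        * G.g (G.nab (G.e k) Y) (G.e i) = ∑ k, G.g (G.nab (G.e k) Y) (G.e i) * G.ric (G.e k) (G.e i) := by
      rw [Finset.sum_comm]
      refine Finset.sum_congr rfl fun k _ => ?_
      rw [← Finset.sum_mul, G.ric_apply', mul_comm, G.ric_symm]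
    simp_rw [e2]
    rw [Finset.sum_comm]
    exact Finset.sum_congr rfl fun k _ => (G.bilin_expand_right G.ric _ _).symm
  rw [D_ric_trace]
  simp only [G.covR_eq hB, map_sub, map_add, LinearMap.sub_apply, LinearMap.add_apply,
    Finset.sum_sub_distrib, Finset.sum_add_distrib]
  linear_combination t2 - t1 + t3 - t4

end FramedGeometry

namespace FramedGeometry

variable {A 𝔛 : Type*} [CommRing A] [AddCommGroup 𝔛] [Module A 𝔛] {n : ℕ}
  (G : FramedGeometry A 𝔛 n)

theorem isUnit_two [Algebra ℝ A] : IsUnit (2 : A) := by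
  simpa only [map_ofNat] using (IsUnit.mk0 (2 : ℝ) two_ne_zero).map (algebraMap ℝ A)

theorem mul_two_cancel [Algebra ℝ A] {a b : A} (h : 2 * a = 2 * b) : a = b :=
  isUnit_two.mul_left_cancel h

/-! ### Gradient and Hessian -/

/-- The gradient of a function. -/
def grad (f : A) : 𝔛 := ∑ i, G.D (G.e i) f • G.e i

theorem g_grad (f : A) (U : 𝔛) : G.g (G.grad f) U = G.D U f := by
  change _ = G.diff f U
  conv_rhs => rw [← G.expand U]
  simp [grad, G.g_symm U, mul_comm]

theorem g_grad_right (f : A) (U : 𝔛) : G.g U (G.grad f) = G.D U f := by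
  rw [g_symm, g_grad]

/-- The Hessian of a function. -/
def hess (f : A) (U V : 𝔛) : A := G.D U (G.D V f) - G.D (G.nab U V) f

theorem g_nab_grad (f : A) (U V : 𝔛) : G.g (G.nab U (G.grad f)) V = G.hess f U V := by
  have h := G.D_g U (G.grad f) V
  rw [g_grad, g_grad] at h
  rw [hess]
  linear_combination -h

theorem sum_g_e (U V : 𝔛) : ∑ i, G.g U (G.e i) * G.g V (G.e i) = G.g U V :=
  (G.g_expand U V).symm

theorem sum_g_e_self : ∑ i, G.g (G.e i) (G.e i) = n := by
  simp [G.ortho]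

/-! ### Conformal fields -/

/-- `L_X g = 2 ρ g`. -/
def IsConformal (X : 𝔛) (ρ : A) : Prop :=
  ∀ U V, G.g (G.nab U X) V + G.g U (G.nab V X) = 2 * ρ * G.g U V

variable {G} [Algebra ℝ A] {X : 𝔛} {ρ : A}

theorem IsConformal.g_nab_self (h : G.IsConformal X ρ) (U : 𝔛) :
    G.g (G.nab U X) U = ρ * G.g U U := by
  refine mul_two_cancel ?_
  have := h U U
  rw [G.g_symm U (G.nab U X)] at this
  linear_combination this

/-- A Koszul-type argument: differentiating the conformal equation gives the part of ∇²X symmetric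
in V, W, while the part skew in U, V is curvature. Cyclic permutation solves for ∇²X. -/
theorem IsConformal.g_covEnd_cov (h : G.IsConformal X ρ) (U V W : 𝔛) :
    G.g (G.covEnd (G.cov X) U V) W = G.g (G.R U X V) W + G.D U ρ * G.g V W + G.D V ρ * G.g U W
      - G.D W ρ * G.g U V := by
  have a (U V W : 𝔛) : G.g (G.covEnd (G.cov X) U V) W + G.g (G.covEnd (G.cov X) U W) V
      = 2 * G.D U ρ * G.g V W := by
    have h1 := congrArg (G.D U) (h V W)
    have h2 := h (G.nab U V) W
    have h3 := h V (G.nab U W)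
    simp only [D_add, D_g, D_mul, D_ofNat] at h1
    simp only [covEnd_apply, cov_apply, map_sub, LinearMap.sub_apply]
    rw [G.g_symm (G.nab U (G.nab W X)) V, G.g_symm (G.nab (G.nab U W) X) V]
    linear_combination h1 - h2 - h3
  have b (U V W : 𝔛) : G.g (G.covEnd (G.cov X) U V) W - G.g (G.covEnd (G.cov X) V U) W
      = G.g (G.R U V X) W := by
    rw [← covEnd_covEnd_cov_swap]; simp
  refine mul_two_cancel ?_
  have r1 := G.g_bianchi U V X W
  have r2 := b U W V
  have r3 := b V W U
  rw [G.g_R_pair, G.g_R_swap] at r2 r3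
  have r4 := G.g_R_swap U X V W
  rw [G.g_symm U V] at *
  linear_combination a U V W + a V U W - a W U V + b U V W - r2 - r3 + r1 - r4 -
    G.D W ρ * 2 * G.g_symm U V

/-- Ric is symmetric, so it sees only the symmetric part of ∇X, which is ρg. -/
theorem IsConformal.sum_ric (h : G.IsConformal X ρ) :
    ∑ i, G.ric (G.e i) (G.nab (G.e i) X) = ρ * G.scal := by
  refine mul_two_cancel ?_
  have e1 : ∑ i, G.ric (G.e i) (G.nab (G.e i) X)
      = ∑ i, ∑ k, G.g (G.nab (G.e i) X) (G.e k) * G.ric (G.e i) (G.e k) :=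
    Finset.sum_congr rfl fun i _ => G.bilin_expand_right G.ric _ _
  have e2 : ∑ i, G.ric (G.e i) (G.nab (G.e i) X)
      = ∑ i, ∑ k, G.g (G.e i) (G.nab (G.e k) X) * G.ric (G.e i) (G.e k) := by
    rw [e1, Finset.sum_comm]
    refine Finset.sum_congr rfl fun i _ => Finset.sum_congr rfl fun k _ => ?_
    rw [G.ric_symm, G.g_symm]
  have e3 (i k : Fin n) : G.g (G.nab (G.e i) X) (G.e k) * G.ric (G.e i) (G.e k)
      + G.g (G.e i) (G.nab (G.e k) X) * G.ric (G.e i) (G.e k)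
      = 2 * ρ * (G.g (G.e i) (G.e k) * G.ric (G.e i) (G.e k)) := by
    rw [← add_mul, h, mul_assoc]
  have e4 : 2 * ∑ i, G.ric (G.e i) (G.nab (G.e i) X)
      = ∑ i, ∑ k, 2 * ρ * (G.g (G.e i) (G.e k) * G.ric (G.e i) (G.e k)) := by
    simp_rw [← e3, Finset.sum_add_distrib, ← e1, ← e2]
    ring
  rw [e4]
  simp [G.ortho, scal, Finset.mul_sum, mul_assoc]

/-- The derivative of the scalar curvature along a conformal field. -/
theorem IsConformal.D_scal (h : G.IsConformal X ρ) :
    G.D X G.scal = -2 * ρ * G.scal - 2 * (n - 1) * ∑ i, G.hess ρ (G.e i) (G.e i) := by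
  -- This is L_X ∇ for a conformal field; the curvature term in ∇²X cancels the one in the
  -- definition of the Lie derivative.
  set B : 𝔛 → 𝔛 → 𝔛 := fun V W => G.D V ρ • W + G.D W ρ • V - G.g V W • G.grad ρ
  have hB : ∀ V W, B V W = G.covEnd (G.cov X) V W - G.R V X W := by
    refine fun V W => G.ext_g fun Z => ?_
    rw [map_sub G.g (G.covEnd _ _ _), LinearMap.sub_apply, h.g_covEnd_cov]
    simp only [B, map_sub, map_add, LinearMap.sub_apply, LinearMap.add_apply, map_smul,
      LinearMap.smul_apply, g_grad, smul_eq_mul]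
    ring
  have hc (U V W : 𝔛) : G.covBil B U V W
      = G.hess ρ U V • W + G.hess ρ U W • V - G.g V W • G.nab U (G.grad ρ) := by
    simp only [covBil, B, nab_sub, nab_add, nab_smul, D_g, hess]
    module
  rw [G.D_scal hB, h.sum_ric]
  simp only [hc, map_sub, map_add, LinearMap.sub_apply, LinearMap.add_apply, map_smul,
      LinearMap.smul_apply, g_nab_grad, smul_eq_mul, G.ortho]
  simp [Finset.sum_add_distrib, Finset.sum_sub_distrib, ← Finset.mul_sum]
  ring

end FramedGeometry

/-! ### Almost Kenmotsu structures: the tensor h' and its algebra. -/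

namespace FramedGeometry

variable {A 𝔛 : Type*} [CommRing A] [AddCommGroup 𝔛] [Module A 𝔛] {n : ℕ}
  (G : FramedGeometry A 𝔛 n)

theorem smul_two_cancel [Algebra ℝ A] {U V : 𝔛} (h : (2 : A) • U = (2 : A) • V) : U = V :=
  (isUnit_two (A := A)).smul_left_cancel.1 h

/-- Orthogonal projection to the complement of a unit field `ξ`. -/
def proj (ξ : 𝔛) : 𝔛 →ₗ[A] 𝔛 := LinearMap.id - (G.g.flip ξ).smulRight ξ

theorem proj_apply (ξ U : 𝔛) : G.proj ξ U = U - G.g U ξ • ξ := rfl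

/-- The tensor `∇ξ - (id - η ⊗ ξ)`, which is `h'` on an almost Kenmotsu manifold. -/
def shape (ξ : 𝔛) : 𝔛 →ₗ[A] 𝔛 := G.cov ξ - G.proj ξ

theorem shape_apply (ξ U : 𝔛) : G.shape ξ U = G.nab U ξ - G.proj ξ U := rfl

theorem nab_eq_shape (ξ U : 𝔛) : G.nab U ξ = G.proj ξ U + G.shape ξ U := by
  rw [shape_apply]; abel

/-- An almost Kenmotsu structure with `η = g(·, ξ)`. -/
structure IsAlmostKenmotsu (φ : 𝔛 →ₗ[A] 𝔛) (ξ : 𝔛) : Prop where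
  phi_phi : ∀ U, φ (φ U) = -U + G.g U ξ • ξ
  g_xi : G.g ξ ξ = 1
  phi_xi : φ ξ = 0
  g_phi : ∀ U V, G.g (φ U) V = -G.g U (φ V)
  closed : ∀ U V, G.g (G.nab U ξ) V = G.g (G.nab V ξ) U
  d_Phi : ∀ U V W, G.g V (G.covEnd φ U W) - G.g U (G.covEnd φ V W) + G.g U (G.covEnd φ W V)
    = 2 * (G.g U ξ * G.g V (φ W) - G.g V ξ * G.g U (φ W) + G.g W ξ * G.g U (φ V))

namespace IsAlmostKenmotsu

variable {G} [Algebra ℝ A] {φ : 𝔛 →ₗ[A] 𝔛} {ξ : 𝔛} (h : G.IsAlmostKenmotsu φ ξ)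
include h

theorem g_nab_xi (U : 𝔛) : G.g (G.nab U ξ) ξ = 0 := by
  have h1 := G.D_g U ξ ξ
  rw [h.g_xi, D_one, G.g_symm ξ] at h1
  refine mul_two_cancel ?_
  linear_combination -h1

theorem nab_xi_xi : G.nab ξ ξ = 0 := by
  refine G.ext_g fun Z => ?_
  rw [h.closed, h.g_nab_xi]; simp

theorem proj_xi : G.proj ξ ξ = 0 := by
  rw [proj_apply, h.g_xi, one_smul, sub_self]

theorem g_proj_xi (U : 𝔛) : G.g (G.proj ξ U) ξ = 0 := by
  simp [proj_apply, h.g_xi]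

theorem g_phi_xi (U : 𝔛) : G.g (φ U) ξ = 0 := by
  rw [h.g_phi, h.phi_xi]; simp

theorem g_xi_phi (U : 𝔛) : G.g ξ (φ U) = 0 := by
  rw [g_symm, h.g_phi_xi]

theorem proj_of_g_eq_zero {U : 𝔛} (hU : G.g U ξ = 0) : G.proj ξ U = U := by
  simp [proj_apply, hU]

theorem proj_phi (U : 𝔛) : G.proj ξ (φ U) = φ U := h.proj_of_g_eq_zero (h.g_phi_xi U)

theorem phi_proj (U : 𝔛) : φ (G.proj ξ U) = φ U := by
  simp [proj_apply, h.phi_xi]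

theorem proj_nab (U : 𝔛) : G.proj ξ (G.nab U ξ) = G.nab U ξ := h.proj_of_g_eq_zero (h.g_nab_xi U)

theorem nab_proj (U : 𝔛) : G.nab (G.proj ξ U) ξ = G.nab U ξ := by
  simp [proj_apply, nab_sub_left, nab_smul_left, h.nab_xi_xi]

theorem proj_proj (U : 𝔛) : G.proj ξ (G.proj ξ U) = G.proj ξ U :=
  h.proj_of_g_eq_zero (h.g_proj_xi U)

theorem phi_phi' (U : 𝔛) : φ (φ U) = -G.proj ξ U := by
  rw [h.phi_phi, proj_apply]; abel

theorem covEnd_phi_skew (U V W : 𝔛) : G.g (G.covEnd φ U V) W = -G.g V (G.covEnd φ U W) := by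
  have h1 := congrArg (G.D U) (h.g_phi V W)
  rw [D_neg, D_g, D_g] at h1
  have h2 := h.g_phi (G.nab U V) W
  have h3 := h.g_phi V (G.nab U W)
  simp only [covEnd_apply, map_sub, LinearMap.sub_apply]
  linear_combination h1 - h2 - h3

theorem covEnd_phi_xi (U : 𝔛) : G.covEnd φ U ξ = -φ (G.nab U ξ) := by
  simp [covEnd_apply, h.phi_xi, nab_zero]

theorem covEnd_phi_phi (U V : 𝔛) : G.covEnd φ U (φ V) + φ (G.covEnd φ U V)
    = G.g V (G.nab U ξ) • ξ + G.g V ξ • G.nab U ξ := by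
  simp only [covEnd_apply, h.phi_phi, map_sub, nab_add, nab_neg, nab_smul, D_g]
  module

/-- The equation for dΦ with first argument ξ. It is provisional: the right-hand side turns out to
be zero in `covEnd_phi_xi_left`. -/
theorem covEnd_phi_xi_left' (V : 𝔛) :
    G.covEnd φ ξ V = (2 : A) • φ V - φ (G.nab V ξ) - G.nab (φ V) ξ := by
  refine G.ext_g fun Z => ?_
  rw [G.g_symm _ Z, G.g_symm _ Z]
  have h1 := h.d_Phi ξ Z V
  have h2 : G.g ξ (G.covEnd φ Z V) = -G.g Z (G.nab (φ V) ξ) := by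
    rw [G.g_symm ξ, h.covEnd_phi_skew, h.covEnd_phi_xi, map_neg, neg_neg, g_symm, h.g_phi,
      h.closed, G.g_symm]
  have h3 : G.g ξ (G.covEnd φ V Z) = G.g Z (φ (G.nab V ξ)) := by
    rw [G.g_symm ξ, h.covEnd_phi_skew, h.covEnd_phi_xi, map_neg, neg_neg]
  rw [h2, h3, h.g_xi_phi, h.g_xi_phi, h.g_xi] at h1
  simp only [map_sub, map_smul, smul_eq_mul]
  linear_combination h1

/-- Since ∇_ξ ξ = 0, the field ∇_ξ(φ²) vanishes, so ∇_ξ φ anticommutes with φ. Substituting the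
formula for ∇_ξ φ gives the relation between φ and ∇ξ. -/
theorem phi_nab_phi (V : 𝔛) : φ (G.nab (φ V) ξ) = G.nab V ξ - (2 : A) • G.proj ξ V := by
  have h1 := h.covEnd_phi_phi ξ V
  rw [h.nab_xi_xi, map_zero, zero_smul, smul_zero, add_zero, h.covEnd_phi_xi_left',
    h.covEnd_phi_xi_left'] at h1
  simp only [map_sub, map_smul, h.phi_phi', nab_neg_left, h.proj_nab, h.nab_proj] at h1
  refine smul_two_cancel (A := A) ?_
  rw [← sub_eq_zero, ← neg_eq_zero, ← h1]
  module

theorem phi_nab_add_nab_phi (V : 𝔛) : φ (G.nab V ξ) + G.nab (φ V) ξ = (2 : A) • φ V := by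
  have h1 := congrArg φ (h.phi_nab_phi V)
  rw [h.phi_phi', h.proj_nab, map_sub, map_smul, h.phi_proj] at h1
  linear_combination (norm := module) -h1

theorem covEnd_phi_xi_left (V : 𝔛) : G.covEnd φ ξ V = 0 := by
  rw [h.covEnd_phi_xi_left', ← h.phi_nab_add_nab_phi]
  abel

theorem shape_xi : G.shape ξ ξ = 0 := by
  rw [shape_apply, h.nab_xi_xi, h.proj_xi, sub_zero]

theorem g_proj_symm (U V : 𝔛) : G.g (G.proj ξ U) V = G.g U (G.proj ξ V) := by
  simp only [proj_apply, map_sub, map_smul, LinearMap.sub_apply, LinearMap.smul_apply, smul_eq_mul,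
    G.g_symm ξ V]
  ring

theorem g_shape_symm (U V : 𝔛) : G.g (G.shape ξ U) V = G.g U (G.shape ξ V) := by
  simp only [shape_apply, map_sub, LinearMap.sub_apply, h.g_proj_symm]
  rw [h.closed, g_symm]

theorem g_shape_xi (U : 𝔛) : G.g (G.shape ξ U) ξ = 0 := by
  rw [h.g_shape_symm, h.shape_xi, map_zero]

theorem proj_shape (U : 𝔛) : G.proj ξ (G.shape ξ U) = G.shape ξ U :=
  h.proj_of_g_eq_zero (h.g_shape_xi U)

theorem shape_proj (U : 𝔛) : G.shape ξ (G.proj ξ U) = G.shape ξ U := by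
  rw [shape_apply, h.nab_proj, h.proj_proj, shape_apply]

theorem phi_shape (U : 𝔛) : φ (G.shape ξ U) = -G.shape ξ (φ U) := by
  have h1 := h.phi_nab_add_nab_phi U
  rw [shape_apply, shape_apply, map_sub, h.phi_proj, h.proj_phi]
  rw [← sub_eq_zero, ← sub_eq_zero.2 h1]
  module

/-- The tensor `h'` of an almost Kenmotsu structure. -/
theorem lie_phi (U : 𝔛) : G.br ξ (φ (φ U)) - φ (G.br ξ (φ U)) = (2 : A) • G.shape ξ U := by
  have h1 := h.covEnd_phi_xi_left (φ U)
  rw [covEnd_apply] at h1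
  have h2 := h.phi_nab_phi U
  simp only [br, map_sub, h2]
  rw [sub_eq_zero.1 h1, h.phi_phi', nab_neg_left, h.nab_proj, shape_apply]
  module

theorem covEnd_proj (U V : 𝔛) :
    G.covEnd (G.proj ξ) U V = -(G.g V (G.nab U ξ) • ξ) - G.g V ξ • G.nab U ξ := by
  simp only [covEnd_apply, proj_apply, nab_sub, nab_smul, D_g]
  module

theorem covEnd_shape (U V : 𝔛) : G.covEnd (G.shape ξ) U V
    = G.covEnd (G.cov ξ) U V + G.g V (G.nab U ξ) • ξ + G.g V ξ • G.nab U ξ := by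
  have h1 := h.covEnd_proj U V
  rw [covEnd_apply] at h1
  simp only [covEnd_apply, shape, LinearMap.sub_apply, nab_sub] at h1 ⊢
  linear_combination (norm := module) -h1

theorem covEnd_shape_phi_xi (U : 𝔛) :
    G.covEnd (G.shape ξ) ξ (φ U) + φ (G.covEnd (G.shape ξ) ξ U) = 0 := by
  have h1 := h.covEnd_phi_xi_left U
  have h2 := h.covEnd_phi_xi_left (G.shape ξ U)
  rw [covEnd_apply, sub_eq_zero] at h1 h2
  rw [covEnd_apply, covEnd_apply, h1, map_sub, ← h2, h.phi_shape, h.phi_shape, nab_neg]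
  abel

end IsAlmostKenmotsu

/-- The `(k, μ)'`-nullity condition, `k` and `μ` being constants. -/
structure IsKMuPrime (φ : 𝔛 →ₗ[A] 𝔛) (ξ : 𝔛) (k μ : A) : Prop
    extends G.IsAlmostKenmotsu φ ξ where
  D_k : ∀ U, G.D U k = 0
  nullity : ∀ U V, G.R U V ξ = k • (G.g V ξ • U - G.g U ξ • V)
    + μ • (G.g V ξ • G.shape ξ U - G.g U ξ • G.shape ξ V)

namespace IsKMuPrime

variable {G} [Algebra ℝ A] {φ : 𝔛 →ₗ[A] 𝔛} {ξ : 𝔛} {k μ : A} (h : G.IsKMuPrime φ ξ k μ)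
include h

/-- The Riccati equation: R(U,ξ)ξ is computed from the nullity condition and from the second
derivatives of ξ. -/
theorem covEnd_shape_xi' (U : 𝔛) : G.covEnd (G.shape ξ) ξ U
    = -((k + 1) • G.proj ξ U) - (μ + 2) • G.shape ξ U - G.shape ξ (G.shape ξ U) := by
  have h1 := G.covEnd_covEnd_cov_swap ξ U ξ
  rw [h.nullity, h.g_xi, h.shape_xi] at h1
  rw [h.covEnd_shape, h.nab_xi_xi, map_zero]
  have h2 : G.covEnd (G.cov ξ) U ξ = -(G.proj ξ U + (2 : A) • G.shape ξ U
      + G.shape ξ (G.shape ξ U)) := by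
    rw [covEnd_apply, cov_apply, cov_apply, h.nab_xi_xi, nab_zero, zero_sub,
      G.nab_eq_shape ξ (G.nab U ξ), h.proj_nab, G.nab_eq_shape ξ U, map_add, h.shape_proj]
    module
  rw [h2] at h1
  rw [proj_apply] at *
  linear_combination (norm := module) -h1

/-- Because ∇_ξ φ = 0, the tensor ∇_ξ B anticommutes with φ, like B itself. In the Riccati equation
P and B² commute with φ, so their combination must vanish separately. This holds first on the image
of φ, which is the whole horizontal part. -/
theorem shape_shape (U : 𝔛) : G.shape ξ (G.shape ξ U) = -(k + 1) • G.proj ξ U := by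
  have h1 (U : 𝔛) : G.shape ξ (G.shape ξ (φ U)) = -(k + 1) • φ U := by
    have h1 := h.covEnd_shape_phi_xi U
    rw [h.covEnd_shape_xi', h.covEnd_shape_xi'] at h1
    simp only [map_sub, map_neg, map_smul, h.phi_shape, h.phi_proj, h.proj_phi] at h1
    refine smul_two_cancel (A := A) ?_
    rw [← sub_eq_zero, ← neg_eq_zero, ← h1]
    module
  have h2 := h1 (φ U)
  rw [h.phi_phi'] at h2
  simp only [map_neg, h.shape_proj] at h2
  rw [← neg_inj, h2]
  module

theorem covEnd_shape_xi (U : 𝔛) : G.covEnd (G.shape ξ) ξ U = -((μ + 2) • G.shape ξ U) := by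
  rw [h.covEnd_shape_xi', h.shape_shape]
  module

/-- Differentiate B² = -(k+1)P along ξ: the right side is parallel along ξ, and the left side gives
-2(μ+2)B². -/
theorem mul_smul_proj (U : 𝔛) : ((μ + 2) * (k + 1)) • G.proj ξ U = 0 := by
  have h1 : G.nab ξ (G.shape ξ (G.shape ξ U)) - G.shape ξ (G.shape ξ (G.nab ξ U))
      = G.covEnd (G.shape ξ) ξ (G.shape ξ U) + G.shape ξ (G.covEnd (G.shape ξ) ξ U) := by
    simp only [covEnd_apply, map_sub]; abel
  have h2 := h.covEnd_proj ξ U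
  rw [h.nab_xi_xi, map_zero, zero_smul, smul_zero, neg_zero, sub_zero, covEnd_apply,
    sub_eq_zero] at h2
  rw [h.covEnd_shape_xi, h.covEnd_shape_xi, h.shape_shape, h.shape_shape, nab_smul, h2] at h1
  have h3 : G.D ξ (-(k + 1)) = 0 := by rw [D_neg, D_add, h.D_k, D_one, add_zero, neg_zero]
  rw [h3, map_neg, map_smul, h.shape_shape] at h1
  refine smul_two_cancel (A := A) ?_
  rw [smul_zero, ← neg_eq_zero, ← sub_eq_zero.2 h1]
  module

end IsKMuPrime

end FramedGeometry

/-! ### Traces of h' and, for k ≠ -1, the covariant derivatives of h' and φ. -/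

namespace FramedGeometry

variable {A 𝔛 : Type*} [CommRing A] [AddCommGroup 𝔛] [Module A 𝔛] {n : ℕ}
  (G : FramedGeometry A 𝔛 n)

theorem ricci_identity (T : 𝔛 →ₗ[A] 𝔛) (U V W : 𝔛) :
    G.R U V (T W) - T (G.R U V W)
      = G.covBil (fun V W => G.covEnd T V W) U V W - G.covBil (fun V W => G.covEnd T V W) V U W := by
  simp only [covBil, covEnd_apply, R_apply, br, nab_sub, nab_sub_left, map_sub]
  abel

theorem sum_adjoint (Θ : 𝔛 →ₗ[A] 𝔛 →ₗ[A] A) (T T' : 𝔛 →ₗ[A] 𝔛)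
    (hT : ∀ U V, G.g (T U) V = G.g U (T' V)) :
    ∑ i, Θ (T (G.e i)) (G.e i) = ∑ i, Θ (G.e i) (T' (G.e i)) := by
  have e1 (i : Fin n) := G.bilin_expand_left Θ (T (G.e i)) (G.e i)
  have e2 (i : Fin n) := G.bilin_expand_right Θ (G.e i) (T' (G.e i))
  simp_rw [e1, e2]
  rw [Finset.sum_comm]
  simp_rw [hT, G.g_symm (T' _)]

/-- The trace of a bilinear form on the orthogonal complement of a unit field. -/
theorem sum_proj {ξ : 𝔛} (hξ : G.g ξ ξ = 1) (Θ : 𝔛 →ₗ[A] 𝔛 →ₗ[A] A) :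
    ∑ i, Θ (G.proj ξ (G.e i)) (G.proj ξ (G.e i)) = ∑ i, Θ (G.e i) (G.e i) - Θ ξ ξ := by
  have e1 := G.bilin_expand_left Θ ξ ξ
  have e2 := G.bilin_expand_right Θ ξ ξ
  have e3 : ∑ i, G.g ξ (G.e i) * G.g ξ (G.e i) = 1 := by rw [sum_g_e, hξ]
  simp only [proj_apply, map_sub, map_smul, LinearMap.sub_apply, LinearMap.smul_apply,
    smul_eq_mul, Finset.sum_sub_distrib, G.g_symm _ ξ, ← mul_assoc, mul_sub]
  rw [← e2, ← e1, ← Finset.sum_mul, e3]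
  ring

namespace IsAlmostKenmotsu

variable {G} [Algebra ℝ A] {φ : 𝔛 →ₗ[A] 𝔛} {ξ : 𝔛} (h : G.IsAlmostKenmotsu φ ξ)
include h

/-- As φ is skew and anticommutes with B, moving one φ across the trace of Bφ² equates the trace of
B with its negative. -/
theorem sum_shape : ∑ i, G.g (G.shape ξ (G.e i)) (G.e i) = 0 := by
  have e1 := G.sum_adjoint (G.g.comp (G.shape ξ ∘ₗ φ)) φ (-φ) (fun U V => by simp [h.g_phi])
  simp only [LinearMap.comp_apply, h.phi_phi', map_neg, h.shape_proj, LinearMap.neg_apply] at e1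
  have e2 (i : Fin n) : G.g (G.shape ξ (φ (G.e i))) (φ (G.e i))
      = -G.g (G.shape ξ (G.e i)) (G.e i) := by
    rw [← neg_neg (G.shape ξ (φ (G.e i))), ← h.phi_shape, map_neg, LinearMap.neg_apply, h.g_phi,
      h.phi_phi', map_neg, neg_neg, ← h.g_proj_symm, h.proj_shape]
  simp only [e2, Finset.sum_neg_distrib] at e1
  refine mul_two_cancel ?_
  linear_combination -e1

theorem sum_g_proj : ∑ i, G.g (G.proj ξ (G.e i)) (G.e i) = n - 1 := by
  have := G.sum_proj h.g_xi G.g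
  rw [sum_g_e_self, h.g_xi] at this
  rw [← this]
  refine Finset.sum_congr rfl fun i _ => ?_
  rw [h.g_proj_symm, h.g_proj_symm, h.proj_proj]

theorem sum_nab_xi : ∑ i, G.g (G.nab (G.e i) ξ) (G.e i) = n - 1 := by
  simp only [G.nab_eq_shape ξ, map_add, LinearMap.add_apply, Finset.sum_add_distrib, h.sum_shape,
    h.sum_g_proj, add_zero]

theorem covEnd_shape_symm (U V W : 𝔛) :
    G.g (G.covEnd (G.shape ξ) U V) W = G.g V (G.covEnd (G.shape ξ) U W) := by
  have h1 := congrArg (G.D U) (h.g_shape_symm V W)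
  rw [D_g, D_g] at h1
  have h2 := h.g_shape_symm (G.nab U V) W
  have h3 := h.g_shape_symm V (G.nab U W)
  simp only [covEnd_apply, map_sub, LinearMap.sub_apply]
  linear_combination h1 - h2 - h3

theorem covEnd_shape_of_xi (U : 𝔛) :
    G.covEnd (G.shape ξ) U ξ = -G.shape ξ (G.nab U ξ) := by
  rw [covEnd_apply, h.shape_xi, nab_zero, zero_sub]

end IsAlmostKenmotsu

namespace IsKMuPrime

variable {G} [Algebra ℝ A] {φ : 𝔛 →ₗ[A] 𝔛} {ξ : 𝔛} {k μ : A} (h : G.IsKMuPrime φ ξ k μ)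
include h

theorem ric_xi (V : 𝔛) : G.ric V ξ = k * (n - 1) * G.g V ξ := by
  simp only [ric_apply, h.nullity, map_add, map_smul, map_sub, LinearMap.add_apply,
    LinearMap.smul_apply, LinearMap.sub_apply, smul_eq_mul, Finset.sum_add_distrib,
    ← Finset.mul_sum, Finset.sum_sub_distrib, h.sum_shape, sum_g_e_self, G.g_symm _ ξ]
  rw [← G.bilin_expand_right G.g V ξ |> fun e => (by simpa [G.g_symm ξ] using e :
    G.g V ξ = ∑ i, G.g ξ (G.e i) * G.g V (G.e i))]
  have e2 : ∑ i, G.g ξ (G.e i) * G.g (G.shape ξ V) (G.e i) = 0 := by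
    rw [← G.bilin_expand_right G.g, h.g_shape_xi]
  rw [e2, G.g_symm V ξ]
  ring

section Nondegenerate

variable (hk : IsUnit (k + 1))
include hk

theorem mu_smul_shape (U : 𝔛) : (μ + 2) • G.shape ξ U = 0 := by
  have h1 := congrArg (G.shape ξ) (h.mul_smul_proj U)
  rw [map_smul, h.shape_proj, map_zero, mul_comm, mul_smul] at h1
  exact (hk.smul_eq_zero).1 h1

theorem covEnd_shape_xi_left (U : 𝔛) : G.covEnd (G.shape ξ) ξ U = 0 := by
  rw [h.covEnd_shape_xi, h.mu_smul_shape hk, neg_zero]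

/-- The derivative of B² = -(k+1)P has no horizontal part, so (∇_U B)B + B(∇_U B) vanishes between
horizontal fields. -/
theorem covEnd_shape_shape {U V W : 𝔛} (hV : G.g V ξ = 0) (hW : G.g W ξ = 0) :
    G.g (G.covEnd (G.shape ξ) U (G.shape ξ V)) W
      = -G.g (G.covEnd (G.shape ξ) U V) (G.shape ξ W) := by
  have h1 : G.nab U (G.shape ξ (G.shape ξ V)) - G.shape ξ (G.shape ξ (G.nab U V))
      = G.covEnd (G.shape ξ) U (G.shape ξ V) + G.shape ξ (G.covEnd (G.shape ξ) U V) := by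
    simp only [covEnd_apply, map_sub]; abel
  have h2 := h.covEnd_proj U V
  have h3 : G.D U (-(k + 1)) = 0 := by rw [D_neg, D_add, h.D_k, D_one, add_zero, neg_zero]
  rw [h.shape_shape, h.shape_shape, nab_smul, h3, zero_smul, add_zero, ← smul_sub, ← covEnd_apply,
    h2, hV] at h1
  have h4 := congrArg (fun Z => G.g Z W) h1
  simp only [map_smul, map_neg, map_add, LinearMap.smul_apply, LinearMap.neg_apply,
    LinearMap.add_apply, G.g_symm ξ W, hW, zero_smul, sub_zero, neg_zero, h.g_shape_symm,
    smul_eq_mul, mul_zero] at h4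
  linear_combination -h4

/-- The Codazzi equation of the leaves: R(U,V)ξ vanishes for horizontal U, V. -/
theorem covEnd_shape_comm {U V : 𝔛} (hU : G.g U ξ = 0) (hV : G.g V ξ = 0) :
    G.covEnd (G.shape ξ) U V = G.covEnd (G.shape ξ) V U := by
  have h1 := G.covEnd_covEnd_cov_swap ξ U V
  rw [h.nullity, hU, hV] at h1
  rw [h.covEnd_shape, h.covEnd_shape, hU, hV, G.g_symm V, G.g_symm U, h.closed U V]
  linear_combination (norm := module) h1

/-- On horizontal fields T(U,V,W) = g((∇_U B)V, W) is totally symmetric, and moving B from one slot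
to another changes the sign. Going from the first slot to the third directly gives a minus, going
through the second gives a plus; so T(BU,V,W) = 0. Since B² is an invertible multiple of P, and ∇_ξ
B = 0, the vanishing extends to every U. -/
theorem g_covEnd_shape {U V W : 𝔛} (hV : G.g V ξ = 0) (hW : G.g W ξ = 0) :
    G.g (G.covEnd (G.shape ξ) U V) W = 0 := by
  have hB (U : 𝔛) := h.g_shape_xi U
  have key {U V W : 𝔛} (hU : G.g U ξ = 0) (hV : G.g V ξ = 0) (hW : G.g W ξ = 0) :
      G.g (G.covEnd (G.shape ξ) (G.shape ξ U) V) W = 0 := by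
    have h1 : G.g (G.covEnd (G.shape ξ) (G.shape ξ U) V) W
        = -G.g (G.covEnd (G.shape ξ) U V) (G.shape ξ W) := by
      rw [h.covEnd_shape_comm hk (hB U) hV, h.covEnd_shape_shape hk hU hW,
        h.covEnd_shape_comm hk hV hU]
    have h2 : G.g (G.covEnd (G.shape ξ) (G.shape ξ U) V) W
        = G.g (G.covEnd (G.shape ξ) U V) (G.shape ξ W) := by
      rw [h.covEnd_shape_symm, G.g_symm, h.covEnd_shape_comm hk (hB U) hW,
        h.covEnd_shape_shape hk hU hV, h.covEnd_shape_comm hk hW hU, h.covEnd_shape_symm,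
        G.g_symm, h.covEnd_shape_shape hk hV hW, neg_neg]
    refine mul_two_cancel ?_
    linear_combination h1 + h2
  have h1 := key (hB (G.proj ξ U)) hV hW
  rw [h.shape_shape, h.proj_proj, map_smul, LinearMap.smul_apply, map_smul, LinearMap.smul_apply,
    smul_eq_mul, neg_mul, neg_eq_zero, hk.mul_right_eq_zero, proj_apply, map_sub, map_smul,
    LinearMap.sub_apply, LinearMap.smul_apply, h.covEnd_shape_xi_left hk, smul_zero, sub_zero] at h1
  exact h1

theorem covEnd_shape_eq (U V : 𝔛) : G.covEnd (G.shape ξ) U V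
    = -(G.g V ξ • G.shape ξ (G.nab U ξ)) - G.g (G.shape ξ (G.nab U ξ)) V • ξ := by
  refine G.ext_g fun Z => ?_
  have h1 := h.g_covEnd_shape hk (U := U) (h.g_proj_xi V) (h.g_proj_xi Z)
  have h2 := h.covEnd_shape_symm U V ξ
  simp only [proj_apply, map_sub, map_smul, LinearMap.sub_apply, LinearMap.smul_apply,
    h.covEnd_shape_of_xi, map_neg, LinearMap.neg_apply, h.g_shape_xi, smul_eq_mul] at h1 h2 ⊢
  rw [h2, G.g_symm V (G.shape ξ _)] at h1
  rw [G.g_symm ξ Z]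
  linear_combination h1

/-- Write F(U,V,W) = g((∇_U φ)V, W). On horizontal fields F is skew in V, W, its cyclic sum vanishes
by the equation for dΦ, φ moves between the last two slots without a sign, and B moves with one.
These symmetries, with B² = -(k+1), leave only F = 0. -/
theorem g_covEnd_phi {U V W : 𝔛} (hV : G.g V ξ = 0) (hW : G.g W ξ = 0) :
    G.g (G.covEnd φ U V) W = 0 := by
  have hB (U : 𝔛) := h.g_shape_xi U
  have hφ (U : 𝔛) := h.g_phi_xi U
  have skew := h.covEnd_phi_skew
  have skew' (U V W : 𝔛) : G.g (G.covEnd φ U V) W = -G.g (G.covEnd φ U W) V := by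
    rw [skew, G.g_symm]
  have cyc {U V W : 𝔛} (hU : G.g U ξ = 0) (hV : G.g V ξ = 0) (hW : G.g W ξ = 0) :
      G.g (G.covEnd φ U V) W + G.g (G.covEnd φ V W) U + G.g (G.covEnd φ W U) V = 0 := by
    have h1 := h.d_Phi U V W
    rw [hU, hV, hW, G.g_symm V, G.g_symm U, G.g_symm U, skew' W V U, skew' U W V] at h1
    linear_combination -h1
  have phi {U V W : 𝔛} (hV : G.g V ξ = 0) (hW : G.g W ξ = 0) :
      G.g (G.covEnd φ U (φ V)) W = G.g (G.covEnd φ U V) (φ W) := by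
    have h1 := congrArg (fun Z => G.g Z W) (h.covEnd_phi_phi U V)
    simp only [hV, zero_smul, add_zero, map_add, LinearMap.add_apply, map_smul,
      LinearMap.smul_apply, G.g_symm ξ W, hW, smul_zero, h.g_phi] at h1
    linear_combination h1
  have shp {U V W : 𝔛} (hV : G.g V ξ = 0) (hW : G.g W ξ = 0) :
      G.g (G.covEnd φ U (G.shape ξ V)) W = -G.g (G.covEnd φ U V) (G.shape ξ W) := by
    have h1 : G.covEnd φ U (G.shape ξ V) + φ (G.covEnd (G.shape ξ) U V)
        = -G.covEnd (G.shape ξ) U (φ V) - G.shape ξ (G.covEnd φ U V) := by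
      simp only [covEnd_apply, map_sub, h.phi_shape, nab_neg]
      abel
    have h2 := congrArg (fun Z => G.g Z W) h1
    simp only [map_add, LinearMap.add_apply, map_sub, LinearMap.sub_apply, map_neg,
      LinearMap.neg_apply, h.g_phi, h.g_covEnd_shape hk hV (hφ W),
      h.g_covEnd_shape hk (hφ V) hW, h.g_shape_symm] at h2
    linear_combination h2
  have ss {U : 𝔛} (hU : G.g U ξ = 0) : G.shape ξ (G.shape ξ U) = -(k + 1) • U := by
    rw [h.shape_shape, h.proj_of_g_eq_zero hU]
  -- The combination F(U,B²V,W) + F(BU,BV,W). It is chosen so that, in the cyclic identities for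
  -- (U,V,W) and (BU,BV,W), the terms differentiated along W cancel; this leaves symmetry of E in U,
  -- V.
  set E : 𝔛 → 𝔛 → 𝔛 → A := fun U V W => -(k + 1) * G.g (G.covEnd φ U V) W
    + G.g (G.covEnd φ (G.shape ξ U) (G.shape ξ V)) W
  have E_symm {U V W : 𝔛} (hU : G.g U ξ = 0) (hV : G.g V ξ = 0) (hW : G.g W ξ = 0) :
      E U V W = E V U W := by
    have c1 := cyc hU hV hW
    have c2 := cyc (hB U) (hB V) hW
    have s1 := shp (U := W) hU (hB V)
    rw [ss hV, map_smul, smul_eq_mul] at s1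
    simp only [E]
    rw [skew' V U W, skew' (G.shape ξ V) (G.shape ξ U) W]
    linear_combination -(k + 1) * c1 + c2 - s1
  have E_skew {U V W : 𝔛} (hU : G.g U ξ = 0) (hV : G.g V ξ = 0) (hW : G.g W ξ = 0) :
      E U V (φ W) = -E U W (φ V) := by
    have e1 := phi (U := U) hV hW
    have e2 := skew' U (φ V) W
    have e3 := phi (U := G.shape ξ U) (hB V) hW
    have e4 := shp (U := G.shape ξ U) (hφ V) hW
    have e5 := skew' (G.shape ξ U) (φ V) (G.shape ξ W)
    rw [h.phi_shape, map_neg, map_neg, LinearMap.neg_apply] at e3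
    simp only [E]
    linear_combination (k + 1) * e1 - (k + 1) * e2 - e3 - e4 + e5
  -- A trilinear form symmetric in its first two slots and skew in its last two is zero.
  have E_zero' {U V W : 𝔛} (hU : G.g U ξ = 0) (hV : G.g V ξ = 0) (hW : G.g W ξ = 0) :
      E U V (φ W) = 0 := by
    refine mul_two_cancel ?_
    have e1 := E_skew hU hV hW
    have e2 := E_symm hU hW (hφ V)
    have e3 := E_skew hW hU hV
    have e4 := E_symm hW hV (hφ U)
    have e5 := E_skew hV hW hU
    have e6 := E_symm hV hU (hφ W)
    linear_combination e1 - e2 - e3 + e4 + e5 - e6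
  have E_zero {U V W : 𝔛} (hU : G.g U ξ = 0) (hV : G.g V ξ = 0) (hW : G.g W ξ = 0) :
      E U V W = 0 := by
    have e1 := E_zero' hU hV (hφ W)
    rw [h.phi_phi', h.proj_of_g_eq_zero hW] at e1
    simp only [E, map_neg] at e1 ⊢
    linear_combination -e1
  -- With E = 0, (k+1)F(U,V,W) equals F(BU,BV,W). The latter is symmetric in V, W while the former
  -- is skew.
  have F_zero {U V W : 𝔛} (hU : G.g U ξ = 0) (hV : G.g V ξ = 0) (hW : G.g W ξ = 0) :
      (k + 1) * G.g (G.covEnd φ U V) W = 0 := by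
    refine mul_two_cancel ?_
    have e1 := E_zero hU hV hW
    have e2 := E_zero hU hW hV
    have e3 := shp (U := G.shape ξ U) hV hW
    have e4 := skew' (G.shape ξ U) (G.shape ξ W) V
    have e5 := skew' U W V
    simp only [E] at e1 e2
    linear_combination -e1 + e2 + e3 - e4 + (k + 1) * e5
  have h1 := F_zero (h.g_proj_xi U) hV hW
  rw [hk.mul_right_eq_zero, proj_apply, map_sub, map_smul, LinearMap.sub_apply,
    LinearMap.smul_apply, h.covEnd_phi_xi_left, smul_zero, sub_zero] at h1
  exact h1

theorem covEnd_phi_eq (U V : 𝔛) : G.covEnd φ U V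
    = -(G.g V ξ • φ (G.nab U ξ)) + G.g (φ (G.nab U ξ)) V • ξ := by
  refine G.ext_g fun Z => ?_
  have h1 := h.g_covEnd_phi hk (U := U) (h.g_proj_xi V) (h.g_proj_xi Z)
  have h2 := h.covEnd_phi_skew U V ξ
  simp only [proj_apply, map_sub, map_add, map_smul, LinearMap.sub_apply, LinearMap.smul_apply,
    LinearMap.add_apply, h.covEnd_phi_xi, map_neg, LinearMap.neg_apply, h.g_phi_xi,
    smul_eq_mul] at h1 h2 ⊢
  rw [h2, G.g_symm V (φ _)] at h1
  rw [G.g_symm ξ Z]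
  linear_combination h1

end Nondegenerate

end IsKMuPrime

end FramedGeometry

/-! ### Curvature, Ricci tensor and scalar curvature for k ≠ -1. -/

namespace FramedGeometry

variable {A 𝔛 : Type*} [CommRing A] [AddCommGroup 𝔛] [Module A 𝔛] {n : ℕ}
  {G : FramedGeometry A 𝔛 n} [Algebra ℝ A] {φ : 𝔛 →ₗ[A] 𝔛} {ξ : 𝔛} {k μ : A}

/-- The Ricci identity for a tensor T whose covariant derivative only involves ξ. It serves T = h'
with ε = -1 and T = φ with ε = 1; in both cases the right side is what the second fundamental form
terms contribute, so the curvature of the leaves commutes with T. -/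
theorem curvature_comm {T C : 𝔛 →ₗ[A] 𝔛} {ε : A} (hε : ∀ U, G.D U ε = 0)
    (hT : ∀ U V, G.covEnd T U V = -(G.g V ξ • C U) + (ε * G.g (C U) V) • ξ) (U V : 𝔛)
    {W Z : 𝔛} (hW : G.g W ξ = 0) (hZ : G.g Z ξ = 0) :
    G.g (G.R U V (T W)) Z - G.g (T (G.R U V W)) Z
      = -(G.g W (G.nab U ξ) * G.g (C V) Z) + ε * G.g (C V) W * G.g (G.nab U ξ) Z
        + G.g W (G.nab V ξ) * G.g (C U) Z - ε * G.g (C U) W * G.g (G.nab V ξ) Z := by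
  have key (U V : 𝔛) : G.g (G.covBil (fun V W => G.covEnd T V W) U V W) Z
      = -(G.g W (G.nab U ξ) * G.g (C V) Z) + ε * G.g (C V) W * G.g (G.nab U ξ) Z := by
    simp only [covBil, hT, nab_add, nab_neg, nab_smul, D_g, D_mul, hε, map_sub, map_add, map_neg,
      map_smul, LinearMap.add_apply, LinearMap.sub_apply, LinearMap.neg_apply,
      LinearMap.smul_apply, smul_eq_mul]
    rw [G.g_symm ξ Z, hW, hZ]
    ring
  rw [← LinearMap.sub_apply, ← map_sub, ricci_identity, map_sub, LinearMap.sub_apply, key, key]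
  ring

namespace IsKMuPrime

variable (h : G.IsKMuPrime φ ξ k μ)
include h

section Nondegenerate

variable (hk : IsUnit (k + 1))
include hk

/-- The Gauss equation: the leaves orthogonal to `ξ` are flat. -/
theorem curvature_horizontal {U V W Z : 𝔛} (hU : G.g U ξ = 0) (hV : G.g V ξ = 0)
    (hW : G.g W ξ = 0) (hZ : G.g Z ξ = 0) :
    G.g (G.R U V W) Z = G.g (G.nab U ξ) W * G.g (G.nab V ξ) Z
      - G.g (G.nab V ξ) W * G.g (G.nab U ξ) Z := by
  have hB (U : 𝔛) := h.g_shape_xi U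
  have hφ (U : 𝔛) := h.g_phi_xi U
  have ss {U : 𝔛} (hU : G.g U ξ = 0) : G.shape ξ (G.shape ξ U) = -(k + 1) • U := by
    rw [h.shape_shape, h.proj_of_g_eq_zero hU]
  -- On horizontal fields this is the intrinsic curvature of the leaves, by the Gauss equation. It
  -- keeps the symmetries of a curvature tensor because ∇ξ is symmetric.
  set ρ : 𝔛 → 𝔛 → 𝔛 → 𝔛 → A := fun U V W Z => G.g (G.R U V W) Z
    + G.g (G.nab V ξ) W * G.g (G.nab U ξ) Z - G.g (G.nab U ξ) W * G.g (G.nab V ξ) Z with hρ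
  have pair (U V W Z : 𝔛) : ρ U V W Z = ρ W Z U V := by
    simp only [hρ]
    rw [G.g_R_pair, h.closed V W, h.closed U Z, h.closed U W, h.closed V Z]
    ring
  have cyc (U V W Z : 𝔛) : ρ U V W Z + ρ V W U Z + ρ W U V Z = 0 := by
    simp only [hρ]
    rw [h.closed W U, h.closed W V, h.closed V U]
    linear_combination G.g_bianchi U V W Z
  have b34 (U V : 𝔛) {W Z : 𝔛} (hW : G.g W ξ = 0) (hZ : G.g Z ξ = 0) :
      ρ U V (G.shape ξ W) Z = ρ U V W (G.shape ξ Z) := by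
    have h1 := curvature_comm (ε := -1) (C := G.shape ξ ∘ₗ G.cov ξ)
      (fun U => by rw [D_neg, D_one, neg_zero])
      (fun U V => by
        rw [h.covEnd_shape_eq hk, LinearMap.comp_apply, cov_apply]; module) U V hW hZ
    simp only [hρ, LinearMap.comp_apply, cov_apply, h.g_shape_symm, ← G.g_symm W] at h1 ⊢
    rw [G.g_symm W (G.nab U ξ), G.g_symm W (G.nab V ξ)] at *
    linear_combination h1
  have p34 (U V : 𝔛) {W Z : 𝔛} (hW : G.g W ξ = 0) (hZ : G.g Z ξ = 0) :
      ρ U V (φ W) Z = -ρ U V W (φ Z) := by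
    have h1 := curvature_comm (ε := 1) (C := φ ∘ₗ G.cov ξ)
      (fun U => D_one _ U)
      (fun U V => by
        rw [h.covEnd_phi_eq hk, LinearMap.comp_apply, cov_apply]; module) U V hW hZ
    simp only [hρ, LinearMap.comp_apply, cov_apply, h.g_phi] at h1 ⊢
    rw [G.g_symm W (G.nab U ξ), G.g_symm W (G.nab V ξ)] at *
    linear_combination h1
  have b12 {U V : 𝔛} (W Z : 𝔛) (hU : G.g U ξ = 0) (hV : G.g V ξ = 0) :
      ρ (G.shape ξ U) V W Z = ρ U (G.shape ξ V) W Z := by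
    rw [pair, b34 _ _ hU hV, pair]
  -- B already moves within each pair; four Bianchi identities let it cross from the first pair to
  -- the second.
  have b13 {U V W Z : 𝔛} (hU : G.g U ξ = 0) (hV : G.g V ξ = 0) (hW : G.g W ξ = 0)
      (hZ : G.g Z ξ = 0) : ρ (G.shape ξ U) V W Z = ρ U V (G.shape ξ W) Z := by
    have e1 := cyc (G.shape ξ U) V W Z
    have e2 := cyc U (G.shape ξ V) W Z
    have e3 := cyc U V (G.shape ξ W) Z
    have e4 := cyc U V W (G.shape ξ Z)
    rw [← b12 _ _ hU hV, b12 _ _ hV hW] at e2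
    rw [← b34 _ _ hW hZ, ← b34 _ _ hU hZ, ← b34 _ _ hV hZ] at e4
    rw [b12 _ _ hW hU] at e3
    refine mul_two_cancel ?_
    linear_combination e1 + e2 - e3 - e4
  have pp {U V W Z : 𝔛} (hW : G.g W ξ = 0) (hZ : G.g Z ξ = 0) :
      ρ U V (φ W) (φ Z) = ρ U V W Z := by
    rw [p34 _ _ hW (hφ Z), h.phi_phi', h.proj_of_g_eq_zero hZ]
    simp only [hρ, map_neg]
    ring
  -- Inserting φ in both last slots changes nothing. Doing so after moving B to the third slot
  -- changes the sign, because φB = -Bφ.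
  have zero {U V W Z : 𝔛} (hU : G.g U ξ = 0) (hV : G.g V ξ = 0) (hW : G.g W ξ = 0)
      (hZ : G.g Z ξ = 0) : ρ (G.shape ξ U) V W Z = 0 := by
    have e1 : ρ (G.shape ξ U) V (φ W) (φ Z) = -ρ U V (G.shape ξ W) Z := by
      rw [b13 hU hV (hφ W) (hφ Z), ← pp (hB W) hZ, h.phi_shape]
      simp only [hρ, map_neg, LinearMap.neg_apply]
      ring
    rw [pp hW hZ, ← b13 hU hV hW hZ] at e1
    refine mul_two_cancel ?_
    linear_combination e1
  have h1 := zero (hB U) hV hW hZ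
  rw [ss hU] at h1
  have h2 : (k + 1) * ρ U V W Z = 0 := by
    simp only [hρ, map_smul, nab_smul_left, LinearMap.smul_apply, smul_eq_mul] at h1 ⊢
    linear_combination -h1
  rw [hk.mul_right_eq_zero] at h2
  linear_combination h2

/-- With ∇ξ = 1 + B horizontally, the traced Gauss equation gives (1+B)² - (n-1)(1+B), and the plane
containing ξ contributes k - 2B since (μ+2)B = 0. As B² = -(k+1), the sum is -(n-1)(1+B). -/
theorem ric_horizontal {V W : 𝔛} (hV : G.g V ξ = 0) (hW : G.g W ξ = 0) :
    G.ric V W = -(n - 1) * (G.g V W + G.g (G.shape ξ V) W) := by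
  have e1 := G.sum_proj h.g_xi (G.rmOuter V W)
  set Θ : 𝔛 →ₗ[A] 𝔛 →ₗ[A] A := G.g.flip W ∘ₗ G.cov ξ |>.smulRight (G.g (G.nab V ξ))
  set Θ' : 𝔛 →ₗ[A] 𝔛 →ₗ[A] A := G.g (G.nab V ξ) W • G.g ∘ₗ G.cov ξ
  have e2 := G.sum_proj h.g_xi (Θ - Θ')
  have e3 (i : Fin n) : G.rmOuter V W (G.proj ξ (G.e i)) (G.proj ξ (G.e i))
      = (Θ - Θ') (G.proj ξ (G.e i)) (G.proj ξ (G.e i)) := by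
    rw [rmOuter_apply, h.curvature_horizontal hk (h.g_proj_xi _) hV hW (h.g_proj_xi _)]
    simp [Θ, Θ']
  have e4 : (Θ - Θ') ξ ξ = 0 := by
    simp [Θ, Θ', h.nab_xi_xi]
  have e5 : ∑ i, (Θ - Θ') (G.e i) (G.e i) = G.g (G.nab V ξ) (G.nab W ξ)
      - (n - 1) * G.g (G.nab V ξ) W := by
    simp only [Θ, Θ', LinearMap.sub_apply, LinearMap.smulRight_apply, LinearMap.comp_apply,
      LinearMap.flip_apply, LinearMap.smul_apply, cov_apply, smul_eq_mul, Finset.sum_sub_distrib,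
      ← Finset.mul_sum, h.sum_nab_xi, h.closed _ W]
    rw [G.bilin_expand_right G.g _ (G.nab W ξ)]
    ring
  have e6 : G.rmOuter V W ξ ξ = k * G.g V W - 2 * G.g (G.shape ξ V) W := by
    have m := h.mu_smul_shape hk W
    have m1 := congrArg (fun Z => G.g Z V) m
    simp only [map_smul, LinearMap.smul_apply, smul_eq_mul, map_zero, LinearMap.zero_apply] at m1
    rw [rmOuter_apply, G.g_R_pair, h.nullity, h.shape_xi, hW, h.g_xi]
    simp only [map_add, map_smul, LinearMap.add_apply, LinearMap.smul_apply, one_smul, zero_smul, sub_zero, smul_zero, smul_eq_mul]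
    rw [h.g_shape_symm V, G.g_symm V, G.g_symm V]
    linear_combination m1
  simp only [e3] at e1
  rw [e1, e4, e5, e6] at e2
  have e7 : G.ric V W = ∑ i, G.rmOuter V W (G.e i) (G.e i) := rfl
  have e8 := h.shape_shape V
  rw [h.proj_of_g_eq_zero hV] at e8
  have e9 := congrArg (fun Z => G.g Z W) e8
  simp only [map_smul, LinearMap.smul_apply, smul_eq_mul, h.g_shape_symm] at e9
  rw [G.nab_eq_shape ξ V, G.nab_eq_shape ξ W, h.proj_of_g_eq_zero hV, h.proj_of_g_eq_zero hW] at e2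
  simp only [map_add, LinearMap.add_apply, h.g_shape_symm] at e2 ⊢
  linear_combination e2 + e7 + e9

theorem scal_eq : G.scal = (n - 1) * (k - (n - 1)) := by
  have e1 := G.sum_proj h.g_xi G.ric
  have e2 := G.sum_proj h.g_xi G.g
  have e3 := G.sum_proj h.g_xi (G.g ∘ₗ G.shape ξ)
  simp only [h.ric_horizontal hk (h.g_proj_xi _) (h.g_proj_xi _), Finset.sum_add_distrib,
    ← Finset.mul_sum] at e1
  rw [e2] at e1
  simp only [LinearMap.comp_apply] at e3
  rw [e3, sum_g_e_self, h.sum_shape, h.shape_xi, h.ric_xi, h.g_xi] at e1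
  simp only [map_zero, LinearMap.zero_apply] at e1
  rw [scal]
  linear_combination -e1

/-- The Ricci tensor has no `g`-part proportional to the metric orthogonally to `ξ`. -/
theorem not_eta_einstein {a : A} (hn : IsUnit ((n : A) - 1))
    (ha : ∀ V W, G.g V ξ = 0 → G.g W ξ = 0 → G.ric V W = a * G.g V W) (U : 𝔛) :
    G.proj ξ U = 0 := by
  have e1 (V : 𝔛) (hV : G.g V ξ = 0) : (n - 1 : A) • G.shape ξ V = -(a + (n - 1)) • V := by
    refine G.ext_g fun Z => ?_
    have e := ha V (G.proj ξ Z) hV (h.g_proj_xi Z)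
    rw [h.ric_horizontal hk hV (h.g_proj_xi Z), ← h.g_proj_symm, ← h.g_proj_symm, h.proj_shape,
      h.proj_of_g_eq_zero hV] at e
    simp only [map_smul, LinearMap.smul_apply, smul_eq_mul]
    linear_combination -e
  -- Conjugation by φ reverses B but fixes a multiple of the identity, so both sides of `e1` vanish.
  -- The coefficient `a` may be any function.
  have e2 (V : 𝔛) (hV : G.g V ξ = 0) : (n - 1 : A) • G.shape ξ V = 0 := by
    have f1 := congrArg φ (e1 V hV)
    have f2 := e1 (φ V) (h.g_phi_xi V)
    rw [map_smul, map_smul, h.phi_shape, smul_neg, f2] at f1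
    have f3 : (a + (n - 1)) • φ V = 0 := by
      refine smul_two_cancel (A := A) ?_
      linear_combination (norm := module) f1
    have f4 := congrArg φ f3
    rw [map_smul, h.phi_phi', h.proj_of_g_eq_zero hV, map_zero] at f4
    rw [e1 V hV]
    linear_combination (norm := module) f4
  have e3 := e2 (G.proj ξ U) (h.g_proj_xi U)
  rw [hn.smul_eq_zero] at e3
  have e4 := congrArg (G.shape ξ) e3
  rw [h.shape_shape, h.proj_proj, map_zero, hk.neg.smul_eq_zero] at e4
  exact e4

end Nondegenerate

end IsKMuPrime

end FramedGeometry

/-! ### The case k = -1, where h' = 0. -/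

namespace FramedGeometry

variable {A 𝔛 : Type*} [CommRing A] [AddCommGroup 𝔛] [Module A 𝔛] {n : ℕ}
  {G : FramedGeometry A 𝔛 n} [Algebra ℝ A] {φ : 𝔛 →ₗ[A] 𝔛} {ξ X : 𝔛} {μ ρ : A}

theorem IsConformal.mul_scal_eq_zero (hX : G.IsConformal X ρ) (hρ : ∀ U, G.D U ρ = 0)
    (hs : G.D X G.scal = 0) : ρ * G.scal = 0 := by
  have h1 := hX.D_scal
  have h2 (U V : 𝔛) : G.hess ρ U V = 0 := by simp [hess, hρ]
  simp only [h2, Finset.sum_const_zero, hs] at h1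
  refine mul_two_cancel ?_
  linear_combination h1

theorem hess_bilin (f : A) (U V : 𝔛) : G.hess f U V = (G.g ∘ₗ G.cov (G.grad f)) U V :=
  (G.g_nab_grad f U V).symm

namespace IsKMuPrime

variable (h : G.IsKMuPrime φ ξ (-1) μ) (hs : ∀ U, G.shape ξ U = 0)
include h hs

theorem nab_xi (U : 𝔛) : G.nab U ξ = G.proj ξ U := by
  rw [nab_eq_shape, hs, add_zero]

theorem curvature_xi (U V : 𝔛) : G.R U V ξ = G.g U ξ • V - G.g V ξ • U := by
  rw [h.nullity, hs, hs]
  module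

theorem curvature_xi_mid (V W : 𝔛) : G.R V ξ W = G.g V W • ξ - G.g W ξ • V := by
  refine G.ext_g fun Z => ?_
  rw [G.g_R_pair, G.g_R_skew, h.curvature_xi hs]
  simp only [map_sub, map_smul, LinearMap.sub_apply, LinearMap.smul_apply, smul_eq_mul,
    G.g_symm ξ Z, G.g_symm Z V, G.g_symm W V]
  ring

/-- The general formula for the derivative of r is applied to ξ itself, whose covariant derivatives
and curvature R(·,ξ)· are explicit once ∇ξ = P. -/
theorem D_xi_scal : G.D ξ G.scal = -2 * (G.scal + n * (n - 1)) := by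
  -- The Lie derivative L_ξ ∇.
  set B : 𝔛 → 𝔛 → 𝔛 := fun V W => (-2 * G.g (G.proj ξ V) W) • ξ
  have hP (U V : 𝔛) : G.covEnd (G.proj ξ) U V
      = -(G.g V (G.proj ξ U) • ξ) - G.g V ξ • G.proj ξ U := by
    rw [h.covEnd_proj, h.nab_xi hs]
  have hB (V W : 𝔛) : B V W = G.covEnd (G.cov ξ) V W - G.R V ξ W := by
    have h1 := h.covEnd_shape V W
    have h2 : G.covEnd (G.shape ξ) V W = 0 := by simp [covEnd_apply, hs, nab_zero]
    rw [h2, h.nab_xi hs] at h1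
    rw [h.curvature_xi_mid hs]
    simp only [B, proj_apply, map_sub, map_smul, LinearMap.sub_apply, LinearMap.smul_apply,
      smul_eq_mul, G.g_symm W V, G.g_symm ξ W] at h1 ⊢
    linear_combination (norm := module) h1
  have hc (U V W : 𝔛) : G.covBil B U V W
      = (2 * (G.g V (G.proj ξ U) * G.g W ξ + G.g V ξ * G.g (G.proj ξ U) W)) • ξ
        - (2 * G.g (G.proj ξ V) W) • G.proj ξ U := by
    have h1 : G.nab U (G.proj ξ V) = G.covEnd (G.proj ξ) U V + G.proj ξ (G.nab U V) := by
      rw [covEnd_apply]; abel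
    simp only [covBil, B, nab_smul, D_mul, D_neg, D_ofNat, D_g, h1, hP, h.nab_xi hs, map_add,
      map_sub, map_neg, map_smul, LinearMap.add_apply, LinearMap.sub_apply, LinearMap.neg_apply,
      LinearMap.smul_apply, smul_eq_mul, G.g_symm ξ W]
    module
  have s1 (j : Fin n) : ∑ i, G.g (G.proj ξ (G.e i)) (G.e j) * G.g (G.e i) ξ = 0 := by
    have e := G.g_expand (G.proj ξ (G.e j)) ξ
    rw [h.g_proj_xi] at e
    rw [e]
    refine Finset.sum_congr rfl fun i _ => ?_
    rw [h.g_proj_symm, G.g_symm ξ, G.g_symm (G.e i) (G.proj ξ _)]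
  have s2 (j : Fin n) : ∑ i, G.g (G.proj ξ (G.e i)) (G.e j) * G.g (G.proj ξ (G.e i)) (G.e j)
      = G.g (G.proj ξ (G.e j)) (G.e j) := by
    have e := G.g_expand (G.proj ξ (G.e j)) (G.proj ξ (G.e j))
    rw [← h.g_proj_symm, h.proj_proj] at e
    rw [e]
    refine Finset.sum_congr rfl fun i _ => ?_
    rw [h.g_proj_symm, G.g_symm (G.e i) (G.proj ξ _)]
  have s3 : ∑ i, G.g (G.e i) ξ * G.g (G.e i) ξ = 1 := by
    rw [← h.g_xi, G.g_expand ξ ξ]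
    simp only [G.g_symm ξ]
  have s4 : ∑ i, G.ric (G.e i) (G.proj ξ (G.e i)) = G.scal + (n - 1) := by
    have e := G.sum_adjoint G.ric (G.proj ξ) (G.proj ξ) h.g_proj_symm
    simp only [proj_apply, map_sub, map_smul, smul_eq_mul, Finset.sum_sub_distrib]
    rw [← scal]
    have e1 : ∑ i, G.g (G.e i) ξ * G.ric (G.e i) ξ = -(n - 1) := by
      have e2 (i : Fin n) : G.g (G.e i) ξ * G.ric (G.e i) ξ
          = -(n - 1) * (G.g (G.e i) ξ * G.g (G.e i) ξ) := by rw [h.ric_xi]; ring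
      simp only [e2, ← Finset.mul_sum, s3, mul_one]
    rw [e1]; ring
  rw [G.D_scal hB]
  simp only [h.nab_xi hs, s4]
  have term (i j : Fin n) : G.g (G.covBil B (G.e i) (G.e j) (G.e j)) (G.e i)
      - G.g (G.covBil B (G.e j) (G.e i) (G.e j)) (G.e i)
      = 2 * (G.g (G.proj ξ (G.e i)) (G.e j) * G.g (G.e i) ξ) * G.g (G.e j) ξ
        - 2 * G.g (G.proj ξ (G.e i)) (G.e i) * G.g (G.proj ξ (G.e j)) (G.e j)
        - 2 * (G.g (G.e i) ξ * G.g (G.e i) ξ) * G.g (G.proj ξ (G.e j)) (G.e j)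
        + 2 * (G.g (G.proj ξ (G.e i)) (G.e j) * G.g (G.proj ξ (G.e i)) (G.e j)) := by
    rw [hc, hc]
    simp only [map_sub, map_smul, LinearMap.sub_apply, LinearMap.smul_apply, smul_eq_mul,
      G.g_symm ξ, ← h.g_proj_symm]
    rw [h.g_proj_symm (G.e j) (G.e i), G.g_symm (G.e j) (G.proj ξ _)]
    ring
  simp only [term, Finset.sum_add_distrib, Finset.sum_sub_distrib, ← Finset.mul_sum,
    ← Finset.sum_mul, s1, s2, s3, h.sum_g_proj]
  simp
  ring

theorem nab_xi_mem {U : 𝔛} (hU : G.g U ξ = 0) : G.g (G.nab ξ U) ξ = 0 := by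
  have e := G.D_g ξ U ξ
  rw [hU, h.nab_xi_xi, map_zero, D_zero] at e
  linear_combination -e

/-- Take the Lie derivative of the Hessian equation along ξ: horizontally L_ξ g = 2g, and L_ξ ∇ =
-2g ⊗ ξ, which cancels the extra 2ξu. The outcome has the same shape with u replaced by ξu and s by
ξs + 2s, so the lemma can be iterated. -/
theorem hess_D_xi {u s : A}
    (hu : ∀ U V, G.g U ξ = 0 → G.g V ξ = 0 → G.hess u U V = (s + G.D ξ u) * G.g U V)
    {U V : 𝔛} (hU : G.g U ξ = 0) (hV : G.g V ξ = 0) :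
    G.hess (G.D ξ u) U V = (G.D ξ s + 2 * s + G.D ξ (G.D ξ u)) * G.g U V := by
  have comm (Y : 𝔛) (f : A) : G.D Y (G.D ξ f)
      = G.D ξ (G.D Y f) - G.D (G.nab ξ Y) f + G.D Y f - G.g Y ξ * G.D ξ f := by
    have e := G.D_br ξ Y f
    rw [br, h.nab_xi hs, proj_apply, D_sub_left, D_sub_left, D_smul_left] at e
    linear_combination e
  have hR : G.nab ξ (G.nab U V) = G.nab U (G.nab ξ V) + G.nab (G.nab ξ U) V - G.nab U V
      - G.g U V • ξ := by
    have e := G.R_apply ξ U V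
    rw [R_swap, h.curvature_xi_mid hs, hV, br, h.nab_xi hs, h.proj_of_g_eq_zero hU,
      nab_sub_left] at e
    linear_combination (norm := module) -e
  have hg : G.g (G.nab U V) ξ = -G.g U V := by
    have e := G.D_g U V ξ
    rw [hV, h.nab_xi hs, h.proj_of_g_eq_zero hU, D_zero, G.g_symm V U] at e
    linear_combination -e
  have e1 := congrArg (G.D ξ) (hu U V hU hV)
  have e2 := hu (G.nab ξ U) V (h.nab_xi_mem hs hU) hV
  have e3 := hu U (G.nab ξ V) hU (h.nab_xi_mem hs hV)
  have e4 := hu U V hU hV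
  simp only [hess, D_mul, D_sub, D_add, D_g] at e1 e2 e3 e4 ⊢
  have c1 := comm V u
  have c2 := comm U (G.D V u)
  have c3 := comm (G.nab U V) u
  rw [hV] at c1
  rw [hU] at c2
  rw [hR, hg, D_sub_left, D_sub_left, D_add_left, D_smul_left] at c3
  rw [c1]
  simp only [D_add, D_sub, zero_mul, sub_zero]
  rw [c2, c3]
  linear_combination e1 - e2 - e3 + 2 * e4

section Conformal

variable (hX : G.IsConformal X ρ)
include hX

theorem D_xi_g_conformal : G.D ξ (G.g X ξ) = ρ := by
  rw [D_g, hX.g_nab_self, h.nab_xi_xi, h.g_xi]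
  simp

/-- The second derivatives of g(X,ξ) reduce to the conformal formula for ∇²X, whose curvature term
g(R(U,X)V, ξ) is known from R(·,·)ξ. -/
theorem hess_g_conformal {U V : 𝔛} (hU : G.g U ξ = 0) (hV : G.g V ξ = 0) :
    G.hess (G.g X ξ) U V = (ρ - G.D ξ ρ + G.D ξ (G.g X ξ)) * G.g U V := by
  have hD (Y : 𝔛) : G.D Y (G.g X ξ) = G.g (G.nab Y X) ξ + G.g X (G.proj ξ Y) := by
    rw [D_g, h.nab_xi hs]
  have hg : G.g (G.nab U V) ξ = -G.g U V := by
    have e := G.D_g U V ξ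
    rw [hV, h.nab_xi hs, h.proj_of_g_eq_zero hU, D_zero, G.g_symm V U] at e
    linear_combination -e
  have e1 := hX.g_covEnd_cov U V ξ
  rw [G.g_R_skew, h.curvature_xi hs, hU, hV] at e1
  have e2 := hX U V
  rw [h.D_xi_g_conformal hs hX, hess, hD V, hD (G.nab U V), h.proj_of_g_eq_zero hV, D_add, D_g, D_g,
    h.nab_xi hs, h.proj_of_g_eq_zero hU]
  simp only [covEnd_apply, cov_apply, proj_apply, map_sub, map_smul, LinearMap.sub_apply,
    LinearMap.smul_apply, smul_eq_mul, hg] at e1 ⊢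
  rw [G.g_symm (G.nab V X) U]
  linear_combination e1 + e2

/-- If the conformal factor is an affine function of the scalar curvature, then it vanishes. -/
theorem conformal_factor_nilpotent (hn : IsUnit ((n : A) - 1)) {β lam : A}
    (hβ : ∀ U, G.D U β = 0) (hl : ∀ U, G.D U lam = 0) (hρ : 2 * ρ = β * G.scal - 2 * lam) :
    2 * lam + β * (n * (n - 1)) = 0 ∧ ρ ^ 3 = 0 := by
  set f := G.g X ξ with hf
  -- The defect of λ from its predicted value: the equation for ξr turns the affine relation between
  -- ρ and r into ξρ = -2ρ + κ.
  set κ := -(2 * lam + β * (n * (n - 1))) with hκ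
  have Dn (U : 𝔛) : G.D U (n : A) = 0 := G.D_natCast U n
  have Dκ (U : 𝔛) : G.D U κ = 0 := by
    simp only [hκ, D_neg, D_add, D_mul, D_sub, D_one, hβ, hl, Dn, D_ofNat]; ring
  have Dρ : G.D ξ ρ = -2 * ρ + κ := by
    have e := congrArg (G.D ξ) hρ
    simp only [D_mul, D_sub, hβ, hl, D_ofNat, h.D_xi_scal hs] at e
    refine mul_two_cancel ?_
    linear_combination e + 2 * hρ
  have Df : G.D ξ f = ρ := h.D_xi_g_conformal hs hX
  have Hf (U V : 𝔛) (hU : G.g U ξ = 0) (hV : G.g V ξ = 0) :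
      G.hess f U V = ((3 * ρ - κ) + G.D ξ f) * G.g U V := by
    rw [h.hess_g_conformal hs hX hU hV, Dρ]; ring
  have Hρ (U V : 𝔛) (hU : G.g U ξ = 0) (hV : G.g V ξ = 0) :
      G.hess ρ U V = (κ + G.D ξ ρ) * G.g U V := by
    have e := h.hess_D_xi hs Hf hU hV
    rw [Df, D_sub, D_mul, D_ofNat, Dκ] at e
    rw [e, Dρ]; ring
  -- Hess(ξρ) is -2 Hess ρ by the formula for ξρ, and is also given by transporting Hess ρ along ξ.
  -- On horizontal fields the two differ by 4κg.
  have κ0 : κ = 0 := by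
    have e1 (U V : 𝔛) (hU : G.g U ξ = 0) (hV : G.g V ξ = 0) : κ * G.g U V = 0 := by
      have e := h.hess_D_xi hs Hρ hU hV
      have e' : G.hess (G.D ξ ρ) U V = -2 * G.hess ρ U V := by
        rw [Dρ]
        simp only [hess, D_add, D_mul, D_neg, D_ofNat, D_zero, Dκ]
        ring
      rw [e', Hρ U V hU hV, Dκ, Dρ] at e
      simp only [D_add, D_mul, D_neg, D_ofNat, Dκ, Dρ] at e
      refine mul_two_cancel (mul_two_cancel ?_)
      linear_combination -e
    have e2 := G.sum_proj h.g_xi G.g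
    rw [sum_g_e_self, h.g_xi] at e2
    refine hn.mul_left_eq_zero.1 ?_
    rw [← e2, Finset.mul_sum]
    exact Finset.sum_eq_zero fun i _ => e1 _ _ (h.g_proj_xi _) (h.g_proj_xi _)
  refine ⟨by linear_combination -κ0 + hκ, ?_⟩
  rw [κ0] at Dρ Hρ Hf
  rw [add_zero] at Dρ
  have D2ρ : G.D ξ (G.D ξ ρ) = 4 * ρ := by
    rw [Dρ, D_mul, D_neg, D_ofNat, Dρ]; ring
  have lap : ∑ i, G.hess ρ (G.e i) (G.e i) = 4 * ρ - 2 * (n - 1) * ρ := by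
    have e := G.sum_proj h.g_xi (G.g ∘ₗ G.cov (G.grad ρ))
    simp only [← hess_bilin, Hρ _ _ (h.g_proj_xi _) (h.g_proj_xi _)] at e
    have e2 := G.sum_proj h.g_xi G.g
    rw [sum_g_e_self, h.g_xi] at e2
    rw [← Finset.mul_sum, e2, Dρ] at e
    have e3 : G.hess ρ ξ ξ = 4 * ρ := by
      rw [hess, h.nab_xi_xi, D_zero_left, D2ρ, sub_zero]
    rw [e3] at e
    linear_combination -e
  set C := -2 * lam - β * (n - 1) * (4 - 2 * (n - 1)) with hC
  have DC (U : 𝔛) : G.D U C = 0 := by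
    simp only [hC, D_neg, D_mul, D_sub, D_one, hβ, hl, Dn, D_ofNat]; ring
  -- The formula for X r with Δρ = (4 - 2(n-1))ρ inserted and r eliminated through βr = 2ρ + 2λ;
  -- hence the constant `C`.
  have DXρ : G.D X ρ = -2 * ρ ^ 2 + C * ρ := by
    have e := congrArg (G.D X) hρ
    simp only [D_mul, D_sub, hβ, hl, D_ofNat, hX.D_scal, lap] at e
    refine mul_two_cancel ?_
    linear_combination e + 2 * ρ * hρ
  have hbr : G.br ξ X = (2 * ρ) • ξ - G.grad f := by
    refine G.ext_g fun Z => ?_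
    have e := hX ξ Z
    rw [br, h.nab_xi hs, map_sub, map_sub, LinearMap.sub_apply, LinearMap.sub_apply, g_grad,
      map_smul, LinearMap.smul_apply, smul_eq_mul, hf, D_g, h.nab_xi hs, ← h.g_proj_symm,
      G.g_symm (G.nab Z X)]
    linear_combination e
  -- Both ξρ and Xρ are polynomials in ρ, so the action of [ξ,X] = 2ρξ - grad f on ρ is known; `C`
  -- drops out.
  have hff : G.g (G.grad f) (G.grad ρ) = -8 * ρ ^ 2 := by
    have e := G.D_br ξ X ρ
    rw [hbr, D_sub_left, D_smul_left, DXρ, Dρ] at e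
    simp only [pow_two, D_add, D_mul, D_neg, D_ofNat, DC, DXρ, Dρ] at e
    rw [g_grad_right]
    linear_combination -e
  have split (u v : A) : G.g (G.grad u) (G.grad v)
      = G.g (G.proj ξ (G.grad u)) (G.grad v) + G.D ξ u * G.D ξ v := by
    simp only [proj_apply, map_sub, map_smul, LinearMap.sub_apply, LinearMap.smul_apply,
      smul_eq_mul, g_grad, g_grad_right]
    ring
  -- Differentiate g(grad f, grad ρ) = -8ρ² along V: the right side is -16ρVρ, and the Hessian
  -- equations reduce the left side to -ρVρ, the terms in Vf cancelling.
  have hV (V : 𝔛) (hV : G.g V ξ = 0) : ρ * G.D V ρ = 0 := by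
    have e := congrArg (G.D V) hff
    rw [D_g, g_nab_grad, G.g_symm (G.grad f), g_nab_grad] at e
    have e1 (u : A) (u' : A) : G.hess u' V (G.grad u)
        = G.hess u' V (G.proj ξ (G.grad u)) + G.D ξ u * G.hess u' V ξ := by
      rw [hess_bilin, hess_bilin, hess_bilin, proj_apply, map_sub, map_smul, g_grad]
      simp
    have e2 (u : A) : G.hess u V ξ = G.D V (G.D ξ u) - G.D V u := by
      rw [hess, h.nab_xi hs, h.proj_of_g_eq_zero hV]
    have e3 (u : A) : G.g V (G.proj ξ (G.grad u)) = G.D V u := by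
      rw [← h.g_proj_symm, h.proj_of_g_eq_zero hV, g_grad_right]
    rw [e1, e1, Hf _ _ hV (h.g_proj_xi _), Hρ _ _ hV (h.g_proj_xi _), e2, e2, e3, e3, Df, Dρ,
      pow_two] at e
    simp only [D_mul, D_neg, D_ofNat] at e
    have u15 : IsUnit (15 : A) := by
      simpa only [map_ofNat] using (IsUnit.mk0 (15 : ℝ) (by norm_num)).map (algebraMap ℝ A)
    refine u15.mul_right_eq_zero.1 ?_
    linear_combination e
  -- The horizontal part of grad f pairs with grad ρ to -8ρ² + 2ρ² = -6ρ², so taking it as V gives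
  -- 6ρ³ = 0.
  have e := hV _ (h.g_proj_xi (G.grad f))
  have e1 := split f ρ
  rw [hff, g_grad_right, Df, Dρ] at e1
  have u6 : IsUnit (6 : A) := by
    simpa only [map_ofNat] using (IsUnit.mk0 (6 : ℝ) (by norm_num)).map (algebraMap ℝ A)
  refine u6.mul_right_eq_zero.1 ?_
  linear_combination -ρ * e1 - e

end Conformal

/-- An `η`-Einstein manifold with constant coefficients is Einstein. -/
theorem eta_einstein (hn : IsUnit ((n : A) - 1)) {a b : A} (ha : G.D ξ a = 0) (hb : G.D ξ b = 0)
    (hric : ∀ U V, G.ric U V = a * G.g U V + b * (G.g U ξ * G.g V ξ)) :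
    a = -(n - 1) ∧ b = 0 ∧ G.scal = -(n * (n - 1)) := by
  have e1 := hric ξ ξ
  rw [h.ric_xi, h.g_xi] at e1
  have e2 : G.scal = n * a + b := by
    simp only [scal, hric, Finset.sum_add_distrib, ← Finset.mul_sum, sum_g_e_self]
    have : ∑ i, G.g (G.e i) ξ * G.g (G.e i) ξ = 1 := by
      rw [← h.g_xi, G.g_expand ξ ξ]
      simp only [G.g_symm ξ]
    rw [this]; ring
  -- With coefficients constant along ξ, r = na + b has ξr = 0, so r = -n(n-1); Ric(ξ,ξ) supplies
  -- the second equation for a and b.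
  have e3 := h.D_xi_scal hs
  rw [e2, D_add, D_mul, D_natCast, ha, hb] at e3
  have e4 : n * a + b + n * (n - 1) = 0 := by
    refine mul_two_cancel ?_
    linear_combination e3
  have e5 : a = -(n - 1) := by
    refine hn.mul_left_cancel ?_
    linear_combination e4 + e1
  refine ⟨e5, by linear_combination -e1 - e5, by linear_combination e2 + e4⟩

end IsKMuPrime

end FramedGeometry

/-! ### The theorem for algebras of functions and fields. -/

namespace FramedGeometry

variable {A 𝔛 : Type*} [CommRing A] [Nontrivial A] [IsReduced A] [Algebra ℝ A] [AddCommGroup 𝔛]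
  [Module A 𝔛]

/-- Conformal `η`-Ricci-Yamabe solitons on `(k, μ)'`-almost Kenmotsu manifolds, in terms of the
algebras of functions and fields. -/
theorem conformal_soliton {m : ℕ} (hm : 1 ≤ m) {G : FramedGeometry A 𝔛 (2 * m + 1)}
    (hD : ∀ U (c : ℝ), G.D U (algebraMap ℝ A c) = 0)
    (hdef : ∀ U, G.g U U = 0 → U = 0)
    (hpos : ∀ (Y : Fin (2 * m + 1) → 𝔛) (s : ℝ), ∑ i, G.g (Y i) (Y i) = algebraMap ℝ A s → 0 ≤ s)
    {φ : 𝔛 →ₗ[A] 𝔛} {ξ X : 𝔛} {ρ : A} {k μ α β lam ν : ℝ}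
    (h : G.IsKMuPrime φ ξ (algebraMap ℝ A k) (algebraMap ℝ A μ)) (hX : G.IsConformal X ρ)
    (hS : ∀ U V, 2 * ρ * G.g U V + 2 * algebraMap ℝ A α * G.ric U V
      + (2 * algebraMap ℝ A lam - algebraMap ℝ A β * G.scal) * G.g U V
      + 2 * algebraMap ℝ A ν * (G.g U ξ * G.g V ξ) = 0) :
    ρ = 0 ∧ lam = β * m * (k - 2 * m) + 2 * m * α ∧ ν = -2 * m * α * (k + 1)
      ∧ (α ≠ 0 → ∀ U V, G.ric U V = algebraMap ℝ A (-(2 * m)) * G.g U V) := by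
  have inj : Function.Injective (algebraMap ℝ A) := (algebraMap ℝ A).injective
  have unit {c : ℝ} (hc : c ≠ 0) : IsUnit (algebraMap ℝ A c) :=
    (IsUnit.mk0 c hc).map (algebraMap ℝ A)
  have m0 : (0 : ℝ) < m := by exact_mod_cast hm
  have en : (((2 * m + 1 : ℕ) : A) - 1) = algebraMap ℝ A (2 * m) := by
    simp [map_ofNat]
  have en' : ((2 * m + 1 : ℕ) : A) = algebraMap ℝ A (2 * m + 1) := by simp [map_ofNat]
  have hn : IsUnit (((2 * m + 1 : ℕ) : A) - 1) := by rw [en]; exact unit (by positivity)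
  have sP := G.sum_proj h.g_xi G.g
  rw [sum_g_e_self, h.g_xi] at sP
  -- The trace of g over the horizontal part is n - 1 = 2m, which is invertible.
  have horiz {c : A} (hc : ∀ U V, G.g U ξ = 0 → G.g V ξ = 0 → c * G.g U V = 0) : c = 0 := by
    refine hn.mul_left_eq_zero.1 ?_
    rw [← sP, Finset.mul_sum]
    exact Finset.sum_eq_zero fun i _ => hc _ _ (h.g_proj_xi _) (h.g_proj_xi _)
  have case_zero (hα : α = 0) : 2 * ρ = algebraMap ℝ A β * G.scal - 2 * algebraMap ℝ A lam
      ∧ ν = 0 := by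
    subst hα
    have e1 : 2 * ρ + 2 * algebraMap ℝ A lam - algebraMap ℝ A β * G.scal = 0 := horiz
      fun U V hU hV => by
        have e := hS U V
        rw [hU, map_zero] at e
        linear_combination e
    refine ⟨by linear_combination e1, inj ?_⟩
    have e := hS ξ ξ
    rw [h.g_xi, map_zero] at e
    rw [map_zero]
    refine mul_two_cancel ?_
    linear_combination e - e1
  by_cases hk : k + 1 = 0
  · obtain rfl : k = -1 := by linarith
    -- Here |BU|² = g(U, B²U) = 0, and the metric is definite.
    have hs (U : 𝔛) : G.shape ξ U = 0 := by
      refine hdef _ ?_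
      rw [h.g_shape_symm, h.shape_shape, ← map_one (algebraMap ℝ A), ← map_add, hk]
      simp
    have h' : G.IsKMuPrime φ ξ (-1) (algebraMap ℝ A μ) := by
      simpa using h
    by_cases hα : α = 0
    · obtain ⟨e1, rfl⟩ := case_zero hα
      obtain ⟨e2, e3⟩ := h'.conformal_factor_nilpotent hs hX hn (fun U => hD U β)
        (fun U => hD U lam) e1
      refine ⟨(pow_eq_zero_iff three_ne_zero).1 e3, ?_, by simp, fun hα' => absurd hα hα'⟩
      rw [en, en'] at e2
      have e4 : algebraMap ℝ A (2 * lam + β * ((2 * m + 1) * (2 * m))) = algebraMap ℝ A 0 := by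
        rw [map_zero, ← e2]
        simp only [map_add, map_mul, map_ofNat, map_natCast, map_one]
      have e5 := inj e4
      rw [hα]
      linear_combination e5 / 2
    · set σ := algebraMap ℝ A β * G.scal - 2 * algebraMap ℝ A lam - 2 * ρ with hσ
      have hσ' : σ = algebraMap ℝ A (2 * ν - 2 * α * (2 * m)) := by
        have e := hS ξ ξ
        rw [h'.ric_xi, h.g_xi, en] at e
        simp only [map_sub, map_mul, map_ofNat, map_natCast] at e ⊢
        linear_combination -e
      have hinv : algebraMap ℝ A (2 * α)⁻¹ * algebraMap ℝ A (2 * α) = 1 := by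
        rw [← map_mul, inv_mul_cancel₀ (by simpa using hα), map_one]
      have hric (U V : 𝔛) : G.ric U V = (algebraMap ℝ A ((2 * α)⁻¹ * (2 * ν - 2 * α * (2 * m))))
          * G.g U V + algebraMap ℝ A ((2 * α)⁻¹ * (-(2 * ν))) * (G.g U ξ * G.g V ξ) := by
        have e := hS U V
        rw [map_mul, ← hσ']
        simp only [map_mul, map_neg, map_ofNat] at hinv ⊢
        linear_combination algebraMap ℝ A (2 * α)⁻¹ * e - G.ric U V * hinv
          + algebraMap ℝ A (2 * α)⁻¹ * G.g U V * hσ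
      obtain ⟨e1, e2, e3⟩ := h'.eta_einstein hs hn (hD _ _) (hD _ _) hric
      have ν0 : ν = 0 := by
        rw [← map_zero (algebraMap ℝ A)] at e2
        have e4 := inj e2
        have e5 : (2 * α)⁻¹ ≠ 0 := by simpa using hα
        have e6 := (mul_eq_zero.1 e4).resolve_left e5
        linarith
      rw [e1, e2, en, ← map_neg] at hric
      rw [en, en', ← map_mul, ← map_neg] at e3
      have e4 : 2 * ρ = algebraMap ℝ A (β * -((2 * m + 1) * (2 * m)) - 2 * lam + 2 * α * (2 * m)) := by
        rw [hσ, e3, ν0] at hσ'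
        simp only [map_sub, map_add, map_mul, map_neg, map_ofNat, map_natCast, map_one,
          map_zero] at hσ' ⊢
        linear_combination -hσ'
      have Dρ (U : 𝔛) : G.D U ρ = 0 := by
        have e5 := congrArg (G.D U) e4
        rw [hD, D_mul, D_ofNat] at e5
        refine mul_two_cancel ?_
        linear_combination e5
      have e5 := hX.mul_scal_eq_zero Dρ (by rw [e3, hD])
      rw [e3, (unit (by rw [neg_ne_zero]; positivity)).mul_left_eq_zero] at e5
      rw [e5, mul_zero, ← map_zero (algebraMap ℝ A)] at e4
      have e6 := inj e4
      refine ⟨e5, by linear_combination e6 / 2, by rw [ν0]; ring, fun _ U V => ?_⟩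
      rw [hric, zero_mul, add_zero]
  · have hk' : IsUnit (algebraMap ℝ A k + 1) := by
      rw [← map_one (algebraMap ℝ A), ← map_add]; exact unit hk
    -- If α ≠ 0, the soliton equation makes Ric proportional to g on horizontal fields, hence P = 0,
    -- against its trace 2m.
    have α0 : α = 0 := by
      by_contra hα
      have hinv : algebraMap ℝ A (2 * α)⁻¹ * algebraMap ℝ A (2 * α) = 1 := by
        rw [← map_mul, inv_mul_cancel₀ (by simpa using hα), map_one]
      simp only [map_mul, map_ofNat] at hinv
      have e1 := h.not_eta_einstein hk' (a := algebraMap ℝ A (2 * α)⁻¹ *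
        (algebraMap ℝ A β * G.scal - 2 * algebraMap ℝ A lam - 2 * ρ)) hn fun V W hV hW => by
          have e := hS V W
          rw [hV] at e
          linear_combination algebraMap ℝ A (2 * α)⁻¹ * e - G.ric V W * hinv
      have e2 := h.sum_g_proj
      simp only [e1, map_zero, LinearMap.zero_apply, Finset.sum_const_zero] at e2
      exact hn.ne_zero e2.symm
    obtain ⟨e1, rfl⟩ := case_zero α0
    have e2 := h.scal_eq hk'
    rw [en, ← map_sub, ← map_mul] at e2
    have Dρ (U : 𝔛) : G.D U ρ = 0 := by
      have e5 := congrArg (G.D U) e1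
      rw [e2, D_sub, D_mul, D_mul, D_mul, D_ofNat, hD, hD, hD] at e5
      refine mul_two_cancel ?_
      linear_combination e5
    -- The sum of the |Be_i|² equals -2m(k+1). The sign ensures k - 2m ≠ 0, that is r ≠ 0.
    have kneg : k + 1 ≤ 0 := by
      have e := hpos (fun i => G.shape ξ (G.e i)) (-(k + 1) * (2 * m)) (by
        have e3 (i : Fin (2 * m + 1)) : G.g (G.shape ξ (G.e i)) (G.shape ξ (G.e i))
            = -(algebraMap ℝ A k + 1) * G.g (G.proj ξ (G.e i)) (G.e i) := by
          rw [← h.g_shape_symm, h.shape_shape]; simp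
        simp only [e3, ← Finset.mul_sum, h.sum_g_proj]
        rw [en]; simp only [map_mul, map_neg, map_add, map_one])
      have : 0 < 2 * (m : ℝ) := by positivity
      nlinarith
    have e3 := hX.mul_scal_eq_zero Dρ (by rw [e2, hD])
    rw [e2, (unit (mul_ne_zero (by positivity) (by linarith))).mul_left_eq_zero] at e3
    refine ⟨e3, ?_, by rw [α0]; ring, fun hα => absurd α0 hα⟩
    rw [e3, e2] at e1
    have e4 : algebraMap ℝ A (2 * lam) = algebraMap ℝ A (β * (2 * m * (k - 2 * m))) := by
      simp only [map_sub, map_mul, map_ofNat, map_natCast] at e1 ⊢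
      linear_combination e1
    have e5 := inj e4
    rw [α0]
    linear_combination e5 / 2

end FramedGeometry

/-! ### Smoothness of the geometric operations and local orthonormal frames. -/

namespace AlmostKenmotsu

noncomputable section

variable {E : Type*} [NormedAddCommGroup E] [NormedSpace ℝ E] [FiniteDimensional ℝ E]
  [CompleteSpace E]
  {H : Type*} [TopologicalSpace H] {I : ModelWithCorners ℝ E H}
  {M : Type*} [TopologicalSpace M] [ChartedSpace H M] [IsManifold I ∞ M]

theorem contMDiffOn_mvfderiv_apply {O : Set M} (hO : IsOpen O) {f : M → ℝ}
    {U : Π x : M, TangentSpace I x} (hf : CMDiff[O] ∞ f) (hU : CMDiff[O] ∞ (T% U)) :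
    CMDiff[O] ∞ (fun x => d% f x (U x)) := by
  have h1 := hf.contMDiffOn_tangentMapWithin (m := ∞) (by simp) hO.uniqueMDiffOn
  have h2 := h1.comp hU (fun x hx => hx)
  intro x hx
  have h3 := h2 x hx
  rw [Bundle.contMDiffWithinAt_totalSpace] at h3
  refine h3.2.congr_of_eventuallyEq ?_ ?_
  · filter_upwards [self_mem_nhdsWithin] with y hy
    simp [tangentMapWithin, mvfderiv, mfderivWithin_of_isOpen hO hy]
    rfl
  · simp [tangentMapWithin, mvfderiv, mfderivWithin_of_isOpen hO hx]
    rfl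

theorem contMDiffOn_mlieBracket {O : Set M} (hO : IsOpen O)
    {U V : Π x : M, TangentSpace I x} (hU : CMDiff[O] ∞ (T% U)) (hV : CMDiff[O] ∞ (T% V)) :
    CMDiff[O] ∞ (T% (mlieBracket I U V)) := by
  have : IsManifold I (((⊤ : ℕ∞) : WithTop ℕ∞) + 1) M := by
    simpa using (inferInstance : IsManifold I ∞ M)
  have : IsManifold I (minSmoothness ℝ 2) M := by
    simpa using (inferInstance : IsManifold I 2 M)
  intro x hx
  refine (ContMDiffAt.mlieBracket_vectorField (m := ⊤) (n := ⊤) (hU.contMDiffAt (hO.mem_nhds hx))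
    (hV.contMDiffAt (hO.mem_nhds hx)) (by simp)).contMDiffWithinAt

variable [RiemannianBundle (fun x : M => TangentSpace I x)]
  [IsContMDiffRiemannianBundle I ∞ E (fun x : M => TangentSpace I x)]

theorem contMDiffOn_inner {O : Set M} 
    {U V : Π x : M, TangentSpace I x} (hU : CMDiff[O] ∞ (T% U)) (hV : CMDiff[O] ∞ (T% V)) :
    CMDiff[O] ∞ (fun x => inner ℝ (U x) (V x)) :=
  ContMDiffOn.inner_bundle (IB := I) (F := E) (E := fun x : M => TangentSpace I x)
    (by exact hU) (by exact hV)

theorem contMDiffOn_koszul {O : Set M} (hO : IsOpen O)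
    {U V W : Π x : M, TangentSpace I x} (hU : CMDiff[O] ∞ (T% U)) (hV : CMDiff[O] ∞ (T% V))
    (hW : CMDiff[O] ∞ (T% W)) :
    CMDiff[O] ∞ (fun x => koszul I U V W x) := by
  unfold koszul
  have i1 := contMDiffOn_inner hV hW
  have i2 := contMDiffOn_inner hW hU
  have i3 := contMDiffOn_inner hU hV
  have d1 := contMDiffOn_mvfderiv_apply hO i1 hU
  have d2 := contMDiffOn_mvfderiv_apply hO i2 hV
  have d3 := contMDiffOn_mvfderiv_apply hO i3 hW
  have b1 := contMDiffOn_inner (contMDiffOn_mlieBracket hO hU hV) hW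
  have b2 := contMDiffOn_inner (contMDiffOn_mlieBracket hO hV hW) hU
  have b3 := contMDiffOn_inner (contMDiffOn_mlieBracket hO hW hU) hV
  exact contMDiffOn_const.mul (((((d1.add d2).sub d3).add b1).sub b2).add b3)

variable (I) in
/-- `e` is an orthonormal frame of the tangent bundle that is smooth on `O`. -/
structure IsOrthonormalFrameOn {n : ℕ} (e : Fin n → Π x : M, TangentSpace I x) (O : Set M) :
    Prop where
  contMDiffOn : ∀ i, CMDiff[O] ∞ (T% (e i))
  inner_eq : ∀ x ∈ O, ∀ i j, inner ℝ (e i x) (e j x) = if i = j then (1 : ℝ) else 0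
  expand : ∀ x ∈ O, ∀ v : TangentSpace I x, ∑ i, inner ℝ v (e i x) • e i x = v

theorem IsOrthonormalFrameOn.mono {n : ℕ} {e : Fin n → Π x : M, TangentSpace I x} {O O' : Set M}
    (he : IsOrthonormalFrameOn I e O) (h : O' ⊆ O) : IsOrthonormalFrameOn I e O' where
  contMDiffOn i := (he.contMDiffOn i).mono h
  inner_eq x hx := he.inner_eq x (h hx)
  expand x hx := he.expand x (h hx)

theorem _root_.Orthonormal.sum_inner_smul_of_span {ι V : Type*} [Fintype ι] [NormedAddCommGroup V]
    [InnerProductSpace ℝ V] {e : ι → V} (he : Orthonormal ℝ e)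
    (hs : ⊤ ≤ Submodule.span ℝ (Set.range e)) (v : V) : ∑ i, inner ℝ v (e i) • e i = v := by
  simpa [real_inner_comm] using (OrthonormalBasis.mk he hs).sum_repr' v

open InnerProductSpace in
theorem exists_isOrthonormalFrameOn (p : M) {n : ℕ} (hn : Module.finrank ℝ E = n) :
    ∃ (O : Set M) (e : Fin n → Π x : M, TangentSpace I x),
      IsOpen O ∧ p ∈ O ∧ IsOrthonormalFrameOn I e O := by
  let t := trivializationAt E (fun x : M => TangentSpace I x) p
  let b := Module.finBasisOfFinrankEq ℝ E hn
  have hs := t.isLocalFrameOn_localFrame_baseSet I ∞ b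
  set s := t.localFrame b
  have gn (i : Fin n) {x : M} (hx : x ∈ t.baseSet) : gramSchmidt ℝ (fun j => s j x) i ≠ 0 :=
    gramSchmidt_ne_zero i (hs.linearIndependent hx)
  -- Smoothness of Gram-Schmidt by well-founded induction on the index: each vector is a smooth
  -- combination of earlier ones, with nonvanishing denominators.
  have gs (i : Fin n) : CMDiff[t.baseSet] ∞ (T% (fun x : M =>
      gramSchmidt ℝ (fun j => s j x) i)) := by
    induction i using WellFoundedLT.induction with
    | ind i ih =>
      have e : (fun x : M => gramSchmidt ℝ (fun j => s j x) i)
          = s i - fun x => ∑ j ∈ Finset.Iio i,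
            (inner ℝ (gramSchmidt ℝ (fun j => s j x) j) (s i x) /
              inner ℝ (gramSchmidt ℝ (fun j => s j x) j) (gramSchmidt ℝ (fun j => s j x) j)) •
              gramSchmidt ℝ (fun j => s j x) j := by
        ext1 x
        have e1 := gramSchmidt_def'' ℝ (fun j => s j x) i
        simp only [Pi.sub_apply, real_inner_self_eq_norm_sq]
        exact eq_sub_of_add_eq e1.symm
      refine ContMDiffOn.congr (ContMDiffOn.sub_section (hs.contMDiffOn i)
        (.sum_section fun j hj => ?_)) fun x _ => congrArg _ (congrFun e x)
      have hj' := ih j (Finset.mem_Iio.1 hj)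
      exact ((contMDiffOn_inner hj' (hs.contMDiffOn i)).div₀ (contMDiffOn_inner hj' hj')
        fun x hx => inner_self_ne_zero.2 (gn j hx)).smul_section hj'
  have on {x : M} (hx : x ∈ t.baseSet) := gramSchmidtNormed_orthonormal (hs.linearIndependent hx)
  refine ⟨t.baseSet, fun i x => gramSchmidtNormed ℝ (fun j => s j x) i, t.open_baseSet,
    FiberBundle.mem_baseSet_trivializationAt' p, fun i => ?_, fun x hx i j => ?_, fun x hx v => ?_⟩
  · have hn : CMDiff[t.baseSet] ∞ (fun x => (Real.sqrt (inner ℝ (gramSchmidt ℝ (fun j => s j x) i)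
        (gramSchmidt ℝ (fun j => s j x) i)))⁻¹) := by
      intro x hx
      have h0 := real_inner_self_pos.2 (gn i hx)
      exact ((Real.contDiffAt_sqrt (n := ∞) h0.ne').contMDiffAt.comp_contMDiffWithinAt x
        (contMDiffOn_inner (gs i) (gs i) x hx)).inv₀ (Real.sqrt_ne_zero'.2 h0)
    exact (hn.smul_section (gs i)).congr fun x hx => congrArg _ (by
      rw [gramSchmidtNormed, norm_eq_sqrt_real_inner]; rfl)
  · exact orthonormal_iff_ite.1 (on hx) i j
  · refine (on hx).sum_inner_smul_of_span ?_ v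
    rw [span_gramSchmidtNormed_range, span_gramSchmidt]
    exact hs.generating hx

/-- The Levi-Civita connection in an orthonormal frame. -/
theorem contMDiffOn_leviCivita {O : Set M} (hO : IsOpen O) {n : ℕ}
    {e : Fin n → Π x : M, TangentSpace I x} (he : IsOrthonormalFrameOn I e O)
    {U V : Π x : M, TangentSpace I x} (hU : CMDiff[O] ∞ (T% U)) (hV : CMDiff[O] ∞ (T% V)) :
    CMDiff[O] ∞ (T% (fun x => leviCivita I M V x (U x))) := by
  have h : CMDiff[O] ∞ (T% (fun x => ∑ i, koszul I U V (e i) x • e i x)) :=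
    .sum_section fun i _ => (contMDiffOn_koszul hO hU hV (he.contMDiffOn i)).smul_section
      (he.contMDiffOn i)
  refine h.congr fun x hx => ?_
  congr 1
  have d {W : Π x : M, TangentSpace I x} (hW : CMDiff[O] ∞ (T% W)) : MDiffAt (T% W) x :=
    (hW.contMDiffAt (hO.mem_nhds hx)).mdifferentiableAt (by simp)
  rw [← he.expand x hx (leviCivita I M V x (U x))]
  refine Finset.sum_congr rfl fun i _ => ?_
  rw [← inner_leviCivitaFun (d hU) (d hV) (d (he.contMDiffOn i))]
  rfl

end
end AlmostKenmotsu

/-! ### Functions and fields on an open set; extension by zero does not affect germs at its points.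
-/

namespace AlmostKenmotsu

/-- Extension by zero of a section over a subset. -/
noncomputable def zeroExt {M : Type*} {O : Set M} {V : M → Type*} [∀ x, Zero (V x)]
    (s : Π x : O, V x) (x : M) : V x :=
  open Classical in if h : x ∈ O then s ⟨x, h⟩ else 0

section zeroExt
variable {M : Type*} {O : Set M} {V : M → Type*}

theorem zeroExt_of_mem [∀ x, Zero (V x)] (s : Π x : O, V x) {x : M} (hx : x ∈ O) :
    zeroExt s x = s ⟨x, hx⟩ := dif_pos hx

@[simp] theorem zeroExt_coe [∀ x, Zero (V x)] (s : Π x : O, V x) (x : O) :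
    zeroExt s (x : M) = s x := dif_pos x.2

theorem zeroExt_add [∀ x, AddZeroClass (V x)] (s t : Π x : O, V x) :
    zeroExt (s + t) = zeroExt s + zeroExt t := by
  ext x; by_cases h : x ∈ O <;> simp [zeroExt, h]

theorem zeroExt_zero [∀ x, AddZeroClass (V x)] : zeroExt (0 : Π x : O, V x) = 0 := by
  ext x; by_cases h : x ∈ O <;> simp [zeroExt, h]

theorem zeroExt_mul (a b : O → ℝ) : zeroExt (V := fun _ => ℝ) (a * b)
    = zeroExt (V := fun _ => ℝ) a * zeroExt (V := fun _ => ℝ) b := by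
  ext x; by_cases h : x ∈ O <;> simp [zeroExt, h]

theorem zeroExt_smul [∀ x, AddCommGroup (V x)] [∀ x, Module ℝ (V x)] (a : O → ℝ)
    (s : Π x : O, V x) : zeroExt (a • s) = zeroExt (V := fun _ => ℝ) a • zeroExt s := by
  ext x; by_cases h : x ∈ O <;> simp [zeroExt, h]
end zeroExt

noncomputable section

variable {E : Type*} [NormedAddCommGroup E] [NormedSpace ℝ E] [FiniteDimensional ℝ E]
  [CompleteSpace E]
  {H : Type*} [TopologicalSpace H] (I : ModelWithCorners ℝ E H)
  {M : Type*} [TopologicalSpace M] [ChartedSpace H M] [IsManifold I ∞ M]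

/-- Smooth functions on `O`. -/
def smoothFunctions (O : Set M) : Subalgebra ℝ (O → ℝ) where
  carrier := {f | CMDiff[O] ∞ (zeroExt (V := fun _ : M => ℝ) f)}
  mul_mem' {f g} hf hg := by
    simp only [Set.mem_ofPred_eq, zeroExt_mul] at *
    exact hf.mul hg
  add_mem' {f g} hf hg := by
    simp only [Set.mem_ofPred_eq, zeroExt_add] at *
    exact hf.add hg
  algebraMap_mem' c := (contMDiffOn_const (c := c)).congr fun x hx => zeroExt_of_mem _ hx

/-- Smooth vector fields on `O`. -/
def smoothFields (O : Set M) : Submodule (smoothFunctions I O) (Π x : O, TangentSpace I (x : M)) where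
  carrier := {U | CMDiff[O] ∞ (T% (zeroExt (V := fun x : M => TangentSpace I x) U))}
  zero_mem' := by
    simp only [Set.mem_ofPred_eq, zeroExt_zero]
    exact (contMDiff_zeroSection ℝ (fun x : M => TangentSpace I x)).contMDiffOn
  add_mem' {U V} hU hV := by
    simp only [Set.mem_ofPred_eq, zeroExt_add] at *
    exact hU.add_section hV
  smul_mem' a U hU := by
    have h := zeroExt_smul (V := fun x : M => TangentSpace I x) a.1 U
    change CMDiff[O] ∞ (T% (zeroExt (V := fun x : M => TangentSpace I x) (a.1 • U)))
    rw [h]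
    exact ContMDiffOn.smul_section a.2 hU

variable {I}
variable {O : Set M}

instance : AddCommGroup (smoothFields I O) := Submodule.addCommGroup _

instance : Module (smoothFunctions I O) (smoothFields I O) := Submodule.module _

instance : SMul (smoothFunctions I O) (smoothFields I O) := Module.toDistribMulAction.toSMul

/-- The extension by zero of a smooth function. -/
def extFun (f : smoothFunctions I O) : M → ℝ := zeroExt (V := fun _ => ℝ) f.1

/-- The extension by zero of a smooth vector field. -/
def extField (U : smoothFields I O) : Π x : M, TangentSpace I x := zeroExt U.1

theorem contMDiffOn_extFun (f : smoothFunctions I O) : CMDiff[O] ∞ (extFun f) := f.2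

@[simp] theorem extFun_coe (f : smoothFunctions I O) (x : O) : extFun f (x : M) = f.1 x :=
  zeroExt_coe _ x

theorem mdifferentiableAt_extFun (hO : IsOpen O) (f : smoothFunctions I O) (x : O) :
    MDiffAt (extFun f) (x : M) :=
  ((contMDiffOn_extFun f).contMDiffAt (hO.mem_nhds x.2)).mdifferentiableAt (by simp)

theorem extFun_add (f h : smoothFunctions I O) : extFun (f + h) = extFun f + extFun h :=
  zeroExt_add _ _

theorem extFun_mul (f h : smoothFunctions I O) : extFun (f * h) = extFun f * extFun h :=
  zeroExt_mul _ _

/-- The restriction to `O` of a function that is smooth on `O`. -/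
def restrictFun (f : M → ℝ) (hf : CMDiff[O] ∞ f) : smoothFunctions I O :=
  ⟨fun x => f x, hf.congr fun _ hx => zeroExt_of_mem _ hx⟩

@[simp] theorem restrictFun_apply (f : M → ℝ) (hf : CMDiff[O] ∞ f) (x : O) :
    (restrictFun f hf).1 x = f x := rfl

theorem extFun_restrictFun_eventuallyEq (hO : IsOpen O) (f : M → ℝ) (hf : CMDiff[O] ∞ f) (x : O) :
    extFun (restrictFun f hf) =ᶠ[nhds (x : M)] f := by
  filter_upwards [hO.mem_nhds x.2] with y hy using zeroExt_of_mem _ hy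

theorem contMDiffOn_extField (U : smoothFields I O) : CMDiff[O] ∞ (T% (extField U)) := U.2

@[simp] theorem extField_coe (U : smoothFields I O) (x : O) : extField U (x : M) = U.1 x :=
  zeroExt_coe _ x

theorem mdifferentiableAt_extField (hO : IsOpen O) (U : smoothFields I O) (x : O) :
    MDiffAt (T% (extField U)) (x : M) :=
  ((contMDiffOn_extField U).contMDiffAt (hO.mem_nhds x.2)).mdifferentiableAt (by simp)

theorem extField_add (U V : smoothFields I O) : extField (U + V) = extField U + extField V :=
  zeroExt_add _ _

theorem extField_smul (f : smoothFunctions I O) (U : smoothFields I O) :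
    extField (f • U) = extFun f • extField U :=
  zeroExt_smul (V := fun x : M => TangentSpace I x) _ _

/-- The restriction to `O` of a vector field that is smooth on `O`. -/
def restrictField (U : Π x : M, TangentSpace I x) (hU : CMDiff[O] ∞ (T% U)) : smoothFields I O :=
  ⟨fun x => U x, hU.congr fun _ hx =>
    congrArg _ (zeroExt_of_mem (V := fun x : M => TangentSpace I x) _ hx)⟩

@[simp] theorem restrictField_apply (U : Π x : M, TangentSpace I x) (hU : CMDiff[O] ∞ (T% U))
    (x : O) : (restrictField U hU).1 x = U x := rfl

theorem extField_restrictField_eventuallyEq (hO : IsOpen O) (U : Π x : M, TangentSpace I x)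
    (hU : CMDiff[O] ∞ (T% U)) (x : O) :
    ∀ᶠ y in nhds (x : M), extField (restrictField U hU) y = U y := by
  filter_upwards [hO.mem_nhds x.2] with y hy using
    zeroExt_of_mem (V := fun x : M => TangentSpace I x) _ hy

namespace smoothFields

@[simp] theorem add_apply (U V : smoothFields I O) (x : O) : (U + V).1 x = U.1 x + V.1 x := rfl

@[simp] theorem sub_apply (U V : smoothFields I O) (x : O) : (U - V).1 x = U.1 x - V.1 x := rfl

@[simp] theorem neg_apply (U : smoothFields I O) (x : O) : (-U).1 x = -U.1 x := rfl

@[simp] theorem zero_apply (x : O) : (0 : smoothFields I O).1 x = 0 := rfl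

@[simp] theorem smul_apply (f : smoothFunctions I O) (U : smoothFields I O) (x : O) :
    (f • U).1 x = f.1 x • U.1 x := rfl

@[simp] theorem sum_apply {ι : Type*} (s : Finset ι) (U : ι → smoothFields I O) (x : O) :
    (∑ i ∈ s, U i).1 x = ∑ i ∈ s, (U i).1 x := by
  rw [← Finset.sum_apply, ← AddSubmonoidClass.coe_finsetSum]

theorem eq_of_apply {U V : smoothFields I O} (h : ∀ x, U.1 x = V.1 x) : U = V :=
  Subtype.ext (funext h)

end smoothFields

namespace smoothFunctions

@[simp] theorem add_apply (f h : smoothFunctions I O) (x : O) : (f + h).1 x = f.1 x + h.1 x := rfl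

@[simp] theorem sub_apply (f h : smoothFunctions I O) (x : O) : (f - h).1 x = f.1 x - h.1 x := rfl

@[simp] theorem neg_apply (f : smoothFunctions I O) (x : O) : (-f).1 x = -f.1 x := rfl

@[simp] theorem mul_apply (f h : smoothFunctions I O) (x : O) : (f * h).1 x = f.1 x * h.1 x := rfl

@[simp] theorem zero_apply (x : O) : (0 : smoothFunctions I O).1 x = 0 := rfl

@[simp] theorem one_apply (x : O) : (1 : smoothFunctions I O).1 x = 1 := rfl

@[simp] theorem algebraMap_apply (c : ℝ) (x : O) :
    (algebraMap ℝ (smoothFunctions I O) c).1 x = c := rfl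

@[simp] theorem sum_apply {ι : Type*} (s : Finset ι) (f : ι → smoothFunctions I O) (x : O) :
    (∑ i ∈ s, f i).1 x = ∑ i ∈ s, (f i).1 x := by
  rw [← Finset.sum_apply, ← AddSubmonoidClass.coe_finsetSum]

theorem eq_of_apply {f h : smoothFunctions I O} (e : ∀ x, f.1 x = h.1 x) : f = h :=
  Subtype.ext (funext e)

end smoothFunctions

variable [RiemannianBundle (fun x : M => TangentSpace I x)]
  [IsContMDiffRiemannianBundle I ∞ E (fun x : M => TangentSpace I x)]

/-- The pointwise inner product of smooth fields. -/
def metric (U V : smoothFields I O) : smoothFunctions I O :=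
  restrictFun (fun x => inner ℝ (extField U x) (extField V x))
    (contMDiffOn_inner (contMDiffOn_extField U) (contMDiffOn_extField V))

@[simp] theorem metric_apply (U V : smoothFields I O) (x : O) :
    (metric U V).1 x = inner ℝ (U.1 x) (V.1 x) := by simp [metric]

/-- The derivative of a smooth function along a smooth field. -/
def derivative (hO : IsOpen O) (U : smoothFields I O) (f : smoothFunctions I O) :
    smoothFunctions I O :=
  restrictFun (fun x => d% (extFun f) x (extField U x))
    (contMDiffOn_mvfderiv_apply hO (contMDiffOn_extFun f) (contMDiffOn_extField U))

@[simp] theorem derivative_apply (hO : IsOpen O) (U : smoothFields I O) (f : smoothFunctions I O)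
    (x : O) : (derivative hO U f).1 x = d% (extFun f) (x : M) (U.1 x) := by simp [derivative]

/-- The Lie bracket of smooth fields. -/
def bracket (hO : IsOpen O) (U V : smoothFields I O) : smoothFields I O :=
  restrictField (mlieBracket I (extField U) (extField V))
    (contMDiffOn_mlieBracket hO (contMDiffOn_extField U) (contMDiffOn_extField V))

@[simp] theorem bracket_apply (hO : IsOpen O) (U V : smoothFields I O) (x : O) :
    (bracket hO U V).1 x = mlieBracket I (extField U) (extField V) (x : M) := by simp [bracket]

variable {n : ℕ} {e : Fin n → Π x : M, TangentSpace I x}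

/-- The Levi-Civita derivative of smooth fields. -/
def connection (hO : IsOpen O) (he : IsOrthonormalFrameOn I e O) (U V : smoothFields I O) :
    smoothFields I O :=
  restrictField (fun x => leviCivita I M (extField V) x (extField U x))
    (contMDiffOn_leviCivita hO he (contMDiffOn_extField U) (contMDiffOn_extField V))

@[simp] theorem connection_apply (hO : IsOpen O) (he : IsOrthonormalFrameOn I e O)
    (U V : smoothFields I O) (x : O) :
    (connection hO he U V).1 x = leviCivita I M (extField V) (x : M) (U.1 x) := by
  simp [connection]

end
end AlmostKenmotsu

/-! ### An open set with an orthonormal frame is a framed geometry. -/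

namespace AlmostKenmotsu

noncomputable section

variable {E : Type*} [NormedAddCommGroup E] [NormedSpace ℝ E] [FiniteDimensional ℝ E]
  [CompleteSpace E]
  {H : Type*} [TopologicalSpace H] {I : ModelWithCorners ℝ E H}
  {M : Type*} [TopologicalSpace M] [ChartedSpace H M] [IsManifold I ∞ M]

theorem mvfderiv_congr {f h : M → ℝ} {x : M} (e : f =ᶠ[nhds x] h) :
    d% f x = d% h x := by
  ext v
  simp only [mvfderiv, e.mfderiv_eq]
  rfl

theorem mlieBracket_congr {U U' V V' : Π x : M, TangentSpace I x} {x : M}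
    (hU : ∀ᶠ y in nhds x, U y = U' y) (hV : ∀ᶠ y in nhds x, V y = V' y) :
    mlieBracket I U V x = mlieBracket I U' V' x :=
  Filter.EventuallyEq.mlieBracket_vectorField_eq hU hV

variable [RiemannianBundle (fun x : M => TangentSpace I x)]
  [IsContMDiffRiemannianBundle I ∞ E (fun x : M => TangentSpace I x)]

theorem leviCivita_congr {V V' : Π x : M, TangentSpace I x} {x : M} (hV : MDiffAt (T% V) x)
    (h : ∀ᶠ y in nhds x, V y = V' y) : leviCivita I M V x = leviCivita I M V' x := by
  refine IsCovariantDerivativeOn.congr_of_eventuallyEq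
    (leviCivita I M).isCovariantDerivativeOnUniv hV ?_ Filter.univ_mem h
  exact hV.congr_of_eventuallyEq (h.mono fun y hy => congrArg _ hy.symm)

variable {O : Set M} {n : ℕ} {e : Fin n → Π x : M, TangentSpace I x}

theorem connection_sub_connection (hO : IsOpen O) (he : IsOrthonormalFrameOn I e O)
    (U V : smoothFields I O) :
    connection hO he U V - connection hO he V U = bracket hO U V :=
  smoothFields.eq_of_apply fun x => by
    have h := leviCivita_torsionFree (mdifferentiableAt_extField hO U x)
      (mdifferentiableAt_extField hO V x)
    simpa using h

theorem extField_bracket_eventuallyEq (hO : IsOpen O) (U V : smoothFields I O) (x : O) :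
    ∀ᶠ y in nhds (x : M), extField (bracket hO U V) y
      = mlieBracket I (extField U) (extField V) y :=
  extField_restrictField_eventuallyEq hO _ _ x

theorem bracket_jacobi (hO : IsOpen O) (U V W : smoothFields I O) :
    bracket hO U (bracket hO V W) + bracket hO V (bracket hO W U)
      + bracket hO W (bracket hO U V) = 0 :=
  smoothFields.eq_of_apply fun x => by
    have : IsManifold I (minSmoothness ℝ 3) M := by
      simpa using (inferInstance : IsManifold I 3 M)
    have s (U : smoothFields I O) : CMDiffAt (minSmoothness ℝ 2) (T% (extField U)) (x : M) :=
      ((contMDiffOn_extField U).contMDiffAt (hO.mem_nhds x.2)).of_le (by simpa using ENat.LEInfty.out)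
    have c (U V W : smoothFields I O) : mlieBracket I (extField U) (extField (bracket hO V W)) (x : M)
        = mlieBracket I (extField U) (mlieBracket I (extField V) (extField W)) (x : M) :=
      mlieBracket_congr (.of_forall fun _ => rfl) (extField_bracket_eventuallyEq hO V W x)
    have h := leibniz_identity_mlieBracket_apply (s U) (s V) (s W)
    simp only [smoothFields.add_apply, bracket_apply, c, smoothFields.zero_apply]
    rw [h, mlieBracket_swap_apply (V := extField W), mlieBracket_swap (V := extField W) (W := extField U)]
    -- Pulling out the sign needs differentiability, which is known for the smooth field `bracket hO
    -- U W`; that field agrees with the bracket near x.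
    have e : mlieBracket I (extField V) (-mlieBracket I (extField U) (extField W)) (x : M)
        = -mlieBracket I (extField V) (mlieBracket I (extField U) (extField W)) (x : M) := by
      have h1 := c V U W
      have d := mdifferentiableAt_extField hO (bracket hO U W) x
      rw [← h1]
      have h2 := mlieBracket_const_smul_right (I := I) (V := extField V) (c := (-1 : ℝ)) d
      rw [neg_one_smul ℝ, neg_one_smul ℝ] at h2
      rw [← h2]
      refine mlieBracket_congr (.of_forall fun _ => rfl) ?_
      filter_upwards [extField_bracket_eventuallyEq hO U W x] with y hy
      simp only [Pi.neg_apply]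
      rw [← hy]
    rw [e]
    abel

theorem extFun_metric_eventuallyEq (hO : IsOpen O) (U V : smoothFields I O) (x : O) :
    extFun (metric U V) =ᶠ[nhds (x : M)] fun y => inner ℝ (extField U y) (extField V y) :=
  extFun_restrictFun_eventuallyEq hO _ _ x

/-- The geometry of an open set carrying an orthonormal frame. -/
def framedGeometry (hO : IsOpen O) (he : IsOrthonormalFrameOn I e O) (hn : 0 < n) :
    FramedGeometry (smoothFunctions I O) (smoothFields I O) n where
  D := derivative hO
  g := LinearMap.mk₂ _ metric
    (fun U V W => smoothFunctions.eq_of_apply fun x => by simp [inner_add_left])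
    (fun a U V => smoothFunctions.eq_of_apply fun x => by simp [inner_smul_left])
    (fun U V W => smoothFunctions.eq_of_apply fun x => by simp [inner_add_right])
    (fun a U V => smoothFunctions.eq_of_apply fun x => by simp [inner_smul_right])
  nab := connection hO he
  e i := restrictField (e i) (he.contMDiffOn i)
  D_add_left U V f := smoothFunctions.eq_of_apply fun x => by simp
  D_smul_left a U f := smoothFunctions.eq_of_apply fun x => by simp
  D_add U f h := smoothFunctions.eq_of_apply fun x => by
    simp [extFun_add, mvfderiv_add (mdifferentiableAt_extFun hO f x)
      (mdifferentiableAt_extFun hO h x)]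
  D_mul U f h := smoothFunctions.eq_of_apply fun x => by
    simp [extFun_mul, mvfderiv_mul (mdifferentiableAt_extFun hO f x)
      (mdifferentiableAt_extFun hO h x), mul_comm]
  g_symm U V := smoothFunctions.eq_of_apply fun x => by simp [real_inner_comm]
  nab_add_left U V W := smoothFields.eq_of_apply fun x => by simp
  nab_smul_left a U W := smoothFields.eq_of_apply fun x => by simp
  nab_add U V W := smoothFields.eq_of_apply fun x => by
    have h := (leviCivita I M).isCovariantDerivativeOnUniv.add (mdifferentiableAt_extField hO V x)
      (mdifferentiableAt_extField hO W x) (Set.mem_univ _)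
    simpa [extField_add] using congrArg (fun T => T (U.1 x)) h
  nab_smul U a V := smoothFields.eq_of_apply fun x => by
    have h := (leviCivita I M).isCovariantDerivativeOnUniv.leibniz
      (mdifferentiableAt_extField hO V x) (mdifferentiableAt_extFun hO a x) (Set.mem_univ _)
    simpa [extField_smul] using congrArg (fun T => T (U.1 x)) h
  D_g U V W := smoothFunctions.eq_of_apply fun x => by
    have h := leviCivita_metric (mdifferentiableAt_extField hO U x)
      (mdifferentiableAt_extField hO V x) (mdifferentiableAt_extField hO W x)
    simpa [mvfderiv_congr (extFun_metric_eventuallyEq hO V W x)] using h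
  jacobi U V W := by
    simp only [connection_sub_connection]
    exact bracket_jacobi hO U V W
  ortho i j := smoothFunctions.eq_of_apply fun x => by
    simp only [LinearMap.mk₂_apply, metric_apply, restrictField_apply, he.inner_eq x x.2]
    split_ifs <;> simp
  expand U := smoothFields.eq_of_apply fun x => by
    simpa using he.expand x x.2 (U.1 x)
  dim_pos := hn

end
end AlmostKenmotsu

/-! ### Comparison of the algebraic and the pointwise curvatures. -/

namespace FramedGeometry

variable {A 𝔛 : Type*} [CommRing A] [AddCommGroup 𝔛] [Module A 𝔛] {n : ℕ}
  (G : FramedGeometry A 𝔛 n)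

/-- The bilinear form `(W, Z) ↦ g(R(W, U)V, Z)`, whose trace is `ric U V`. -/
def curvatureForm (U V : 𝔛) : 𝔛 →ₗ[A] 𝔛 →ₗ[A] A := G.g.comp ((G.R.flip U).flip V)

theorem curvatureForm_apply (U V W Z : 𝔛) : G.curvatureForm U V W Z = G.g (G.R W U V) Z := rfl

theorem ric_eq_sum_curvatureForm (U V : 𝔛) :
    G.ric U V = ∑ i, G.curvatureForm U V (G.e i) (G.e i) := G.ric_apply U V

end FramedGeometry

namespace AlmostKenmotsu

noncomputable section

/-- The pointwise Ricci and scalar curvatures are traces over a basis chosen separately in each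
tangent space, unrelated to the smooth frame; the trace does not depend on the choice. -/
theorem sum_orthonormalBasis_eq {ι κ V : Type*} [Fintype ι] [Fintype κ] [DecidableEq κ]
    [NormedAddCommGroup V] [InnerProductSpace ℝ V] (b : OrthonormalBasis ι ℝ V) {e : κ → V}
    (ho : ∀ i j, inner ℝ (e i) (e j) = if i = j then (1 : ℝ) else 0)
    (he : ∀ v, ∑ j, inner ℝ v (e j) • e j = v) (Q : V →ₗ[ℝ] V →ₗ[ℝ] ℝ) :
    ∑ i, Q (b i) (b i) = ∑ j, Q (e j) (e j) := by
  have h (v w : V) : Q v w = ∑ j, ∑ k, inner ℝ v (e j) * inner ℝ w (e k) * Q (e j) (e k) := by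
    conv_lhs => rw [← he v, ← he w]
    simp only [map_sum, map_smul, LinearMap.sum_apply, LinearMap.smul_apply, smul_eq_mul,
      Finset.mul_sum]
    rw [Finset.sum_comm]
    exact Finset.sum_congr rfl fun _ _ => Finset.sum_congr rfl fun _ _ => by ring
  calc ∑ i, Q (b i) (b i)
      = ∑ j, ∑ k, (∑ i, inner ℝ (e j) (b i) * inner ℝ (b i) (e k)) * Q (e j) (e k) := by
        simp_rw [h (b _) (b _), Finset.sum_mul]
        rw [Finset.sum_comm]
        refine Finset.sum_congr rfl fun j _ => ?_
        rw [Finset.sum_comm]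
        simp_rw [real_inner_comm (e j)]
    _ = ∑ j, Q (e j) (e j) := by
        simp [b.sum_inner_mul_inner, ho]

variable {E : Type*} [NormedAddCommGroup E] [NormedSpace ℝ E] [FiniteDimensional ℝ E]
  [CompleteSpace E]
  {H : Type*} [TopologicalSpace H] {I : ModelWithCorners ℝ E H}
  {M : Type*} [TopologicalSpace M] [ChartedSpace H M] [IsManifold I ∞ M]
  [RiemannianBundle (fun x : M => TangentSpace I x)]
  [IsContMDiffRiemannianBundle I ∞ E (fun x : M => TangentSpace I x)]
  {O : Set M} {n : ℕ} {e : Fin n → Π x : M, TangentSpace I x}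
  (hO : IsOpen O) (he : IsOrthonormalFrameOn I e O) (hn : 0 < n)

theorem framedGeometry_g_apply (U V : smoothFields I O) (x : O) :
    ((framedGeometry hO he hn).g U V).1 x = inner ℝ (U.1 x) (V.1 x) := metric_apply U V x

theorem framedGeometry_br (U V : smoothFields I O) :
    (framedGeometry hO he hn).br U V = bracket hO U V := connection_sub_connection hO he U V

theorem framedGeometry_nab (U V : smoothFields I O) :
    (framedGeometry hO he hn).nab U V = connection hO he U V := rfl

theorem framedGeometry_e_apply (i : Fin n) (x : O) :
    ((framedGeometry hO he hn).e i).1 x = e i x := rfl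

theorem framedGeometry_D_apply (U : smoothFields I O) (f : smoothFunctions I O) {F : M → ℝ}
    (hF : ∀ y : O, F y = f.1 y) (x : O) :
    ((framedGeometry hO he hn).D U f).1 x = d% F (x : M) (U.1 x) := by
  change (derivative hO U f).1 x = _
  rw [derivative_apply, mvfderiv_congr]
  filter_upwards [hO.mem_nhds x.2] with y hy
  exact (extFun_coe f ⟨y, hy⟩).trans (hF ⟨y, hy⟩).symm

include hO he hn in
/-- Linear maps over the smooth functions are tensorial. -/
theorem apply_eq_of_apply_eq (T : smoothFields I O →ₗ[smoothFunctions I O] smoothFields I O)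
    {U V : smoothFields I O} {x : O} (h : U.1 x = V.1 x) : (T U).1 x = (T V).1 x := by
  have k (U : smoothFields I O) : (T U).1 x
      = ∑ i, inner ℝ (U.1 x) (e i x) • (T ((framedGeometry hO he hn).e i)).1 x := by
    conv_lhs => rw [← (framedGeometry hO he hn).expand U]
    simp only [map_sum, map_smul, smoothFields.sum_apply, smoothFields.smul_apply,
      framedGeometry_g_apply, framedGeometry_e_apply]
  rw [k, k, h]

include hO he hn in
theorem apply_eq_of_apply_eq_fun (T : smoothFields I O →ₗ[smoothFunctions I O] smoothFunctions I O)
    {U V : smoothFields I O} {x : O} (h : U.1 x = V.1 x) : (T U).1 x = (T V).1 x := by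
  have k (U : smoothFields I O) : (T U).1 x
      = ∑ i, inner ℝ (U.1 x) (e i x) • (T ((framedGeometry hO he hn).e i)).1 x := by
    conv_lhs => rw [← (framedGeometry hO he hn).expand U]
    simp only [map_sum, map_smul, smoothFunctions.sum_apply, smul_eq_mul, smoothFunctions.mul_apply,
      framedGeometry_g_apply, framedGeometry_e_apply]
  rw [k, k, h]

/-- The field with constant coefficients in the frame that takes the value `u` at `x`. -/
def constField (he : IsOrthonormalFrameOn I e O) (x : O) (u : TangentSpace I (x : M)) :
    smoothFields I O :=
  ∑ i, algebraMap ℝ (smoothFunctions I O) (inner ℝ u (e i x)) •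
    restrictField (e i) (he.contMDiffOn i)

@[simp] theorem constField_apply (x : O) (u : TangentSpace I (x : M)) :
    (constField he x u).1 x = u := by
  simpa [constField] using he.expand x x.2 u

/-- The value at a point of a bilinear form on smooth fields. -/
def formAt (Q : smoothFields I O →ₗ[smoothFunctions I O] smoothFields I O
      →ₗ[smoothFunctions I O] smoothFunctions I O) (x : O) :
    TangentSpace I (x : M) →ₗ[ℝ] TangentSpace I (x : M) →ₗ[ℝ] ℝ :=
  have l {U U' V : smoothFields I O} (h : U.1 x = U'.1 x) : (Q U V).1 x = (Q U' V).1 x :=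
    apply_eq_of_apply_eq_fun hO he hn (Q.flip V) h
  have r {U V V' : smoothFields I O} (h : V.1 x = V'.1 x) : (Q U V).1 x = (Q U V').1 x :=
    apply_eq_of_apply_eq_fun hO he hn (Q U) h
  LinearMap.mk₂ ℝ (fun u v => (Q (constField he x u) (constField he x v)).1 x)
    (fun u u' v => by
      rw [← smoothFunctions.add_apply, ← LinearMap.add_apply, ← map_add]
      exact l (by simp))
    (fun c u v => by
      rw [l (U' := algebraMap ℝ (smoothFunctions I O) c • constField he x u) (by
        simp only [smoothFields.smul_apply, constField_apply, smoothFunctions.algebraMap_apply])]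
      simp only [map_smul, LinearMap.smul_apply, smul_eq_mul, smoothFunctions.mul_apply,
        smoothFunctions.algebraMap_apply])
    (fun u v v' => by
      rw [← smoothFunctions.add_apply, ← map_add]
      exact r (by simp))
    (fun c u v => by
      rw [r (V' := algebraMap ℝ (smoothFunctions I O) c • constField he x v) (by
        simp only [smoothFields.smul_apply, constField_apply, smoothFunctions.algebraMap_apply])]
      simp only [map_smul, smul_eq_mul, smoothFunctions.mul_apply,
        smoothFunctions.algebraMap_apply])

theorem formAt_apply (Q : smoothFields I O →ₗ[smoothFunctions I O] smoothFields I O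
      →ₗ[smoothFunctions I O] smoothFunctions I O) (x : O) (U V : smoothFields I O) :
    formAt hO he hn Q x (U.1 x) (V.1 x) = (Q U V).1 x :=
  (apply_eq_of_apply_eq_fun hO he hn (Q.flip (constField he x (V.1 x)))
    (constField_apply he x (U.1 x))).trans
    (apply_eq_of_apply_eq_fun hO he hn (Q U) (constField_apply he x (V.1 x)))

theorem sum_stdOrthonormalBasis (Q : smoothFields I O →ₗ[smoothFunctions I O] smoothFields I O
      →ₗ[smoothFunctions I O] smoothFunctions I O) (x : O)
    (q : TangentSpace I (x : M) → TangentSpace I (x : M) → ℝ)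
    (hq : ∀ U V : smoothFields I O, q (U.1 x) (V.1 x) = (Q U V).1 x) :
    ∑ i, q (stdOrthonormalBasis ℝ (TangentSpace I (x : M)) i)
        (stdOrthonormalBasis ℝ (TangentSpace I (x : M)) i)
      = ∑ j, (Q ((framedGeometry hO he hn).e j) ((framedGeometry hO he hn).e j)).1 x := by
  have h (u v : TangentSpace I (x : M)) : q u v = formAt hO he hn Q x u v := by
    have h1 := hq (constField he x u) (constField he x v)
    rw [← formAt_apply hO he hn] at h1
    simpa using h1
  simp_rw [h, ← formAt_apply hO he hn Q x, framedGeometry_e_apply]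
  exact sum_orthonormalBasis_eq _ (he.inner_eq x x.2) (he.expand x x.2) _

theorem restrictField_extField (U : smoothFields I O) :
    restrictField (extField U) (contMDiffOn_extField U) = U :=
  smoothFields.eq_of_apply fun x => by simp

theorem framedGeometry_R_restrictField {U V W : Π x : M, TangentSpace I x}
    (hU : CMDiff[O] ∞ (T% U)) (hV : CMDiff[O] ∞ (T% V)) (hW : CMDiff[O] ∞ (T% W)) (x : O) :
    ((framedGeometry hO he hn).R (restrictField U hU) (restrictField V hV)
      (restrictField W hW)).1 x = curvatureField I U V W x := by
  have c1 {W : Π x : M, TangentSpace I x} (hW : CMDiff[O] ∞ (T% W)) (x : O) :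
      leviCivita I M (extField (restrictField W hW)) (x : M) = leviCivita I M W (x : M) :=
    leviCivita_congr (mdifferentiableAt_extField hO _ x)
      (extField_restrictField_eventuallyEq hO W hW x)
  have c2 {V W : Π x : M, TangentSpace I x} (hV : CMDiff[O] ∞ (T% V)) (hW : CMDiff[O] ∞ (T% W)) :
      leviCivita I M (extField (connection hO he (restrictField V hV) (restrictField W hW))) (x : M)
        = leviCivita I M (fun y => leviCivita I M W y (V y)) (x : M) := by
    refine leviCivita_congr (mdifferentiableAt_extField hO _ x) ?_
    filter_upwards [hO.mem_nhds x.2] with y hy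
    have h := extField_coe (connection hO he (restrictField V hV) (restrictField W hW)) ⟨y, hy⟩
    rw [connection_apply, c1] at h
    exact h
  rw [FramedGeometry.R_apply, framedGeometry_br]
  simp only [framedGeometry_nab, smoothFields.sub_apply, connection_apply, c1, c2, bracket_apply,
    restrictField_apply, curvatureField]
  rw [mlieBracket_congr (extField_restrictField_eventuallyEq hO U hU x)
    (extField_restrictField_eventuallyEq hO V hV x)]

include hO he hn in
theorem trilinear_apply_eq (T : smoothFields I O →ₗ[smoothFunctions I O] smoothFields I O
      →ₗ[smoothFunctions I O] smoothFields I O →ₗ[smoothFunctions I O] smoothFields I O)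
    {U U' V V' W W' : smoothFields I O} {x : O} (hU : U.1 x = U'.1 x) (hV : V.1 x = V'.1 x)
    (hW : W.1 x = W'.1 x) : (T U V W).1 x = (T U' V' W').1 x :=
  ((apply_eq_of_apply_eq hO he hn (T U V) hW).trans
    (apply_eq_of_apply_eq hO he hn ((T U).flip W') hV)).trans
    (apply_eq_of_apply_eq hO he hn ((T.flip V').flip W') hU)

/-- Every tangent vector extends to a smooth field near its base point. -/
theorem exists_contMDiffOn_extend_subset (hO : IsOpen O) (x : O) (u : Fin 3 → TangentSpace I (x : M)) :
    ∃ s : Set M, IsOpen s ∧ (x : M) ∈ s ∧ s ⊆ O ∧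
      ∀ i, CMDiff[s] ∞ (T% (FiberBundle.extend E (u i))) := by
  choose t ht h using fun i => FiberBundle.exists_contMDiffOn_extend (k := ∞) I E (u i)
  obtain ⟨s, hs, hso, hx⟩ := mem_nhds_iff.1
    (Filter.inter_mem (hO.mem_nhds x.2) (Filter.iInter_mem.2 ht))
  exact ⟨s, hso, hx, fun y hy => (hs hy).1,
    fun i => (h i).mono fun y hy => Set.mem_iInter.1 (hs hy).2 i⟩

/-- The pointwise curvature uses extensions that are smooth only near x. On a smaller open set the
given fields and these extensions are all smooth, and tensoriality compares the two curvatures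
there. -/
theorem framedGeometry_R_apply (U V W : smoothFields I O) (x : O) :
    ((framedGeometry hO he hn).R U V W).1 x = curvature I (x : M) (U.1 x) (V.1 x) (W.1 x) := by
  obtain ⟨s, hs, hx, hsO, h⟩ := exists_contMDiffOn_extend_subset hO x ![U.1 x, V.1 x, W.1 x]
  have hu : CMDiff[s] ∞ (T% (FiberBundle.extend E (U.1 x))) := h 0
  have hv : CMDiff[s] ∞ (T% (FiberBundle.extend E (V.1 x))) := h 1
  have hw : CMDiff[s] ∞ (T% (FiberBundle.extend E (W.1 x))) := h 2
  have he' := he.mono hsO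
  rw [curvature, ← framedGeometry_R_restrictField hs he' hn hu hv hw ⟨x, hx⟩]
  conv_lhs => rw [← restrictField_extField U, ← restrictField_extField V,
    ← restrictField_extField W, framedGeometry_R_restrictField,
    ← framedGeometry_R_restrictField hs he' hn ((contMDiffOn_extField U).mono hsO)
      ((contMDiffOn_extField V).mono hsO) ((contMDiffOn_extField W).mono hsO) ⟨x, hx⟩]
  apply trilinear_apply_eq hs he' hn
  all_goals
    rw [restrictField_apply, restrictField_apply, extField_coe, FiberBundle.extend_apply_self]

theorem framedGeometry_ric_apply (U V : smoothFields I O) (x : O) :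
    ((framedGeometry hO he hn).ric U V).1 x = ricci I (x : M) (U.1 x) (V.1 x) := by
  rw [FramedGeometry.ric_eq_sum_curvatureForm, smoothFunctions.sum_apply, ricci]
  refine (sum_stdOrthonormalBasis hO he hn ((framedGeometry hO he hn).curvatureForm U V) x
    (fun w w' => inner ℝ (curvature I (x : M) w (U.1 x) (V.1 x)) w') fun W W' => ?_).symm
  rw [FramedGeometry.curvatureForm_apply, framedGeometry_g_apply, framedGeometry_R_apply]

theorem framedGeometry_scal_apply (x : O) :
    ((framedGeometry hO he hn).scal).1 x = scalarCurvature I (x : M) := by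
  rw [FramedGeometry.scal, smoothFunctions.sum_apply, scalarCurvature]
  exact (sum_stdOrthonormalBasis hO he hn (framedGeometry hO he hn).ric x (ricci I (x : M))
    fun U V => (framedGeometry_ric_apply hO he hn U V x).symm).symm

end
end AlmostKenmotsu

/-! ### The contact structure and the Lie derivative of φ on smooth fields. -/

namespace FramedGeometry

variable {A 𝔛 : Type*} [CommRing A] [AddCommGroup 𝔛] [Module A 𝔛] {n : ℕ}
  (G : FramedGeometry A 𝔛 n)

/-- The Lie derivative `U ↦ [ξ, φ U] - φ [ξ, U]` of an endomorphism. -/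
def lieEnd (ξ : 𝔛) (φ : 𝔛 →ₗ[A] 𝔛) : 𝔛 →ₗ[A] 𝔛 where
  toFun U := G.br ξ (φ U) - φ (G.br ξ U)
  map_add' U V := by simp only [map_add, br_add]; abel
  map_smul' a U := by
    simp only [map_smul, br_smul, map_add, RingHom.id_apply]
    module

theorem lieEnd_apply (ξ : 𝔛) (φ : 𝔛 →ₗ[A] 𝔛) (U : 𝔛) :
    G.lieEnd ξ φ U = G.br ξ (φ U) - φ (G.br ξ U) := rfl

end FramedGeometry

namespace AlmostKenmotsu

noncomputable section

variable {E : Type*} [NormedAddCommGroup E] [NormedSpace ℝ E] [FiniteDimensional ℝ E]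
  [CompleteSpace E]
  {H : Type*} [TopologicalSpace H] {I : ModelWithCorners ℝ E H}
  {M : Type*} [TopologicalSpace M] [ChartedSpace H M] [IsManifold I ∞ M]
  [RiemannianBundle (fun x : M => TangentSpace I x)]
  [IsContMDiffRiemannianBundle I ∞ E (fun x : M => TangentSpace I x)]
  {φ : Π x : M, TangentSpace I x →L[ℝ] TangentSpace I x}
  {ξ : Π x : M, TangentSpace I x} {η : Π x : M, TangentSpace I x →L[ℝ] ℝ}

namespace IsAlmostContactMetric

variable (h : IsAlmostContactMetric I φ ξ η)
include h

/-- From φ²ξ = 0, the identity for φ² at φξ reads φξ = cξ with c = η(φξ); applying φ once more gives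
c²ξ = 0. -/
theorem phi_xi (x : M) : φ x (ξ x) = 0 := by
  have e1 := h.phi_phi x (ξ x)
  rw [h.eta_xi, one_smul, neg_add_cancel] at e1
  have e2 := h.phi_phi x (φ x (ξ x))
  rw [e1, map_zero] at e2
  have e3 : φ x (ξ x) = η x (φ x (ξ x)) • ξ x := by
    rw [eq_comm, ← sub_eq_zero, e2]; abel
  have e4 : (η x (φ x (ξ x)) * η x (φ x (ξ x))) • ξ x = 0 := by
    rw [mul_smul, ← e3, ← map_smul, ← e3, e1]
  have e5 := congrArg (η x) e4
  rw [map_smul, h.eta_xi, map_zero, smul_eq_mul, mul_one, mul_self_eq_zero] at e5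
  rw [e3, e5, zero_smul]

theorem eta_phi (x : M) (u : TangentSpace I x) : η x (φ x u) = 0 := by
  have e3 := h.phi_phi x (φ x u)
  have e4 := congrArg (φ x) (h.phi_phi x u)
  rw [map_add, map_neg, map_smul, h.phi_xi, smul_zero, add_zero] at e4
  rw [e4] at e3
  have e5 : η x (φ x u) • ξ x = 0 := by simpa using e3.symm
  have e6 := congrArg (η x) e5
  simpa [h.eta_xi] using e6

theorem eta_eq (x : M) (u : TangentSpace I x) : η x u = inner ℝ u (ξ x) := by
  have e := h.inner_phi x u (ξ x)
  rw [h.phi_xi, inner_zero_right, h.eta_xi] at e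
  linarith

theorem inner_xi (x : M) : inner ℝ (ξ x) (ξ x) = (1 : ℝ) := by
  rw [← h.eta_eq, h.eta_xi]

theorem inner_phi_left (x : M) (u v : TangentSpace I x) :
    inner ℝ (φ x u) v = -inner ℝ u (φ x v) := by
  have e := h.inner_phi x u (φ x v)
  rw [h.phi_phi, inner_add_right, inner_neg_right, inner_smul_right, ← h.eta_eq] at e
  rw [h.eta_phi, h.eta_phi] at e
  linarith

theorem contMDiffOn_phi {O : Set M} {U : Π x : M, TangentSpace I x} (hU : CMDiff[O] ∞ (T% U)) :
    CMDiff[O] ∞ (T% (fun x => φ x (U x))) :=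
  ContMDiffOn.clm_bundle_apply (E₁ := fun x : M => TangentSpace I x)
    (E₂ := fun x : M => TangentSpace I x) (b := fun x : M => x) (ϕ := φ) (v := U)
    h.smooth_phi.contMDiffOn hU

/-- The action of `φ` on smooth fields. -/
def endField (O : Set M) : smoothFields I O →ₗ[smoothFunctions I O] smoothFields I O where
  toFun U := restrictField (fun x => φ x (extField U x))
    (h.contMDiffOn_phi (contMDiffOn_extField U))
  map_add' U V := smoothFields.eq_of_apply fun x => by simp
  map_smul' a U := smoothFields.eq_of_apply fun x => by simp

@[simp] theorem endField_apply {O : Set M} (U : smoothFields I O) (x : O) :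
    (h.endField O U).1 x = φ x (U.1 x) := by
  change φ x (extField U x) = _
  rw [extField_coe]

/-- The Reeb field on `O`. -/
def reeb (O : Set M) : smoothFields I O := restrictField ξ h.smooth_xi.contMDiffOn

@[simp] theorem reeb_apply {O : Set M} (x : O) : (h.reeb O).1 x = ξ x := rfl

variable {O : Set M} {n : ℕ} {e : Fin n → Π x : M, TangentSpace I x}
  (hO : IsOpen O) (he : IsOrthonormalFrameOn I e O) (hn : 0 < n)

theorem lieEnd_restrictField {U : Π x : M, TangentSpace I x} (hU : CMDiff[O] ∞ (T% U)) (x : O) :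
    ((framedGeometry hO he hn).lieEnd (h.reeb O) (h.endField O) (restrictField U hU)).1 x
      = mlieBracket I ξ (fun y => φ y (U y)) (x : M) - φ x (mlieBracket I ξ U (x : M)) := by
  have hξ := extField_restrictField_eventuallyEq hO ξ h.smooth_xi.contMDiffOn x
  have hφ : ∀ᶠ y in nhds (x : M), extField (h.endField O (restrictField U hU)) y = φ y (U y) := by
    filter_upwards [hO.mem_nhds x.2] with y hy
    have e := extField_coe (h.endField O (restrictField U hU)) ⟨y, hy⟩
    rw [endField_apply] at e
    exact e
  rw [FramedGeometry.lieEnd_apply, framedGeometry_br, framedGeometry_br, smoothFields.sub_apply,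
    endField_apply, bracket_apply, bracket_apply, reeb, mlieBracket_congr hξ hφ,
    mlieBracket_congr hξ (extField_restrictField_eventuallyEq hO U hU x)]

/-- As for the curvature: shrink to a set where the extension used by `hTensor` is smooth, then use
tensoriality. -/
theorem lieEnd_apply (U : smoothFields I O) (x : O) :
    ((framedGeometry hO he hn).lieEnd (h.reeb O) (h.endField O) U).1 x
      = (2 : ℝ) • hTensor I φ ξ (x : M) (U.1 x) := by
  obtain ⟨s, hs, hx, hsO, hu⟩ := exists_contMDiffOn_extend_subset hO x fun _ => U.1 x
  have he' := he.mono hsO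
  rw [hTensor, smul_smul, show (2 : ℝ) * (1 / 2) = 1 by norm_num, one_smul,
    ← h.lieEnd_restrictField hs he' hn (hu 0) ⟨x, hx⟩]
  conv_lhs => rw [← restrictField_extField U, lieEnd_restrictField,
    ← h.lieEnd_restrictField hs he' hn ((contMDiffOn_extField U).mono hsO) ⟨x, hx⟩]
  apply apply_eq_of_apply_eq hs he' hn
  rw [restrictField_apply, restrictField_apply, extField_coe, FiberBundle.extend_apply_self]

end IsAlmostContactMetric
end
end AlmostKenmotsu

/-! ### Translation of the structure equations: exterior and Lie derivatives through ∇. -/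

namespace FramedGeometry

variable {A 𝔛 : Type*} [CommRing A] [AddCommGroup 𝔛] [Module A 𝔛] {n : ℕ}
  {G : FramedGeometry A 𝔛 n}

theorem closed_of_extDeriv {ξ U V : 𝔛}
    (h : G.D U (G.g V ξ) - G.D V (G.g U ξ) - G.g (G.br U V) ξ = 0) :
    G.g (G.nab U ξ) V = G.g (G.nab V ξ) U := by
  rw [G.D_g, G.D_g, br, map_sub, LinearMap.sub_apply] at h
  rw [G.g_symm (G.nab U ξ), G.g_symm (G.nab V ξ)]
  linear_combination h

theorem covEnd_of_extDeriv {φ : 𝔛 →ₗ[A] 𝔛} (hφ : ∀ U V, G.g (φ U) V = -G.g U (φ V)) {U V W : 𝔛}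
    {c : A} (h : G.D U (G.g V (φ W)) - G.D V (G.g U (φ W)) + G.D W (G.g U (φ V))
      - G.g (G.br U V) (φ W) + G.g (G.br U W) (φ V) - G.g (G.br V W) (φ U) = c) :
    G.g V (G.covEnd φ U W) - G.g U (G.covEnd φ V W) + G.g U (G.covEnd φ W V) = c := by
  have e1 := hφ V (G.nab U W)
  have e2 := hφ U (G.nab V W)
  have e3 := hφ U (G.nab W V)
  rw [G.g_symm (φ V)] at e1
  rw [G.g_symm (φ U)] at e2 e3
  simp only [G.D_g, br, map_sub, LinearMap.sub_apply] at h
  simp only [covEnd_apply, map_sub]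
  linear_combination h - e1 + e2 - e3

theorem lieDeriv_metric (X U V : 𝔛) :
    G.D X (G.g U V) - G.g (G.br X U) V - G.g U (G.br X V)
      = G.g (G.nab U X) V + G.g U (G.nab V X) := by
  simp only [G.D_g, br, map_sub, LinearMap.sub_apply]
  ring

end FramedGeometry

namespace AlmostKenmotsu

noncomputable section

variable {E : Type*} [NormedAddCommGroup E] [NormedSpace ℝ E] [FiniteDimensional ℝ E]
  [CompleteSpace E]
  {H : Type*} [TopologicalSpace H] {I : ModelWithCorners ℝ E H}
  {M : Type*} [TopologicalSpace M] [ChartedSpace H M] [IsManifold I ∞ M]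
  [RiemannianBundle (fun x : M => TangentSpace I x)]
  [IsContMDiffRiemannianBundle I ∞ E (fun x : M => TangentSpace I x)]
  {φ : Π x : M, TangentSpace I x →L[ℝ] TangentSpace I x}
  {ξ : Π x : M, TangentSpace I x} {η : Π x : M, TangentSpace I x →L[ℝ] ℝ}
  {O : Set M} {n : ℕ} {e : Fin n → Π x : M, TangentSpace I x}
  (hO : IsOpen O) (he : IsOrthonormalFrameOn I e O) (hn : 0 < n)

theorem IsAlmostContactMetric.metric_reeb_apply (h : IsAlmostContactMetric I φ ξ η)
    (U : smoothFields I O) (x : O) :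
    ((framedGeometry hO he hn).g U (h.reeb O)).1 x = η x (U.1 x) := by
  rw [framedGeometry_g_apply, h.reeb_apply, ← h.eta_eq]

theorem IsAlmostKenmotsu.framedGeometry (h : IsAlmostKenmotsu I φ ξ η) :
    (framedGeometry hO he hn).IsAlmostKenmotsu (h.endField O) (h.reeb O) := by
  have g_phi (U V : smoothFields I O) :
      (AlmostKenmotsu.framedGeometry hO he hn).g (h.endField O U) V
        = -(AlmostKenmotsu.framedGeometry hO he hn).g U (h.endField O V) :=
    smoothFunctions.eq_of_apply fun x => by
      rw [smoothFunctions.neg_apply, framedGeometry_g_apply, framedGeometry_g_apply,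
        h.endField_apply, h.endField_apply, h.inner_phi_left]
  refine ⟨fun U => smoothFields.eq_of_apply fun x => ?_, smoothFunctions.eq_of_apply fun x => ?_,
    smoothFields.eq_of_apply fun x => ?_, g_phi, fun U V =>
    FramedGeometry.closed_of_extDeriv (smoothFunctions.eq_of_apply fun x => ?_), fun U V W =>
    FramedGeometry.covEnd_of_extDeriv g_phi (smoothFunctions.eq_of_apply fun x => ?_)⟩
  · rw [h.endField_apply, h.endField_apply, h.phi_phi, smoothFields.add_apply,
      smoothFields.neg_apply, smoothFields.smul_apply, h.metric_reeb_apply, h.reeb_apply]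
  · rw [framedGeometry_g_apply, h.reeb_apply, h.inner_xi, smoothFunctions.one_apply]
  · rw [h.endField_apply, h.reeb_apply, h.phi_xi, smoothFields.zero_apply]
  · have e1 := h.d_eta x _ _ (mdifferentiableAt_extField hO U x) (mdifferentiableAt_extField hO V x)
    rw [extDerivOneForm, extField_coe, extField_coe] at e1
    have hF (U : smoothFields I O) (y : O) : η y (extField U (y : M))
        = ((AlmostKenmotsu.framedGeometry hO he hn).g U (h.reeb O)).1 y := by
      rw [h.metric_reeb_apply, extField_coe]
    simp only [smoothFunctions.sub_apply]
    rw [framedGeometry_D_apply hO he hn _ _ (F := fun y => η y (extField V y)) (hF V),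
      framedGeometry_D_apply hO he hn _ _ (F := fun y => η y (extField U y)) (hF U),
      h.metric_reeb_apply, framedGeometry_br, bracket_apply]
    exact e1
  · have e1 := h.d_Phi x _ _ _ (mdifferentiableAt_extField hO U x)
      (mdifferentiableAt_extField hO V x) (mdifferentiableAt_extField hO W x)
    simp only [extDerivTwoForm, wedgeOneTwo, extField_coe, fundamentalForm] at e1
    have hF (U V : smoothFields I O) (y : O) :
        inner ℝ (extField U (y : M)) (φ y (extField V (y : M)))
        = ((AlmostKenmotsu.framedGeometry hO he hn).g U (h.endField O V)).1 y := by
      rw [framedGeometry_g_apply, h.endField_apply, extField_coe, extField_coe]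
    simp only [smoothFunctions.sub_apply, smoothFunctions.add_apply, smoothFunctions.mul_apply]
    rw [
      framedGeometry_D_apply hO he hn _ _
        (F := fun y => inner ℝ (extField V y) (φ y (extField W y))) (hF V W),
      framedGeometry_D_apply hO he hn _ _
        (F := fun y => inner ℝ (extField U y) (φ y (extField W y))) (hF U W),
      framedGeometry_D_apply hO he hn _ _
        (F := fun y => inner ℝ (extField U y) (φ y (extField V y))) (hF U V)]
    simp only [h.metric_reeb_apply, framedGeometry_g_apply, framedGeometry_br, bracket_apply,
      h.endField_apply]
    exact e1

theorem framedGeometry_D_algebraMap (c : ℝ) (U : smoothFields I O) :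
    (framedGeometry hO he hn).D U (algebraMap ℝ (smoothFunctions I O) c) = 0 :=
  smoothFunctions.eq_of_apply fun x => by
    rw [framedGeometry_D_apply hO he hn U _ (F := fun _ => c) fun y => rfl, mvfderiv_const]
    rfl

theorem IsKMuPrimeAlmostKenmotsu.framedGeometry {k μ : ℝ}
    (h : IsKMuPrimeAlmostKenmotsu I φ ξ η k μ) :
    (framedGeometry hO he hn).IsKMuPrime (h.endField O) (h.reeb O)
      (algebraMap ℝ (smoothFunctions I O) k) (algebraMap ℝ (smoothFunctions I O) μ) := by
  have hK := h.toIsAlmostKenmotsu.framedGeometry hO he hn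
  -- Identifies h' with `shape`: L_ξ φ evaluated at φU is twice either of them.
  have hs (U : smoothFields I O) (x : O) : hPrime I φ ξ (x : M) (U.1 x)
      = ((AlmostKenmotsu.framedGeometry hO he hn).shape (h.reeb O) U).1 x := by
    have e1 := h.lieEnd_apply hO he hn (h.endField O U) x
    rw [FramedGeometry.lieEnd_apply, hK.lie_phi, h.endField_apply, smoothFields.smul_apply] at e1
    exact (smul_right_injective _ (two_ne_zero (α := ℝ)) e1).symm
  refine ⟨hK, framedGeometry_D_algebraMap hO he hn k, fun U V => smoothFields.eq_of_apply fun x => ?_⟩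
  rw [framedGeometry_R_apply, h.reeb_apply, h.nullity]
  simp only [smoothFields.add_apply, smoothFields.sub_apply, smoothFields.smul_apply,
    smoothFunctions.algebraMap_apply, h.metric_reeb_apply, hs]

end
end AlmostKenmotsu

/-! ### Conformal fields and solitons on an open set; the local theorem. -/

namespace AlmostKenmotsu

noncomputable section

variable {E : Type*} [NormedAddCommGroup E] [NormedSpace ℝ E] [FiniteDimensional ℝ E]
  [CompleteSpace E]
  {H : Type*} [TopologicalSpace H] {I : ModelWithCorners ℝ E H}
  {M : Type*} [TopologicalSpace M] [ChartedSpace H M] [IsManifold I ∞ M]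
  [RiemannianBundle (fun x : M => TangentSpace I x)]
  [IsContMDiffRiemannianBundle I ∞ E (fun x : M => TangentSpace I x)]
  {φ : Π x : M, TangentSpace I x →L[ℝ] TangentSpace I x}
  {ξ : Π x : M, TangentSpace I x} {η : Π x : M, TangentSpace I x →L[ℝ] ℝ}

/-- Real functions have no nilpotents; this turns ρ³ = 0 into ρ = 0. -/
instance (O : Set M) : IsReduced (smoothFunctions I O) :=
  isReduced_of_injective (smoothFunctions I O).val Subtype.val_injective

section
variable {O : Set M} {n : ℕ} {e : Fin n → Π x : M, TangentSpace I x}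
  (hO : IsOpen O) (he : IsOrthonormalFrameOn I e O) (hn : 0 < n)

theorem lieDerivMetric_eq {X : Π x : M, TangentSpace I x} (hX : CMDiff[O] ∞ (T% X))
    (U V : smoothFields I O) (x : O) :
    lieDerivMetric I X (extField U) (extField V) (x : M)
      = ((framedGeometry hO he hn).g ((framedGeometry hO he hn).nab U (restrictField X hX)) V
        + (framedGeometry hO he hn).g U
          ((framedGeometry hO he hn).nab V (restrictField X hX))).1 x := by
  have hr := extField_restrictField_eventuallyEq hO X hX x
  rw [← FramedGeometry.lieDeriv_metric, smoothFunctions.sub_apply, smoothFunctions.sub_apply,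
    framedGeometry_D_apply hO he hn _ _ (F := fun y => inner ℝ (extField U y) (extField V y))
      fun y => by rw [framedGeometry_g_apply, extField_coe, extField_coe],
    framedGeometry_g_apply, framedGeometry_g_apply, framedGeometry_br, framedGeometry_br,
    bracket_apply, bracket_apply, mlieBracket_congr hr (.of_forall fun _ => rfl),
    mlieBracket_congr hr (.of_forall fun _ => rfl), restrictField_apply, lieDerivMetric,
    extField_coe, extField_coe]

theorem IsConformalVectorField.framedGeometry {X : Π x : M, TangentSpace I x} {ρ : M → ℝ}
    (hX : IsConformalVectorField I X ρ) :
    (framedGeometry hO he hn).IsConformal (restrictField X hX.smooth_field.contMDiffOn)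
      (restrictFun ρ hX.smooth_factor.contMDiffOn) := fun U V =>
  smoothFunctions.eq_of_apply fun x => by
    rw [← lieDerivMetric_eq, hX.lieDeriv_eq _ _ _ (mdifferentiableAt_extField hO U x)
      (mdifferentiableAt_extField hO V x), smoothFunctions.mul_apply, framedGeometry_g_apply,
      extField_coe, extField_coe]
    rfl

theorem IsEtaRicciYamabeSoliton.framedGeometry {X : Π x : M, TangentSpace I x} {ρ : M → ℝ}
    {α β lam ν : ℝ} (h : IsAlmostContactMetric I φ ξ η) (hX : IsConformalVectorField I X ρ)
    (hS : IsEtaRicciYamabeSoliton I η X α β lam ν) (U V : smoothFields I O) :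
    2 * restrictFun ρ hX.smooth_factor.contMDiffOn * (framedGeometry hO he hn).g U V
      + 2 * algebraMap ℝ (smoothFunctions I O) α * (framedGeometry hO he hn).ric U V
      + (2 * algebraMap ℝ (smoothFunctions I O) lam
        - algebraMap ℝ (smoothFunctions I O) β * (framedGeometry hO he hn).scal)
          * (framedGeometry hO he hn).g U V
      + 2 * algebraMap ℝ (smoothFunctions I O) ν * ((framedGeometry hO he hn).g U (h.reeb O)
        * (framedGeometry hO he hn).g V (h.reeb O)) = 0 :=
  smoothFunctions.eq_of_apply fun x => by
    have hU := mdifferentiableAt_extField hO U x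
    have hV := mdifferentiableAt_extField hO V x
    have e := hS x _ _ hU hV
    rw [hX.lieDeriv_eq _ _ _ hU hV, extField_coe, extField_coe] at e
    simp only [smoothFunctions.add_apply, smoothFunctions.sub_apply, smoothFunctions.mul_apply,
      smoothFunctions.algebraMap_apply, h.metric_reeb_apply, framedGeometry_g_apply,
      framedGeometry_ric_apply, framedGeometry_scal_apply, restrictFun_apply]
    exact e

theorem eq_zero_of_metric_self {U : smoothFields I O}
    (h : (framedGeometry hO he hn).g U U = 0) : U = 0 :=
  smoothFields.eq_of_apply fun x => by
    have e := congrArg (fun f : smoothFunctions I O => f.1 x) h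
    simp only [framedGeometry_g_apply] at e
    exact inner_self_eq_zero.1 e

theorem nonneg_of_sum_metric_self (p : O) (Y : Fin n → smoothFields I O) (s : ℝ)
    (h : ∑ i, (framedGeometry hO he hn).g (Y i) (Y i) = algebraMap ℝ (smoothFunctions I O) s) :
    0 ≤ s := by
  have e := congrArg (fun f : smoothFunctions I O => f.1 p) h
  simp only [smoothFunctions.sum_apply, framedGeometry_g_apply,
    smoothFunctions.algebraMap_apply] at e
  rw [← e]
  exact Finset.sum_nonneg fun i _ => real_inner_self_nonneg

end

/-- A conformal `η`-Ricci-Yamabe soliton on a `(k, μ)'`-almost Kenmotsu manifold, near a point. -/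
theorem conformal_soliton_at {m : ℕ} (hm : 1 ≤ m) (hE : Module.finrank ℝ E = 2 * m + 1)
    {k μ : ℝ} (hN : IsKMuPrimeAlmostKenmotsu I φ ξ η k μ) {X : Π x : M, TangentSpace I x}
    {ρ : M → ℝ} (hX : IsConformalVectorField I X ρ) {α β lam ν : ℝ}
    (hS : IsEtaRicciYamabeSoliton I η X α β lam ν) (p : M) :
    ρ p = 0 ∧ lam = β * m * (k - 2 * m) + 2 * m * α ∧ ν = -2 * m * α * (k + 1)
      ∧ (α ≠ 0 → ∀ u v : TangentSpace I p, ricci I p u v = -(2 * m) * inner ℝ u v) := by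
  obtain ⟨O, e, hO, hp, he⟩ := exists_isOrthonormalFrameOn (I := I) p hE
  have hn : 0 < 2 * m + 1 := Nat.succ_pos _
  -- Makes the algebra of smooth functions nontrivial, so that real constants embed into it.
  have : Nonempty O := ⟨⟨p, hp⟩⟩
  obtain ⟨h1, h2, h3, h4⟩ := FramedGeometry.conformal_soliton hm
    (fun U c => framedGeometry_D_algebraMap hO he hn c U)
    (fun U => eq_zero_of_metric_self hO he hn) (nonneg_of_sum_metric_self hO he hn ⟨p, hp⟩)
    (hN.framedGeometry hO he hn) (hX.framedGeometry hO he hn)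
    (hS.framedGeometry hO he hn hN.toIsAlmostContactMetric hX)
  refine ⟨congrArg (fun f : smoothFunctions I O => f.1 ⟨p, hp⟩) h1, h2, h3, fun hα u v => ?_⟩
  have h5 := congrArg (fun f : smoothFunctions I O => f.1 ⟨p, hp⟩)
    (h4 hα (constField he ⟨p, hp⟩ u) (constField he ⟨p, hp⟩ v))
  simp only [framedGeometry_ric_apply, smoothFunctions.mul_apply, framedGeometry_g_apply,
    smoothFunctions.algebraMap_apply, constField_apply] at h5
  exact h5

end
end AlmostKenmotsu

/-! ### The global theorem. -/

theorem theorem5p1 (m : ℕ) (hm : 1 ≤ m)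
    {M : Type*} [TopologicalSpace M] [T2Space M] [Nonempty M]
    [ChartedSpace (EuclideanSpace ℝ (Fin (2 * m + 1))) M]
    [IsManifold (𝓡 (2 * m + 1)) ∞ M]
    [RiemannianBundle (fun x : M => TangentSpace (𝓡 (2 * m + 1)) x)]
    [IsContMDiffRiemannianBundle (𝓡 (2 * m + 1)) ∞ (EuclideanSpace ℝ (Fin (2 * m + 1)))
      (fun x : M => TangentSpace (𝓡 (2 * m + 1)) x)]
    (φ : Π x : M, TangentSpace (𝓡 (2 * m + 1)) x →L[ℝ] TangentSpace (𝓡 (2 * m + 1)) x)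
    (ξ : Π x : M, TangentSpace (𝓡 (2 * m + 1)) x)
    (η : Π x : M, TangentSpace (𝓡 (2 * m + 1)) x →L[ℝ] ℝ)
    (k μ : ℝ)
    (hN : AlmostKenmotsu.IsKMuPrimeAlmostKenmotsu (𝓡 (2 * m + 1)) φ ξ η k μ)
    (X : Π x : M, TangentSpace (𝓡 (2 * m + 1)) x) (ρ : M → ℝ)
    (hX : AlmostKenmotsu.IsConformalVectorField (𝓡 (2 * m + 1)) X ρ)
    (α β lam ν : ℝ)
    (hS : AlmostKenmotsu.IsEtaRicciYamabeSoliton (𝓡 (2 * m + 1)) η X α β lam ν) :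
    (∃ c : ℝ, ∀ x, ρ x = c) ∧ (∀ x, ρ x = 0) ∧
      (α ≠ 0 → AlmostKenmotsu.IsEinstein (𝓡 (2 * m + 1)) M) ∧
      (∀ x, lam = β * m * (k - 2 * m) - ρ x + 2 * m * α) ∧
      ν = -2 * m * α * (k + 1) := by
  have key := AlmostKenmotsu.conformal_soliton_at hm (finrank_euclideanSpace_fin) hN hX hS
  have hρ (x : M) : ρ x = 0 := (key x).1
  -- The Einstein constant -2m is the same at every point, so connectedness plays no role. The
  -- formula for ν needs one point, which nonemptiness provides.
  refine ⟨⟨0, hρ⟩, hρ, fun hα => ⟨-(2 * m), fun x => (key x).2.2.2 hα⟩, fun x => ?_,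
    (key (Classical.arbitrary M)).2.2.1⟩
  rw [hρ, sub_zero]
  exact (key x).2.1
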